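/- Let $\pi\colon Y\to X$ be a smooth fibered manifold (a surjective submersion) with $\dim X=n$, $\dim Y=n+m$, and let $(x^\lambda,y^i)$ denote charts of $Y$ adapted to $\pi$, with induced jet coordinates $(x^\lambda,y^i_\sigma)$, $\partial_i^\sigma=\partial/\partial y^i_\sigma$, total derivatives $D_\lambda=\partial_\lambda+y^i_{\sigma+\lambda}\partial_i^\sigma$, iterated total derivatives $D_\sigma$ ($\sigma$ a multi-index), and $v_X=dx^1\wedge\dots\wedge dx^n$. For a smooth Lagrangian $\lambda\colon J_rY\to\wedge^nT^*X$ of arbitrary order $r\ge 0$, locally $\lambda=L\,v_X$, let $$\mathcal E(\lambda)\colon J_{2r}Y\to V^*Y\otimes\wedge^nT^*X,\qquad \mathcal E(\lambda)=\mathcal E(\lambda)_i\,\omega^i\otimes v_X,\quad \mathcal E(\lambda)_i=\sum_{|\sigma|\le r}(-1)^{|\sigma|}D_\sigma\,\partial_i^\sigma L,$$ be its Euler--Lagrange morphism ($\omega^i$ being the vertical covector dual to $\partial_i$). A smooth local section $s$ of $\pi$ is critical if $\mathcal E(\lambda)\circ j_{2r}s=0$. For vertical vector fields $\Xi_1,\Xi_2$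 on $Y$, the second quotient variation (Hessian morphism) is $\Xi_1\rfloor\mathcal E(\Xi_2\rfloor\mathcal E(\lambda))\colon J_{4r}Y\to\wedge^nT^*X$. The vertical differential $V\mathcal E(\lambda)$ has in an adapted chart the components $\partial_i^\sigma\mathcal E(\lambda)_j$; it acts on vertical fields $\Xi=\Xi^i\partial_i$ through prolongation by $\nabla(\Xi)_j=\sum_{i,\sigma}D_\sigma\Xi^i\;\partial_i^\sigma\mathcal E(\lambda)_j$, and its adjoint $V\mathcal E(\lambda)^*$ acts by $\nabla^*(\Xi)_i=\sum_{j,\sigma}(-1)^{|\sigma|}D_\sigma\big(\Xi^j\,\partial_i^\sigma\mathcal E(\lambda)_j\big)$. Theorem. Let $s$ be a critical section of $\lambda$ and let $\Xi_1,\Xi_2$ be smooth vertical vector fields on $Y$. Then at every point $x$ of the domain of $s$ and in every adapted chart around $s(x)$, evaluated along $js$, $$\Xi_1\rfloor\mathcal E(\Xi_2\rfloor\mathcal E(\lambda)) =\Big(\sum_{j}\Xi_1^j\,\nabla(\Xi_2)_j\Big)v_X=\Xi_1\rfloor j\Xi_2\rfloor V\mathcal E(\lambda),$$ $$\Xi_1\rfloor\mathcal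 E(\Xi_2\rfloor\mathcal E(\lambda)) =\Big(\sum_{i}\Xi_1^i\,\nabla^*(\Xi_2)_i\Big)v_X=\Xi_1\rfloor j\Xi_2\rfloor V\mathcal E(\lambda)^*.$$ In particular the right-hand sides do not depend on the adapted chart. Moreover $V\mathcal E(\lambda)$ is self-adjoint along $s$: $\nabla(\Xi_2)_i=\nabla^*(\Xi_2)_i$ along $js$, for every $i$. -/

import Mathlib

open Set Filter
open scoped Topology Manifold ContDiff

noncomputable section

namespace SecondVariation

/-- The model space `ℝⁿ`. -/
abbrev Euc (n : ℕ) := EuclideanSpace ℝ (Fin n)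

/-! ### Multi-indices and calculus in jet coordinates -/

/-- The multi-indices `σ ∈ ℕⁿ` of length `|σ| ≤ k`. -/
def multiIndices (n k : ℕ) : Finset (Fin n → ℕ) :=
  (Fintype.piFinset fun _ => Finset.range (k + 1)).filter fun σ => ∑ l, σ l ≤ k

lemma mem_multiIndices {n k : ℕ} {σ : Fin n → ℕ} : σ ∈ multiIndices n k ↔ ∑ l, σ l ≤ k := by
  simp only [multiIndices, Finset.mem_filter, Fintype.mem_piFinset, Finset.mem_range,
    and_iff_right_iff_imp]
  intro h l
  have := Finset.single_le_sum (f := σ) (fun _ _ => Nat.zero_le _) (Finset.mem_univ l)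
  omega

/-- The composite `D₀^σ₀ ∘ D₁^σ₁ ∘ ⋯` of (commuting) operators `D₀, …, Dₙ₋₁`. -/
def iterOp {n : ℕ} {α : Type*} (D : Fin n → α → α) (σ : Fin n → ℕ) : α → α :=
  (List.finRange n).foldr (fun l g => (D l)^[σ l] ∘ g) id

/-- The partial derivative `∂_σ f = ∂^{|σ|} f / ∂x^σ` of a function on `ℝⁿ`. -/
def partialDeriv {n : ℕ} (σ : Fin n → ℕ) (f : Euc n → ℝ) : Euc n → ℝ :=
  iterOp (fun l g u => fderiv ℝ g u (EuclideanSpace.single l 1)) σ f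

/-- Coordinates `(x^λ, y^i_σ)` on jets of all orders; a function on `k`-jets is a function that
depends only on `x` and on the `y^i_σ` with `|σ| ≤ k`. -/
abbrev JetCoord (n m : ℕ) := Euc n × (Fin m → (Fin n → ℕ) → ℝ)

/-- The point `(x, y)` below a point of the jet coordinate space, where `y^i = y^i_0`. -/
def JetCoord.point {n m : ℕ} (p : JetCoord n m) : Euc n × Euc m :=
  (p.1, WithLp.toLp 2 fun i => p.2 i 0)

/-- `∂f/∂x^l` in jet coordinates. -/
def dBase {n m : ℕ} (l : Fin n) (f : JetCoord n m → ℝ) : JetCoord n m → ℝ :=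
  fun p => lineDeriv ℝ f p (EuclideanSpace.single l 1, 0)

/-- `∂_i^σ f = ∂f/∂y^i_σ` in jet coordinates. -/
def dFiber {n m : ℕ} (i : Fin m) (σ : Fin n → ℕ) (f : JetCoord n m → ℝ) : JetCoord n m → ℝ :=
  fun p => lineDeriv ℝ f p (0, Pi.single i (Pi.single σ 1))

/-- The total derivative `D_l f = ∂_l f + y^i_{σ+l} ∂_i^σ f`; the sum over `σ` is finite for a
function of finite order. -/
def totalDeriv {n m : ℕ} (l : Fin n) (f : JetCoord n m → ℝ) : JetCoord n m → ℝ :=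
  fun p => dBase l f p + ∑ i, ∑ᶠ σ : Fin n → ℕ, p.2 i (σ + Pi.single l 1) * dFiber i σ f p

/-- The iterated total derivative `D_σ f`. -/
def totalDerivs {n m : ℕ} (σ : Fin n → ℕ) (f : JetCoord n m → ℝ) : JetCoord n m → ℝ :=
  iterOp totalDeriv σ f

/-- The Euler--Lagrange expression `∑_{|σ| ≤ k} (-1)^{|σ|} D_σ (∂_i^σ f)` of a function `f` of
order `k`. -/
def eulerExpr {n m : ℕ} (k : ℕ) (f : JetCoord n m → ℝ) (i : Fin m) : JetCoord n m → ℝ :=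
  fun p => ∑ σ ∈ multiIndices n k, (-1) ^ (∑ l, σ l) * totalDerivs σ (dFiber i σ f) p

/-- Components `α_{ij}^σ` of a local form `α_{ij}^σ ω^i_σ ⊗ ω^j ⊗ v_X`. -/
abbrev FormComp (n m : ℕ) := Fin m → Fin m → (Fin n → ℕ) → JetCoord n m → ℝ

/-- The operator in total derivatives `∇_α(ξ)_j = D_σ ξ^i α_{ij}^σ` of a form with `|σ| ≤ k`. -/
def nabla {n m : ℕ} (k : ℕ) (α : FormComp n m) (ξ : Fin m → JetCoord n m → ℝ) (j : Fin m) :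
    JetCoord n m → ℝ :=
  fun p => ∑ i, ∑ σ ∈ multiIndices n k, totalDerivs σ (ξ i) p * α i j σ p

/-- The adjoint operator `∇_α^*(ξ)_i = (-1)^{|σ|} D_σ (α_{ij}^σ ξ^j)` of a form with
`|σ| ≤ k`. -/
def nablaAdjoint {n m : ℕ} (k : ℕ) (α : FormComp n m) (ξ : Fin m → JetCoord n m → ℝ)
    (i : Fin m) : JetCoord n m → ℝ :=
  fun p => ∑ j, ∑ σ ∈ multiIndices n k,
    (-1) ^ (∑ l, σ l) * totalDerivs σ (fun q => α i j σ q * ξ j q) p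

/-! ### Fibered manifolds, adapted charts, sections -/

/-- A fibered manifold `π : Y → X` (a surjective submersion), `dim X = n`, `dim Y = n + m`. -/
structure FiberedManifold (n m : ℕ) (X Y : Type*)
    [TopologicalSpace X] [ChartedSpace (Euc n) X]
    [TopologicalSpace Y] [ChartedSpace (Euc n × Euc m) Y] where
  proj : Y → X
  surjective : Function.Surjective proj
  submersion : Manifold.IsSubmersion 𝓘(ℝ, Euc n × Euc m) 𝓘(ℝ, Euc n) ∞ proj

section

variable {n m : ℕ} {X Y : Type*}
  [TopologicalSpace X] [ChartedSpace (Euc n) X] [IsManifold 𝓘(ℝ, Euc n) ∞ X]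
  [TopologicalSpace Y] [ChartedSpace (Euc n × Euc m) Y]
  [IsManifold 𝓘(ℝ, Euc n × Euc m) ∞ Y]

/-- A chart `(x^λ, y^i)` of `Y` adapted to `π`, with the chart `(x^λ)` of `X` below it. -/
structure AdaptedChart (π : FiberedManifold n m X Y) where
  base : OpenPartialHomeomorph X (Euc n)
  total : OpenPartialHomeomorph Y (Euc n × Euc m)
  base_mem : base ∈ IsManifold.maximalAtlas 𝓘(ℝ, Euc n) ∞ X
  total_mem : total ∈ IsManifold.maximalAtlas 𝓘(ℝ, Euc n × Euc m) ∞ Y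
  proj_mem : ∀ y ∈ total.source, π.proj y ∈ base.source
  fst_total : ∀ y ∈ total.source, (total y).1 = base (π.proj y)

/-- A smooth local section of `π` (the values outside `domain` are irrelevant). -/
structure LocalSection (π : FiberedManifold n m X Y) where
  domain : Set X
  isOpen_domain : IsOpen domain
  toFun : X → Y
  smooth : ContMDiffOn 𝓘(ℝ, Euc n) 𝓘(ℝ, Euc n × Euc m) ∞ toFun domain
  isSection : ∀ x ∈ domain, π.proj (toFun x) = x

/-- The vertical space `V_y Y = ker T_y π`. -/
abbrev Vert (π : FiberedManifold n m X Y) (y : Y) :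
    Submodule ℝ (TangentSpace 𝓘(ℝ, Euc n × Euc m) y) :=
  LinearMap.ker (mfderiv 𝓘(ℝ, Euc n × Euc m) 𝓘(ℝ, Euc n) π.proj y).toLinearMap

/-- A smooth vertical vector field `Ξ : Y → VY`. -/
structure VerticalField (π : FiberedManifold n m X Y) where
  toFun : ∀ y : Y, Vert π y
  smooth : ContMDiff 𝓘(ℝ, Euc n × Euc m) 𝓘(ℝ, Euc n × Euc m).tangent ∞
    fun y => (⟨y, (toFun y : TangentSpace 𝓘(ℝ, Euc n × Euc m) y)⟩ :
      TangentBundle 𝓘(ℝ, Euc n × Euc m) Y)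

variable (X n) in
/-- The space `∧ⁿ T_x^* X`. -/
abbrev TopForm (x : X) := (TangentSpace 𝓘(ℝ, Euc n) x) [⋀^Fin n]→ₗ[ℝ] ℝ

/-- Around each point there is an adapted chart. -/
lemma exists_adaptedChart (π : FiberedManifold n m X Y) (y : Y) :
    ∃ c : AdaptedChart π, y ∈ c.total.source := by
  obtain ⟨F, _, _, hF⟩ := π.submersion
  have h := hF y
  have : FiniteDimensional ℝ (Euc n × F) :=
    LinearEquiv.finiteDimensional h.equiv.toLinearEquiv
  have : FiniteDimensional ℝ F :=
    FiniteDimensional.of_surjective (LinearMap.snd ℝ (Euc n) F) LinearMap.snd_surjective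
  have hr := h.equiv.toLinearEquiv.finrank_eq
  simp only [Module.finrank_prod, finrank_euclideanSpace, Fintype.card_fin] at hr
  have e : F ≃L[ℝ] Euc m := ContinuousLinearEquiv.ofFinrankEq (by
    rw [finrank_euclideanSpace, Fintype.card_fin]; omega)
  have h' := h.trans_F e
  have hfst := h'.writtenInCharts
  let t : OpenPartialHomeomorph Y (Euc n × Euc m) :=
    h'.domChart.trans h'.equiv.toHomeomorph.toOpenPartialHomeomorph
  have ht : t.source = h'.domChart.source := by simp [t]
  refine ⟨{ base := h'.codChart, total := t, base_mem := h'.codChart_mem_maximalAtlas,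
            total_mem := ?_, proj_mem := ?_, fst_total := ?_ }, ?_⟩
  · apply OpenPartialHomeomorph.mem_maximalAtlas_of_contMDiffOn
    · rw [ht]
      exact h'.equiv.contDiff.contMDiff.comp_contMDiffOn
        (contMDiffOn_of_mem_maximalAtlas h'.domChart_mem_maximalAtlas)
    · refine (contMDiffOn_symm_of_mem_maximalAtlas h'.domChart_mem_maximalAtlas).comp
        (h'.equiv.symm.contDiff.contMDiff.contMDiffOn) ?_
      intro z hz
      simpa [t] using hz
  · intro z hz
    exact h'.source_subset_preimage_source (ht ▸ hz)
  · intro z hz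
    rw [ht] at hz
    have := hfst (x := h'.domChart z) (by simpa using h'.domChart.map_source hz)
    simp only [Function.comp_apply, OpenPartialHomeomorph.extend_coe,
      OpenPartialHomeomorph.extend_coe_symm, modelWithCornersSelf_coe,
      modelWithCornersSelf_coe_symm, id_eq, h'.domChart.left_inv hz] at this
    exact this.symm
  · rw [ht]
    exact h'.mem_domChart_source

/-! ### Jets -/

namespace AdaptedChart

variable {π : FiberedManifold n m X Y} (c : AdaptedChart π)

/-- The derivative `∂_σ s^i` at `x` of the coordinate expression `s^i = y^i ∘ s` of a section. -/
def derivCoord (s : X → Y) (x : X) (i : Fin m) (σ : Fin n → ℕ) : ℝ :=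
  partialDeriv σ (fun u => (c.total (s (c.base.symm u))).2 i) (c.base x)

end AdaptedChart

/-- Contact of order `k` at `x` of two local sections: same value and, in adapted charts, same
partial derivatives of order `≤ k`. -/
def jetSetoid (π : FiberedManifold n m X Y) (k : ℕ) (x : X) :
    Setoid {s : LocalSection π // x ∈ s.domain} where
  r s t := s.1.toFun x = t.1.toFun x ∧ ∀ c : AdaptedChart π, s.1.toFun x ∈ c.total.source →
    ∀ i, ∀ σ ∈ multiIndices n k,
      c.derivCoord s.1.toFun x i σ = c.derivCoord t.1.toFun x i σ
  iseqv :=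
    { refl := fun _ => ⟨rfl, fun _ _ _ _ _ => rfl⟩
      symm := fun h => ⟨h.1.symm, fun c hc i σ hσ => (h.2 c (h.1 ▸ hc) i σ hσ).symm⟩
      trans := fun h h' => ⟨h.1.trans h'.1, fun c hc i σ hσ =>
        (h.2 c hc i σ hσ).trans (h'.2 c (h.1 ▸ hc) i σ hσ)⟩ }

/-- The fibre over `x` of the jet space `J_k Y → X`. -/
def Jet (π : FiberedManifold n m X Y) (k : ℕ) (x : X) : Type _ :=
  Quotient (jetSetoid π k x)

/-- The jet `j_k s(x)`. -/
def LocalSection.jet {π : FiberedManifold n m X Y} (s : LocalSection π) (k : ℕ) {x : X}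
    (hx : x ∈ s.domain) : Jet π k x :=
  Quotient.mk (jetSetoid π k x) ⟨s, hx⟩

/-- The projection `J_k Y → Y`. -/
def Jet.target {π : FiberedManifold n m X Y} {k : ℕ} {x : X} (j : Jet π k x) : Y :=
  Quotient.lift (s := jetSetoid π k x) (fun s => s.1.toFun x) (fun _ _ h => h.1) j

/-- A fibered morphism `J_k Y → ∧ⁿ T^*X` over `X`: a Lagrangian of order `k`, once smooth. -/
def Density (π : FiberedManifold n m X Y) (k : ℕ) :=
  ∀ x : X, Jet π k x → TopForm n X x

/-- A fibered morphism `J_k Y → V^*Y ⊗ ∧ⁿ T^*X` over `Y`. -/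
def SourceForm (π : FiberedManifold n m X Y) (k : ℕ) :=
  ∀ (x : X) (j : Jet π k x), Vert π j.target →ₗ[ℝ] TopForm n X x

/-- `Ξ ⌋ η`. -/
def SourceForm.contract {π : FiberedManifold n m X Y} {k : ℕ} (Ξ : VerticalField π)
    (η : SourceForm π k) : Density π k :=
  fun x j => η x j (Ξ.toFun j.target)

namespace AdaptedChart

variable {π : FiberedManifold n m X Y} (c : AdaptedChart π)

/-- The frame `∂_1, …, ∂_n` of `T_x X`. -/
def baseFrame (x : X) : Fin n → TangentSpace 𝓘(ℝ, Euc n) x := fun l =>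
  (mfderiv 𝓘(ℝ, Euc n) 𝓘(ℝ, Euc n) c.base x).inverse (EuclideanSpace.single l 1 : Euc n)

/-- The volume form `v_X = dx^1 ∧ ⋯ ∧ dx^n` of the chart, at `x`. -/
def volumeForm (x : X) : TopForm n X x :=
  (EuclideanSpace.basisFun (Fin n) ℝ).toBasis.det.compLinearMap
    (mfderiv 𝓘(ℝ, Euc n) 𝓘(ℝ, Euc n) c.base x).toLinearMap

/-- The differential `v ↦ v^i` at `y` of the coordinate `y^i`, on vertical vectors. -/
def vertCoord (y : Y) (i : Fin m) : Vert π y →ₗ[ℝ] ℝ :=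
  ((EuclideanSpace.proj i : Euc m →L[ℝ] ℝ).toLinearMap ∘ₗ LinearMap.snd ℝ (Euc n) (Euc m) ∘ₗ
    (mfderiv 𝓘(ℝ, Euc n × Euc m) 𝓘(ℝ, Euc n × Euc m) c.total y).toLinearMap) ∘ₗ
      (Vert π y).subtype

/-- The coordinate vector `∂_i` at `y`. -/
def fiberVec (y : Y) (i : Fin m) : TangentSpace 𝓘(ℝ, Euc n × Euc m) y :=
  (mfderiv 𝓘(ℝ, Euc n × Euc m) 𝓘(ℝ, Euc n × Euc m) c.total y).inverse
    ((0, EuclideanSpace.single i 1) : Euc n × Euc m)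

lemma fiberVec_mem {y : Y} (hy : y ∈ c.total.source) (i : Fin m) : c.fiberVec y i ∈ Vert π y := by
  have hb := c.proj_mem y hy
  have dt : c.total.MDifferentiable 𝓘(ℝ, Euc n × Euc m) 𝓘(ℝ, Euc n × Euc m) :=
    ⟨(contMDiffOn_of_mem_maximalAtlas c.total_mem).mdifferentiableOn (by simp),
      (contMDiffOn_symm_of_mem_maximalAtlas c.total_mem).mdifferentiableOn (by simp)⟩
  have db : c.base.MDifferentiable 𝓘(ℝ, Euc n) 𝓘(ℝ, Euc n) :=
    ⟨(contMDiffOn_of_mem_maximalAtlas c.base_mem).mdifferentiableOn (by simp),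
      (contMDiffOn_symm_of_mem_maximalAtlas c.base_mem).mdifferentiableOn (by simp)⟩
  have dp : MDifferentiableAt 𝓘(ℝ, Euc n × Euc m) 𝓘(ℝ, Euc n) π.proj y := by
    obtain ⟨F, _, _, hF⟩ := π.submersion
    exact (hF y).contMDiffAt.mdifferentiableAt (by simp)
  have hfst : MDifferentiableAt 𝓘(ℝ, Euc n × Euc m) 𝓘(ℝ, Euc n)
      (Prod.fst : Euc n × Euc m → Euc n) (c.total y) :=
    differentiableAt_fst.mdifferentiableAt
  have key : mfderiv 𝓘(ℝ, Euc n × Euc m) 𝓘(ℝ, Euc n) (c.base ∘ π.proj) y =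
      mfderiv 𝓘(ℝ, Euc n × Euc m) 𝓘(ℝ, Euc n) (Prod.fst ∘ c.total) y := by
    apply Filter.EventuallyEq.mfderiv_eq
    filter_upwards [c.total.open_source.mem_nhds hy] with z hz
    exact (c.fst_total z hz).symm
  rw [mfderiv_comp y (db.mdifferentiableAt hb) dp,
    mfderiv_comp y hfst (dt.mdifferentiableAt hy)] at key
  have hinv : mfderiv 𝓘(ℝ, Euc n × Euc m) 𝓘(ℝ, Euc n × Euc m) c.total y (c.fiberVec y i) =
      ((0, EuclideanSpace.single i 1) : Euc n × Euc m) := by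
    have : (mfderiv 𝓘(ℝ, Euc n × Euc m) 𝓘(ℝ, Euc n × Euc m) c.total y).IsInvertible :=
      ⟨dt.mfderiv hy, rfl⟩
    exact this.self_apply_inverse _
  have hd : mfderiv 𝓘(ℝ, Euc n × Euc m) 𝓘(ℝ, Euc n) (Prod.fst : Euc n × Euc m → Euc n)
      (c.total y) = ContinuousLinearMap.fst ℝ (Euc n) (Euc m) := by
    rw [mfderiv_eq_fderiv]
    exact fderiv_fst
  apply LinearMap.mem_ker.mpr
  apply db.mfderiv_injective hb
  have h1 := DFunLike.congr_fun key (c.fiberVec y i)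
  have h2 := congrArg (mfderiv 𝓘(ℝ, Euc n × Euc m) 𝓘(ℝ, Euc n)
    (Prod.fst : Euc n × Euc m → Euc n) (c.total y)) hinv
  have h3 := DFunLike.congr_fun hd ((0, EuclideanSpace.single i 1) : Euc n × Euc m)
  exact (h1.trans (h2.trans h3)).trans
    (map_zero (mfderiv 𝓘(ℝ, Euc n) 𝓘(ℝ, Euc n) c.base (π.proj y))).symm

/-- The component `Ξ^i` of a vertical vector field in the chart. -/
def fieldComp (Ξ : VerticalField π) (i : Fin m) : JetCoord n m → ℝ :=
  fun p => c.vertCoord (c.total.symm p.point) i (Ξ.toFun (c.total.symm p.point))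

/-- The coordinates of a `k`-jet (those of order `> k` are set to zero). -/
def jetCoord {k : ℕ} {x : X} (j : Jet π k x) : JetCoord n m :=
  (c.base x, fun i σ =>
    if σ ∈ multiIndices n k then c.derivCoord (Quotient.out j).1.toFun x i σ else 0)

/-- The polynomial of degree `k` whose derivatives at `p.1` are the `y^i_σ` of `p`. -/
def taylorPoly (k : ℕ) (p : JetCoord n m) (u : Euc n) : Euc m :=
  WithLp.toLp 2 fun i => ∑ σ ∈ multiIndices n k,
    p.2 i σ * ∏ l, (u l - p.1 l) ^ σ l / (Nat.factorial (σ l) : ℝ)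

lemma contDiff_taylorPoly (k : ℕ) (p : JetCoord n m) : ContDiff ℝ ∞ (taylorPoly k p) := by
  refine (PiLp.continuousLinearEquiv 2 ℝ (fun _ : Fin m => ℝ)).symm.contDiff.comp ?_
  refine contDiff_pi.mpr fun i => ContDiff.sum fun σ _ => contDiff_const.mul ?_
  refine contDiff_prod fun l _ => ContDiff.div_const (ContDiff.pow (ContDiff.sub ?_ contDiff_const) _) _
  exact (EuclideanSpace.proj l : Euc n →L[ℝ] ℝ).contDiff

lemma taylorPoly_self (k : ℕ) (p : JetCoord n m) :
    taylorPoly k p p.1 = WithLp.toLp 2 fun i => p.2 i 0 := by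
  simp only [taylorPoly, sub_self]
  congr 1
  funext i
  rw [Finset.sum_eq_single 0]
  · simp
  · intro σ _ hσ
    obtain ⟨l, hl⟩ := Function.ne_iff.mp hσ
    rw [Finset.prod_eq_zero (Finset.mem_univ l) (by simp [zero_pow hl]), mul_zero]
  · intro h
    exact absurd (mem_multiIndices.mpr (by simp)) h

/-- The local section whose coordinate expression is the polynomial `taylorPoly k p`. -/
def taylorSection (k : ℕ) (p : JetCoord n m) : LocalSection π where
  domain := {x | x ∈ c.base.source ∧ (c.base x, taylorPoly k p (c.base x)) ∈ c.total.target}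
  isOpen_domain := by
    have h : ContinuousOn (fun x => (c.base x, taylorPoly k p (c.base x))) c.base.source :=
      c.base.continuousOn.prodMk
        ((contDiff_taylorPoly k p).continuous.comp_continuousOn c.base.continuousOn)
    exact h.isOpen_inter_preimage c.base.open_source c.total.open_target
  toFun x := c.total.symm (c.base x, taylorPoly k p (c.base x))
  smooth := by
    refine (contMDiffOn_symm_of_mem_maximalAtlas c.total_mem).comp ?_ fun _ hx => hx.2
    have hb : ContMDiffOn 𝓘(ℝ, Euc n) 𝓘(ℝ, Euc n) ∞ c.base
        {x | x ∈ c.base.source ∧ (c.base x, taylorPoly k p (c.base x)) ∈ c.total.target} :=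
      (contMDiffOn_of_mem_maximalAtlas c.base_mem).mono fun _ hx => hx.1
    exact hb.prodMk_space ((contDiff_taylorPoly k p).contMDiff.comp_contMDiffOn hb)
  isSection := by
    rintro x ⟨hx, ht⟩
    have hs := c.total.map_target ht
    apply c.base.injOn (c.proj_mem _ hs) hx
    rw [← c.fst_total _ hs, c.total.right_inv ht]

lemma mem_taylorSection_domain (k : ℕ) {p : JetCoord n m} (hp : p.point ∈ c.total.target) :
    c.base.symm p.1 ∈ (c.taylorSection k p).domain := by
  have hs := c.total.map_target hp
  have h1 := c.fst_total _ hs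
  rw [c.total.right_inv hp] at h1
  have hb : p.1 ∈ c.base.target := by
    have := c.base.map_source (c.proj_mem _ hs)
    rwa [← h1] at this
  refine ⟨c.base.map_target hb, ?_⟩
  rw [c.base.right_inv hb, taylorPoly_self]
  exact hp

/-- The `k`-jet with coordinates `p`. -/
def jetOf (k : ℕ) {p : JetCoord n m} (hp : p.point ∈ c.total.target) :
    Jet π k (c.base.symm p.1) :=
  (c.taylorSection k p).jet k (c.mem_taylorSection_domain k hp)

lemma target_jetOf_mem (k : ℕ) {p : JetCoord n m} (hp : p.point ∈ c.total.target) :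
    (c.jetOf k hp).target ∈ c.total.source :=
  c.total.map_target (c.mem_taylorSection_domain k hp).2

open Classical in
/-- The function `f` with `L = f v_X` in the chart. -/
def densityComp {k : ℕ} (L : Density π k) : JetCoord n m → ℝ := fun p =>
  if hp : p.point ∈ c.total.target then
    L (c.base.symm p.1) (c.jetOf k hp) (c.baseFrame (c.base.symm p.1))
  else 0

open Classical in
/-- The functions `η_i` with `η = η_i ω^i ⊗ v_X` in the chart. -/
def sourceComp {k : ℕ} (η : SourceForm π k) (i : Fin m) : JetCoord n m → ℝ := fun p =>
  if hp : p.point ∈ c.total.target then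
    η (c.base.symm p.1) (c.jetOf k hp)
      ⟨c.fiberVec (c.jetOf k hp).target i, c.fiberVec_mem (c.target_jetOf_mem k hp) i⟩
      (c.baseFrame (c.base.symm p.1))
  else 0

/-- The value `f v_X` at a jet of the local `n`-form with component `f`. -/
def formAt (f : JetCoord n m → ℝ) {k : ℕ} {x : X} (j : Jet π k x) : TopForm n X x :=
  f (c.jetCoord j) • c.volumeForm x

/-- The vertical differential `Vη = ∂_i^σ η_j ω^i_σ ⊗ ω^j ⊗ v_X`, the differential of the components
of `η` along the fibres of the jet space over `X`. -/
def verticalDifferential {k : ℕ} (η : SourceForm π k) : FormComp n m :=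
  fun i j σ => dFiber i σ (c.sourceComp η j)

end AdaptedChart

/-! ### Lagrangians and the Euler--Lagrange morphism -/

/-- Coordinates on the finite-dimensional jet space `J_k Y`. -/
abbrev FinJetCoord (n m k : ℕ) := Euc n × (Fin m → ↥(multiIndices n k) → ℝ)

/-- A `k`-jet coordinate tuple, with zeros in orders `> k`. -/
def FinJetCoord.extend {n m k : ℕ} (q : FinJetCoord n m k) : JetCoord n m :=
  (q.1, fun i σ => if h : σ ∈ multiIndices n k then q.2 i ⟨σ, h⟩ else 0)

/-- Smoothness of a fibered morphism `J_k Y → ∧ⁿ T^*X`, in the charts of `J_k Y` induced by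
adapted charts. -/
def Density.IsSmooth {π : FiberedManifold n m X Y} {k : ℕ} (L : Density π k) : Prop :=
  ∀ c : AdaptedChart π, ContDiffOn ℝ ∞
    (fun q : FinJetCoord n m k => c.densityComp L q.extend)
    {q | q.extend.point ∈ c.total.target}

/-- An adapted chart around `y`. -/
def adaptedChartAt (π : FiberedManifold n m X Y) (y : Y) : AdaptedChart π :=
  (exists_adaptedChart π y).choose

/-- The Euler--Lagrange morphism `E(L) : J_{2k} Y → V^*Y ⊗ ∧ⁿ T^*X` of a Lagrangian of order `k`,
`E(L) = (-1)^{|σ|} D_σ (∂_i^σ f) ω^i ⊗ v_X` for `L = f v_X`. The expression is the same in all adapted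
charts; a chart around the target of the jet is used. -/
def eulerLagrange {π : FiberedManifold n m X Y} {k : ℕ} (L : Density π k) :
    SourceForm π (2 * k) := fun _ j =>
  let c := adaptedChartAt π j.target
  ∑ i, (c.vertCoord j.target i).smulRight
    (c.formAt (eulerExpr k (c.densityComp L) i) j)

/-- A local section is critical if `E(L) ∘ js = 0`. -/
def LocalSection.IsCritical {π : FiberedManifold n m X Y} (s : LocalSection π) {k : ℕ}
    (L : Density π k) : Prop :=
  ∀ x, ∀ hx : x ∈ s.domain, eulerLagrange L x (s.jet (2 * k) hx) = 0

/-- The Hessian morphism `Ξ₁ ⌋ E(Ξ₂ ⌋ E(L))`, i.e. the second quotient variation. -/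
def hessian {π : FiberedManifold n m X Y} {k : ℕ} (L : Density π k) (Ξ₁ Ξ₂ : VerticalField π) :
    Density π (2 * (2 * k)) :=
  (eulerLagrange ((eulerLagrange L).contract Ξ₂)).contract Ξ₁

/-- `Ξ₁ ⌋ jΞ₂ ⌋ VE(L) = Ξ₁^j D_σ Ξ₂^i ∂_i^σ E(L)_j`, the vertical differential of the
Euler--Lagrange morphism contracted with prolonged vertical fields, in a chart. -/
def jacobi {π : FiberedManifold n m X Y} (c : AdaptedChart π) {k : ℕ} (L : Density π k)
    (Ξ₁ Ξ₂ : VerticalField π) : JetCoord n m → ℝ :=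
  fun p => ∑ j, c.fieldComp Ξ₁ j p *
    nabla (2 * k) (c.verticalDifferential (eulerLagrange L)) (c.fieldComp Ξ₂) j p

/-- `Ξ₁ ⌋ jΞ₂ ⌋ VE(L)^* = (-1)^{|σ|} Ξ₁^i D_σ (Ξ₂^j ∂_i^σ E(L)_j)`, its adjoint, in a chart. -/
def jacobiAdjoint {π : FiberedManifold n m X Y} (c : AdaptedChart π) {k : ℕ} (L : Density π k)
    (Ξ₁ Ξ₂ : VerticalField π) : JetCoord n m → ℝ :=
  fun p => ∑ i, c.fieldComp Ξ₁ i p *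
    nablaAdjoint (2 * k) (c.verticalDifferential (eulerLagrange L)) (c.fieldComp Ξ₂) i p

end

end SecondVariation

end

/-!
The proof computes in adapted charts, where a section becomes a map `u : ℝⁿ → ℝᵐ` and a function
`f` of finite order on jets is evaluated along the prolongation `j u` (`jetProl`). Two facts about
`j u` reduce the jet calculus to calculus on `ℝⁿ`: the chain rule `(D_σ f)(j u) = ∂_σ (f(j u))`
(`JetSmoothOn.totalDerivs_jetProl`), and the formula `∑ ∂_σ ξ^i ∂_i^σ f` for the derivative of
`f(j(u + tξ))` at `t = 0` (`variation`).

*Self-adjointness.* Parameter derivatives commute with `∂_σ`, so the linearization of `E(f)_i` is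
`∑ (-1)^{|σ|} ∂_σ` of the linearization of `∂_i^σ f`. Paired with `η^i`, where `η` or `ξ` has
compact support, its integral is, after integrations by parts, that of the second variation `∑ ∂_σ
η^i ∂_τ ξ^j ∂_i^σ ∂_j^τ f`, which is symmetric in `η` and `ξ`. Hence `∇ = ∇^*` along every
section, critical or not, by the fundamental lemma of the calculus of variations
(`JetSmoothOn.nabla_eq_nablaAdjoint`).

*The Hessian.* If `g = Ξ^j E_j` and the `E_j` vanish along `j u`, then in `E(g)_i = ∑ (-1)^{|σ|}
D_σ ∂_i^σ (Ξ^j E_j)` only the terms with `∂_i^σ` on `E_j` survive along `j u`, and these add up to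
`∇^*(Ξ)_i` (`eulerExpr_contract_eq_nablaAdjoint`).

*Independence of the chart.* The morphism `E(L)` is defined with a chart chosen at each point, so
its components in a given chart are known only after the transformation law of the Euler--Lagrange
expressions (`IsCoordChange.eulerExpr_transport`). The components of `L` in two charts, along any
section, differ by the Jacobian of the change of base coordinates. Differentiating this in the
direction of a compactly supported vertical field and integrating with the first variation formula
turns it into an identity between the two families of Euler--Lagrange expressions. That the jet of
a section is determined by its coordinates in a single chart is `AdaptedChart.jet_eq_of_trunc_eq`.
-/

namespace SecondVariation

/-! ### Multi-indices and iterated operators -/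

section IterOp

variable {n : ℕ}

lemma iterate_rel {α β : Type*} {D : α → α} {D' : β → β} (R : ℕ → α → β → Prop)
    (h : ∀ k a b, R k a b → R (k + 1) (D a) (D' b)) (j : ℕ) {k : ℕ} {a : α} {b : β}
    (hab : R k a b) : R (k + j) (D^[j] a) (D'^[j] b) := by
  induction j with
  | zero => exact hab
  | succ j ih =>
    rw [Function.iterate_succ_apply', Function.iterate_succ_apply', ← add_assoc]
    exact h _ _ _ ih

/-- A graded relation preserved by each pair `(D l, D' l)`, with the degree going up by one, is
preserved by the composites `D^σ` and `D'^σ`, with the degree going up by `|σ|`. -/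
lemma iterOp_rel {α β : Type*} {D : Fin n → α → α} {D' : Fin n → β → β} (R : ℕ → α → β → Prop)
    (h : ∀ k a b l, R k a b → R (k + 1) (D l a) (D' l b)) (σ : Fin n → ℕ) {k : ℕ} {a : α} {b : β}
    (hab : R k a b) : R (k + ∑ l, σ l) (iterOp D σ a) (iterOp D' σ b) := by
  have key : ∀ ls : List (Fin n), R (k + (ls.map σ).sum)
      (ls.foldr (fun l g => (D l)^[σ l] ∘ g) id a)
      (ls.foldr (fun l g => (D' l)^[σ l] ∘ g) id b) := by
    intro ls
    induction ls with
    | nil => simpa using hab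
    | cons l ls ih =>
      have := iterate_rel R (fun k a b => h k a b l) (σ l) ih
      simpa [add_assoc, add_comm, add_left_comm] using this
  have := key (List.finRange n)
  rwa [← Fin.sum_univ_def] at this

/-- Ungraded form of `iterOp_rel`. -/
lemma iterOp_rel' {α β : Type*} {D : Fin n → α → α} {D' : Fin n → β → β} (R : α → β → Prop)
    (h : ∀ a b l, R a b → R (D l a) (D' l b)) (σ : Fin n → ℕ) {a : α} {b : β}
    (hab : R a b) : R (iterOp D σ a) (iterOp D' σ b) :=
  iterOp_rel (fun _ => R) (fun _ a b l => h a b l) σ (k := 0) hab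

/-- An operator that commutes with each `D l`, up to a partial equivalence relation respected by
all operators, commutes with `D^σ`. -/
lemma iterOp_comm {α : Type*} {D : Fin n → α → α} {T : α → α} {R : α → α → Prop}
    (htrans : ∀ {a b c}, R a b → R b c → R a c)
    (hD : ∀ {a b} l, R a b → R (D l a) (D l b)) (hT : ∀ {a b}, R a b → R (T a) (T b))
    (hcomm : ∀ {a} l, R a a → R (T (D l a)) (D l (T a)))
    (σ : Fin n → ℕ) {a : α} (ha : R a a) : R (T (iterOp D σ a)) (iterOp D σ (T a)) := by
  have := iterOp_rel' (fun a b => R a a ∧ R (T a) b) (D := D) (D' := D) (fun a b l h =>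
    ⟨hD l h.1, htrans (hcomm l h.1) (hD l h.2)⟩) σ (a := a) (b := T a) ⟨ha, hT ha⟩
  exact this.2

lemma iterOp_zero {α : Type*} (D : Fin n → α → α) (a : α) : iterOp D 0 a = a := by
  have key : ∀ ls : List (Fin n), ls.foldr (fun l g => (D l)^[(0 : Fin n → ℕ) l] ∘ g) id a = a := by
    intro ls
    induction ls with
    | nil => rfl
    | cons l ls => simp
  exact key _

/-- `D_l D^σ = D^{σ+l}` for operators which commute up to a partial equivalence relation. -/
lemma iterOp_add_single {α : Type*} {D : Fin n → α → α} {R : α → α → Prop}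
    (htrans : ∀ {a b c}, R a b → R b c → R a c)
    (hD : ∀ {a b} l, R a b → R (D l a) (D l b))
    (hcomm : ∀ {a} k l, R a a → R (D k (D l a)) (D l (D k a)))
    (σ : Fin n → ℕ) (l : Fin n) {a : α} (ha : R a a) :
    R (D l (iterOp D σ a)) (iterOp D (σ + Pi.single l 1) a) := by
  have hit : ∀ k j {a b}, R a b → R ((D k)^[j] a) ((D k)^[j] b) := fun k j a b h =>
    iterate_rel (fun _ => R) (fun _ _ _ h => hD k h) j (k := 0) h
  have hself : ∀ ls : List (Fin n), R (ls.foldr (fun l g => (D l)^[σ l] ∘ g) id a)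
      (ls.foldr (fun l g => (D l)^[σ l] ∘ g) id a) := by
    intro ls
    induction ls with
    | nil => exact ha
    | cons k ls ih => exact hit k _ ih
  have hitc : ∀ k j {a}, R a a → R (D l ((D k)^[j] a)) ((D k)^[j] (D l a)) := by
    intro k j a h
    induction j with
    | zero => exact hD l h
    | succ j ih =>
      rw [Function.iterate_succ_apply', Function.iterate_succ_apply']
      exact htrans (hcomm l k (hit k j h)) (hD k ih)
  -- Off `l` the exponents agree; at the factor of `l` there is one more application of `D l`, which
  -- `hitc` has moved past the preceding factors.
  have key1 : ∀ ls : List (Fin n), l ∉ ls →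
      ls.foldr (fun k g => (D k)^[(σ + Pi.single l 1 : Fin n → ℕ) k] ∘ g) id a =
        ls.foldr (fun k g => (D k)^[σ k] ∘ g) id a := by
    intro ls hl
    induction ls with
    | nil => rfl
    | cons k ls ih =>
      simp only [List.mem_cons, not_or] at hl
      simp only [List.foldr_cons, Function.comp_apply, ih hl.2]
      simp [Pi.single_eq_of_ne (Ne.symm hl.1)]
  have key2 : ∀ ls : List (Fin n), ls.Nodup → l ∈ ls →
      R (D l (ls.foldr (fun k g => (D k)^[σ k] ∘ g) id a))
        (ls.foldr (fun k g => (D k)^[(σ + Pi.single l 1 : Fin n → ℕ) k] ∘ g) id a) := by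
    intro ls hnd hl
    induction ls with
    | nil => simp at hl
    | cons k ls ih =>
      rw [List.nodup_cons] at hnd
      simp only [List.foldr_cons, Function.comp_apply]
      by_cases hk : k = l
      · subst hk
        rw [key1 ls hnd.1, Pi.add_apply, Pi.single_eq_same, Function.iterate_succ_apply']
        exact hD k (hit k _ (hself ls))
      · have hl' : l ∈ ls := by
          rcases List.mem_cons.mp hl with h | h
          · exact absurd h.symm hk
          · exact h
        refine htrans (hitc k _ (hself ls)) ?_
        rw [Pi.add_apply, Pi.single_eq_of_ne hk, add_zero]
        exact hit k _ (ih hnd.2 hl')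
  exact key2 _ (List.nodup_finRange n) (List.mem_finRange l)

lemma multiIndex_induction {P : (Fin n → ℕ) → Prop} (h0 : P 0)
    (hs : ∀ σ l, P σ → P (σ + Pi.single l 1)) (σ : Fin n → ℕ) : P σ := by
  generalize hN : ∑ l, σ l = N
  induction N generalizing σ with
  | zero =>
    have : σ = 0 := by
      funext l
      exact (Finset.sum_eq_zero_iff.mp hN) l (Finset.mem_univ l)
    exact this ▸ h0
  | succ N ih =>
    obtain ⟨l, hl⟩ : ∃ l, σ l ≠ 0 := by
      by_contra! h
      simp [h] at hN
    have hσ : σ - Pi.single l 1 + Pi.single l 1 = σ := by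
      funext k
      by_cases hk : k = l
      · subst hk; simp; omega
      · simp [Pi.single_eq_of_ne hk]
    rw [← hσ]
    refine hs _ _ (ih _ ?_)
    have h1 : ∑ k, (σ - Pi.single l 1 + Pi.single l 1 : Fin n → ℕ) k = N + 1 := by rw [hσ, hN]
    simp only [Pi.add_apply, Finset.sum_add_distrib, Finset.sum_pi_single', Finset.mem_univ,
      if_true] at h1
    omega

lemma zero_mem_multiIndices {k : ℕ} : (0 : Fin n → ℕ) ∈ multiIndices n k := by
  simp [mem_multiIndices]

lemma add_single_mem_multiIndices {k : ℕ} {σ : Fin n → ℕ} (h : σ ∈ multiIndices n k) (l : Fin n) :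
    σ + Pi.single l 1 ∈ multiIndices n (k + 1) := by
  rw [mem_multiIndices] at *
  simp only [Pi.add_apply, Finset.sum_add_distrib, Finset.sum_pi_single', Finset.mem_univ, if_true]
  omega

lemma multiIndices_mono {k k' : ℕ} (h : k ≤ k') {σ : Fin n → ℕ} (hσ : σ ∈ multiIndices n k) :
    σ ∈ multiIndices n k' := by
  rw [mem_multiIndices] at *
  omega

end IterOp

/-! ### Directional derivatives on open sets -/

section Directional

variable {E : Type*} [NormedAddCommGroup E] [NormedSpace ℝ E] {U : Set E} {f g : E → ℝ}

/-- The directional derivative of `f` along the constant vector `v`. -/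
noncomputable def dirDeriv (v : E) (f : E → ℝ) : E → ℝ := fun z => fderiv ℝ f z v

/-- Equality on `U` of functions which are smooth on `U`. This is a partial equivalence relation, and
`f` is related to itself exactly if `f` is smooth on `U`; the directional derivatives respect it and
commute up to it. -/
def SmoothEq (U : Set E) (f g : E → ℝ) : Prop := ContDiffOn ℝ ∞ f U ∧ EqOn f g U

lemma SmoothEq.trans {h : E → ℝ} (h₁ : SmoothEq U f g) (h₂ : SmoothEq U g h) : SmoothEq U f h :=
  ⟨h₁.1, h₁.2.trans h₂.2⟩

lemma contDiffOn_dirDeriv (hU : IsOpen U) (hf : ContDiffOn ℝ ∞ f U) (v : E) :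
    ContDiffOn ℝ ∞ (dirDeriv v f) U :=
  (hf.fderiv_of_isOpen hU (by simp)).clm_apply contDiffOn_const

lemma eqOn_dirDeriv (hU : IsOpen U) (h : EqOn f g U) (v : E) :
    EqOn (dirDeriv v f) (dirDeriv v g) U := by
  intro x hx
  have : f =ᶠ[𝓝 x] g := Filter.eventuallyEq_of_mem (hU.mem_nhds hx) h
  simp [dirDeriv, this.fderiv_eq]

lemma SmoothEq.dirDeriv_congr (hU : IsOpen U) (h : SmoothEq U f g) (v : E) :
    SmoothEq U (dirDeriv v f) (dirDeriv v g) :=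
  ⟨contDiffOn_dirDeriv hU h.1 v, eqOn_dirDeriv hU h.2 v⟩

lemma fderiv_dirDeriv (hU : IsOpen U) (hf : ContDiffOn ℝ ∞ f U) (v w : E) {x : E} (hx : x ∈ U) :
    dirDeriv w (dirDeriv v f) x = fderiv ℝ (fderiv ℝ f) x w v := by
  have hd : DifferentiableAt ℝ (fderiv ℝ f) x :=
    ((hf.fderiv_of_isOpen hU (m := ∞) (by simp)).contDiffAt (hU.mem_nhds hx)).differentiableAt
      (by simp)
  change fderiv ℝ (fun y => fderiv ℝ f y v) x w = _
  rw [fderiv_clm_apply hd (differentiableAt_const v)]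
  simp

lemma dirDeriv_comm (hU : IsOpen U) (hf : ContDiffOn ℝ ∞ f U) (v w : E) :
    EqOn (dirDeriv w (dirDeriv v f)) (dirDeriv v (dirDeriv w f)) U := by
  intro x hx
  rw [fderiv_dirDeriv hU hf v w hx, fderiv_dirDeriv hU hf w v hx]
  exact (hf.contDiffAt (hU.mem_nhds hx)).isSymmSndFDerivAt
    (by simp; exact WithTop.coe_le_coe.mpr le_top) w v

lemma SmoothEq.dirDeriv_swap (hU : IsOpen U) (hf : SmoothEq U f f) (v w : E) :
    SmoothEq U (dirDeriv w (dirDeriv v f)) (dirDeriv v (dirDeriv w f)) :=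
  ⟨contDiffOn_dirDeriv hU (contDiffOn_dirDeriv hU hf.1 v) w,
    dirDeriv_comm hU hf.1 v w⟩

end Directional

section PartialDeriv

variable {n : ℕ} {U : Set (Euc n)} {f g : Euc n → ℝ}

/-- The unit vector `∂_l` of `ℝⁿ`. -/
noncomputable abbrev unitVec (l : Fin n) : Euc n := EuclideanSpace.single l 1

lemma partialDeriv_eq_iterOp (σ : Fin n → ℕ) (f : Euc n → ℝ) :
    partialDeriv σ f = iterOp (fun l => dirDeriv (unitVec l)) σ f := rfl

lemma partialDeriv_zero (f : Euc n → ℝ) : partialDeriv 0 f = f := iterOp_zero _ _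

lemma SmoothEq.partialDeriv_congr (hU : IsOpen U) (h : SmoothEq U f g) (σ : Fin n → ℕ) :
    SmoothEq U (partialDeriv σ f) (partialDeriv σ g) :=
  iterOp_rel' (D := fun l => dirDeriv (unitVec l)) (D' := fun l => dirDeriv (unitVec l))
    (SmoothEq U) (fun _ _ _ h => h.dirDeriv_congr hU _) σ h

lemma contDiffOn_partialDeriv (hU : IsOpen U) (hf : ContDiffOn ℝ ∞ f U) (σ : Fin n → ℕ) :
    ContDiffOn ℝ ∞ (partialDeriv σ f) U :=
  (SmoothEq.partialDeriv_congr hU ⟨hf, fun _ _ => rfl⟩ σ).1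

lemma eqOn_partialDeriv (hU : IsOpen U) (h : EqOn f g U) (σ : Fin n → ℕ) :
    EqOn (partialDeriv σ f) (partialDeriv σ g) U :=
  iterOp_rel' (D := fun l => dirDeriv (unitVec l)) (D' := fun l => dirDeriv (unitVec l))
    (fun f g => EqOn f g U) (fun _ _ _ h => eqOn_dirDeriv hU h _) σ h

lemma dirDeriv_partialDeriv (hU : IsOpen U) (hf : ContDiffOn ℝ ∞ f U) (σ : Fin n → ℕ)
    (l : Fin n) :
    EqOn (dirDeriv (unitVec l) (partialDeriv σ f)) (partialDeriv (σ + Pi.single l 1) f) U :=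
  (iterOp_add_single (D := fun l => dirDeriv (unitVec l)) (R := SmoothEq U) (fun h h' => h.trans h')
    (fun _ h => h.dirDeriv_congr hU _) (fun _ _ h => h.dirDeriv_swap hU _ _) σ l
    ⟨hf, fun _ _ => rfl⟩).2

lemma partialDeriv_dirDeriv (hU : IsOpen U) (hf : ContDiffOn ℝ ∞ f U) (σ : Fin n → ℕ)
    (l : Fin n) :
    EqOn (partialDeriv σ (dirDeriv (unitVec l) f)) (partialDeriv (σ + Pi.single l 1) f) U :=
  (iterOp_comm (D := fun l => dirDeriv (unitVec l)) (R := SmoothEq U) (T := dirDeriv (unitVec l))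
    (fun h h' => h.trans h') (fun _ h => h.dirDeriv_congr hU _)
    (fun h => h.dirDeriv_congr hU _) (fun _ h => h.dirDeriv_swap hU _ _) σ
    ⟨hf, fun _ _ => rfl⟩).2.symm.trans (dirDeriv_partialDeriv hU hf σ l)

/-- The partial derivatives in `x` of a family `w(t, x)` are restrictions of iterated directional
derivatives of `w` as a function of `(t, x)`. -/
lemma partialDeriv_slice {W : Set (ℝ × Euc n)} (hW : IsOpen W) {w : ℝ × Euc n → ℝ}
    (hw : ContDiffOn ℝ ∞ w W) (σ : Fin n → ℕ) {t : ℝ} {x : Euc n} (hx : (t, x) ∈ W) :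
    partialDeriv σ (fun x => w (t, x)) x =
      iterOp (fun l => dirDeriv ((0 : ℝ), unitVec l)) σ w (t, x) := by
  refine ((iterOp_rel' (fun (a : ℝ × Euc n → ℝ) (b : Euc n → ℝ) => ContDiffOn ℝ ∞ a W ∧
    ∀ x, (t, x) ∈ W → a (t, x) = b x) ?_ σ ⟨hw, fun _ _ => rfl⟩).2 x hx).symm
  rintro a b l ⟨ha, hab⟩
  refine ⟨contDiffOn_dirDeriv hW ha _, fun x hx => ?_⟩
  have hV : IsOpen {x | (t, x) ∈ W} := hW.preimage (by fun_prop)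
  have h1 : b =ᶠ[𝓝 x] fun x => a (t, x) := by
    filter_upwards [hV.mem_nhds hx] with y hy using (hab y hy).symm
  have h2 : HasFDerivAt a (fderiv ℝ a (t, x)) (t, x) :=
    ((ha.contDiffAt (hW.mem_nhds hx)).differentiableAt (by simp)).hasFDerivAt
  have h3 := h2.comp x (hasFDerivAt_prodMk_right t x)
  have h4 : fderiv ℝ b x = _ := h1.fderiv_eq.trans h3.fderiv
  simp only [dirDeriv]
  rw [h4]
  rfl

lemma contDiffOn_iterOp_slice {W : Set (ℝ × Euc n)} (hW : IsOpen W) {w : ℝ × Euc n → ℝ}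
    (hw : ContDiffOn ℝ ∞ w W) (σ : Fin n → ℕ) :
    ContDiffOn ℝ ∞ (iterOp (fun l => dirDeriv ((0 : ℝ), unitVec l)) σ w) W :=
  iterOp_rel' (fun (a _ : ℝ × Euc n → ℝ) => ContDiffOn ℝ ∞ a W)
    (fun _ _ _ h => contDiffOn_dirDeriv hW h _) σ (b := w) hw (D' := fun _ => id)

/-- Mixed derivatives in the parameter and the space variables of a smooth family commute. -/
lemma hasDerivAt_partialDeriv_slice {W : Set (ℝ × Euc n)} (hW : IsOpen W) {w : ℝ × Euc n → ℝ}
    (hw : ContDiffOn ℝ ∞ w W) (σ : Fin n → ℕ) {t : ℝ} {x : Euc n} (hx : (t, x) ∈ W) :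
    HasDerivAt (fun t => partialDeriv σ (fun x => w (t, x)) x)
      (partialDeriv σ (fun x => dirDeriv ((1 : ℝ), (0 : Euc n)) w (t, x)) x) t := by
  rw [partialDeriv_slice hW (contDiffOn_dirDeriv hW hw _) σ hx]
  have hc := (iterOp_comm (R := SmoothEq W) (T := dirDeriv ((1 : ℝ), (0 : Euc n)))
    (D := fun l => dirDeriv ((0 : ℝ), unitVec l))
    (fun h h' => h.trans h') (fun _ h => h.dirDeriv_congr hW _)
    (fun h => h.dirDeriv_congr hW _) (fun _ h => h.dirDeriv_swap hW _ _) σ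
    ⟨hw, fun _ _ => rfl⟩).2 hx
  rw [← hc]
  have h2 := (((contDiffOn_iterOp_slice hW hw σ).contDiffAt (hW.mem_nhds hx)).differentiableAt
    (by simp)).hasFDerivAt
  have h3 := h2.comp t (hasFDerivAt_prodMk_left (𝕜 := ℝ) t x)
  have h4 := h3.hasDerivAt
  refine HasDerivAt.congr_of_eventuallyEq
    (f := (iterOp (fun l => dirDeriv ((0 : ℝ), unitVec l)) σ w) ∘ fun t => (t, x)) ?_ ?_
  · convert h4 using 1
    simp [dirDeriv]
  · have hV : IsOpen {t | (t, x) ∈ W} := hW.preimage (by fun_prop)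
    filter_upwards [hV.mem_nhds hx] with s hs using partialDeriv_slice hW hw σ hs

end PartialDeriv

/-! ### Test functions and integration by parts -/

section TestFunctions

open MeasureTheory

/-- `h` is a test function on `U`: smooth on `U` and zero on `U` off a compact subset of `U`. The
values of `h` off `U` are irrelevant. -/
def TestOn {E : Type*} [NormedAddCommGroup E] [NormedSpace ℝ E] (U : Set E) (h : E → ℝ) : Prop :=
  ContDiffOn ℝ ∞ h U ∧ ∃ K ⊆ U, IsCompact K ∧ ∀ x ∈ U, x ∉ K → h x = 0

section General

variable {E : Type*} [NormedAddCommGroup E] [NormedSpace ℝ E] {U : Set E} {f g h : E → ℝ}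

lemma TestOn.mul_right (hh : TestOn U h) (hg : ContDiffOn ℝ ∞ g U) :
    TestOn U (fun x => h x * g x) := by
  obtain ⟨hs, K, hKU, hK, h0⟩ := hh
  exact ⟨hs.mul hg, K, hKU, hK, fun x hx hxK => by simp [h0 x hx hxK]⟩

lemma TestOn.mul_left (hh : TestOn U h) (hg : ContDiffOn ℝ ∞ g U) :
    TestOn U (fun x => g x * h x) := by
  simpa [mul_comm] using hh.mul_right hg

lemma TestOn.zero : TestOn U (fun _ => (0 : ℝ)) :=
  ⟨contDiffOn_const, ∅, empty_subset _, isCompact_empty, fun _ _ _ => rfl⟩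

lemma TestOn.add (hh : TestOn U h) (hg : TestOn U g) : TestOn U (fun x => h x + g x) := by
  obtain ⟨hs, K, hKU, hK, h0⟩ := hh
  obtain ⟨hs', K', hKU', hK', h0'⟩ := hg
  refine ⟨hs.add hs', K ∪ K', union_subset hKU hKU', hK.union hK', fun x hx hxK => ?_⟩
  simp only [mem_union, not_or] at hxK
  simp [h0 x hx hxK.1, h0' x hx hxK.2]

lemma TestOn.sum {ι : Type*} {s : Finset ι} {F : ι → E → ℝ} (hF : ∀ i ∈ s, TestOn U (F i)) :
    TestOn U (fun x => ∑ i ∈ s, F i x) := by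
  classical
  induction s using Finset.induction_on with
  | empty => simpa using TestOn.zero
  | insert a s ha ih =>
    simp only [Finset.sum_insert ha]
    exact (hF a (by simp)).add (ih fun i hi => hF i (by simp [hi]))

lemma TestOn.dirDeriv (hU : IsOpen U) (hh : TestOn U h) (v : E) :
    TestOn U (dirDeriv v h) := by
  obtain ⟨hs, K, hKU, hK, h0⟩ := hh
  refine ⟨contDiffOn_dirDeriv hU hs v, K, hKU, hK, fun x hx hxK => ?_⟩
  have hV : IsOpen (U ∩ Kᶜ) := hU.inter hK.isClosed.isOpen_compl
  have := eqOn_dirDeriv hV (f := h) (g := fun _ => 0) (fun y hy => h0 y hy.1 hy.2) v ⟨hx, hxK⟩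
  rw [this]
  simp [SecondVariation.dirDeriv]

/-- Extended by zero, a test function on `U` is smooth on the whole space. -/
lemma TestOn.contDiff_indicator (hU : IsOpen U) (hh : TestOn U h) :
    ContDiff ℝ ∞ (U.indicator h) := by
  obtain ⟨hs, K, hKU, hK, h0⟩ := hh
  rw [contDiff_iff_contDiffAt]
  intro x
  by_cases hx : x ∈ U
  · refine (hs.contDiffAt (hU.mem_nhds hx)).congr_of_eventuallyEq ?_
    filter_upwards [hU.mem_nhds hx] with y hy using indicator_of_mem hy h
  · have hxK : Kᶜ ∈ 𝓝 x := hK.isClosed.isOpen_compl.mem_nhds fun h => hx (hKU h)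
    refine (contDiffAt_const (c := (0 : ℝ))).congr_of_eventuallyEq ?_
    filter_upwards [hxK] with y hy
    by_cases hyU : y ∈ U
    · rw [indicator_of_mem hyU, h0 y hyU hy]
    · exact indicator_of_notMem hyU h

lemma TestOn.hasCompactSupport_indicator (hh : TestOn U h) :
    HasCompactSupport (U.indicator h) := by
  obtain ⟨hs, K, hKU, hK, h0⟩ := hh
  refine HasCompactSupport.intro hK fun x hx => ?_
  by_cases hxU : x ∈ U
  · rw [indicator_of_mem hxU, h0 x hxU hx]
  · exact indicator_of_notMem hxU h

lemma TestOn.of_tsupport (hs : ContDiff ℝ ∞ h) (hc : HasCompactSupport h) (ht : tsupport h ⊆ U) :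
    TestOn U h :=
  ⟨hs.contDiffOn, tsupport h, ht, hc, fun _ _ hx => image_eq_zero_of_notMem_tsupport hx⟩

end General

section Integral

variable {n : ℕ} {U : Set (Euc n)} {f g h : Euc n → ℝ}

lemma TestOn.integrableOn (hU : IsOpen U) (hh : TestOn U h) : IntegrableOn h U := by
  rw [← integrable_indicator_iff hU.measurableSet]
  exact (hh.contDiff_indicator hU).continuous.integrable_of_hasCompactSupport
    hh.hasCompactSupport_indicator

lemma TestOn.partialDeriv (hU : IsOpen U) (hh : TestOn U h) (σ : Fin n → ℕ) :
    TestOn U (partialDeriv σ h) :=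
  iterOp_rel' (D := fun l => SecondVariation.dirDeriv (unitVec l)) (fun h _ => TestOn U h)
    (fun _ _ _ h => h.dirDeriv hU _) σ (b := h) hh (D' := fun _ => id)

lemma TestOn.integral_dirDeriv (hU : IsOpen U) (hh : TestOn U h) (v : Euc n) :
    ∫ x in U, SecondVariation.dirDeriv v h x = 0 := by
  have hs := hh.contDiff_indicator hU
  have hc := hh.hasCompactSupport_indicator
  have hd : U.indicator (SecondVariation.dirDeriv v h) =
      SecondVariation.dirDeriv v (U.indicator h) := by
    have hd' : TestOn U (SecondVariation.dirDeriv v h) := hh.dirDeriv hU v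
    obtain ⟨hs, K, hKU, hK, h0⟩ := hh
    funext x
    by_cases hx : x ∈ U
    · rw [indicator_of_mem hx]
      exact eqOn_dirDeriv hU (fun y hy => (indicator_of_mem hy h).symm) v hx
    · rw [indicator_of_notMem hx]
      have hxK : x ∈ Kᶜ := fun h => hx (hKU h)
      have := eqOn_dirDeriv hK.isClosed.isOpen_compl (f := U.indicator h) (g := fun _ => 0)
        (fun y hy => by
          by_cases hyU : y ∈ U
          · rw [indicator_of_mem hyU, h0 y hyU hy]
          · exact indicator_of_notMem hyU h) v hxK
      rw [this]
      simp [SecondVariation.dirDeriv]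
  rw [← integral_indicator hU.measurableSet, hd]
  have hs' : Continuous (SecondVariation.dirDeriv v (U.indicator h)) :=
    (hs.continuous_fderiv (by simp)).clm_apply continuous_const
  have hc' : HasCompactSupport (SecondVariation.dirDeriv v (U.indicator h)) :=
    hc.fderiv_apply (𝕜 := ℝ) v
  have hi : Integrable (fun x => fderiv ℝ (U.indicator h) x v) :=
    hs'.integrable_of_hasCompactSupport hc'
  have := integral_mul_fderiv_eq_neg_fderiv_mul_of_integrable (μ := volume) (𝕜 := ℝ)
    (f := fun _ : Euc n => (1 : ℝ)) (g := U.indicator h) (v := v) (by simp)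
    (by simpa using hi)
    (by simpa using hs.continuous.integrable_of_hasCompactSupport hc)
    (fun _ _ => differentiableAt_const _)
    (fun x _ => hs.contDiffAt.differentiableAt (by simp))
  simpa [SecondVariation.dirDeriv] using this

/-- Integration by parts, once. -/
lemma TestOn.integral_mul_dirDeriv (hU : IsOpen U) (hh : TestOn U h) (hg : ContDiffOn ℝ ∞ g U)
    (v : Euc n) :
    ∫ x in U, h x * SecondVariation.dirDeriv v g x =
      -∫ x in U, SecondVariation.dirDeriv v h x * g x := by
  have h0 := (hh.mul_right hg).integral_dirDeriv hU v
  have hi1 := (hh.mul_right (contDiffOn_dirDeriv hU hg v)).integrableOn hU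
  have hi2 := ((hh.dirDeriv hU v).mul_right hg).integrableOn hU
  have hsum : ∫ x in U, SecondVariation.dirDeriv v (fun x => h x * g x) x =
      ∫ x in U, (h x * SecondVariation.dirDeriv v g x + SecondVariation.dirDeriv v h x * g x) := by
    refine setIntegral_congr_fun hU.measurableSet fun x hx => ?_
    have d1 := (hh.1.contDiffAt (hU.mem_nhds hx)).differentiableAt (by simp)
    have d2 := (hg.contDiffAt (hU.mem_nhds hx)).differentiableAt (by simp)
    simp only [SecondVariation.dirDeriv]
    rw [fderiv_fun_mul d1 d2]
    simp [mul_comm]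
  rw [hsum, integral_add hi1 hi2] at h0
  linarith

/-- Integration by parts for `∂_σ`. -/
lemma TestOn.integral_mul_partialDeriv (hU : IsOpen U) (hh : TestOn U h)
    (hg : ContDiffOn ℝ ∞ g U) (σ : Fin n → ℕ) :
    ∫ x in U, h x * SecondVariation.partialDeriv σ g x =
      (-1) ^ (∑ l, σ l) * ∫ x in U, SecondVariation.partialDeriv σ h x * g x := by
  induction σ using multiIndex_induction generalizing h with
  | h0 => simp [partialDeriv_zero]
  | hs σ l ih =>
    have e1 : ∫ x in U, h x * SecondVariation.partialDeriv (σ + Pi.single l 1) g x =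
        ∫ x in U, h x * SecondVariation.dirDeriv (unitVec l)
          (SecondVariation.partialDeriv σ g) x :=
      setIntegral_congr_fun hU.measurableSet fun x hx => by
        simp only [dirDeriv_partialDeriv hU hg σ l hx]
    have e2 : ∫ x in U, SecondVariation.partialDeriv σ
          (SecondVariation.dirDeriv (unitVec l) h) x * g x =
        ∫ x in U, SecondVariation.partialDeriv (σ + Pi.single l 1) h x * g x :=
      setIntegral_congr_fun hU.measurableSet fun x hx => by
        simp only [partialDeriv_dirDeriv hU hh.1 σ l hx]
    rw [e1, hh.integral_mul_dirDeriv hU (contDiffOn_partialDeriv hU hg σ), ih (hh.dirDeriv hU _),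
      e2]
    have : ∑ k, (σ + Pi.single l 1 : Fin n → ℕ) k = ∑ k, σ k + 1 := by
      simp [Finset.sum_add_distrib]
    rw [this, pow_succ]
    ring

/-- The fundamental lemma of the calculus of variations. -/
lemma eqOn_zero_of_integral_testOn (hU : IsOpen U) (hg : ContinuousOn g U)
    (h : ∀ φ, TestOn U φ → ∫ x in U, φ x * g x = 0) : EqOn g 0 U := by
  have hae := hU.ae_eq_zero_of_integral_contDiff_smul_eq_zero (μ := volume)
    (hg.locallyIntegrableOn hU.measurableSet) (fun φ hs hc ht => ?_)
  · refine Measure.eqOn_open_of_ae_eq (μ := volume) ?_ hU hg continuousOn_const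
    rw [Filter.EventuallyEq, ae_restrict_iff' hU.measurableSet]
    exact hae
  · have h1 := h φ (TestOn.of_tsupport hs hc ht)
    rw [← h1]
    refine (setIntegral_eq_integral_of_forall_compl_eq_zero fun x hx => ?_).symm
    rw [image_eq_zero_of_notMem_tsupport fun h => hx (ht h)]
    simp

end Integral

end TestFunctions

/-! ### Smooth functions on jet coordinate spaces -/

section JetFunctions

variable {n m : ℕ}

/-- The infinite jet prolongation of `u`, in coordinates: the point `z` and all partial derivatives
of `u` at `z`. It is meaningful where `u` is smooth near `z`. -/
noncomputable def jetProl (u : Euc n → Euc m) (z : Euc n) : JetCoord n m :=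
  (z, fun i σ => partialDeriv σ (fun x => u x i) z)

/-- The coordinates of order at most `k`. -/
def JetCoord.trunc (k : ℕ) (p : JetCoord n m) : FinJetCoord n m k :=
  (p.1, fun i σ => p.2 i σ)

/-- The jets of order `k` over the set `Ω` of points `(x, y)`. -/
def jetDomain (Ω : Set (Euc n × Euc m)) (k : ℕ) : Set (FinJetCoord n m k) :=
  {q | q.extend.point ∈ Ω}

/-- The restriction of a function of jets of all orders to `k`-jets. -/
def finPart (k : ℕ) (f : JetCoord n m → ℝ) : FinJetCoord n m k → ℝ := fun q => f q.extend

/-- `f` is, over the set `Ω` of points `(x, y)`, a smooth function of order `k`: it depends only on the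
coordinates of order at most `k`, and smoothly. The values of `f` off `Ω` are irrelevant. -/
def JetSmoothOn (Ω : Set (Euc n × Euc m)) (k : ℕ) (f : JetCoord n m → ℝ) : Prop :=
  ContDiffOn ℝ ∞ (finPart k f) (jetDomain Ω k) ∧
    ∀ p : JetCoord n m, p.point ∈ Ω → f p = finPart k f (p.trunc k)

lemma point_extend {k : ℕ} (q : FinJetCoord n m k) :
    q.extend.point = (q.1, WithLp.toLp 2 fun i => q.2 i ⟨0, zero_mem_multiIndices⟩) := by
  simp [FinJetCoord.extend, JetCoord.point, zero_mem_multiIndices]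

lemma trunc_extend {k : ℕ} (q : FinJetCoord n m k) : q.extend.trunc k = q := by
  refine Prod.ext rfl ?_
  funext i σ
  simp [FinJetCoord.extend, JetCoord.trunc]

lemma point_extend_trunc (k : ℕ) (p : JetCoord n m) : (p.trunc k).extend.point = p.point := by
  rw [point_extend]
  rfl

lemma point_jetProl (u : Euc n → Euc m) (z : Euc n) : (jetProl u z).point = (z, u z) := by
  simp [jetProl, JetCoord.point, partialDeriv_zero]

lemma trunc_mem {Ω : Set (Euc n × Euc m)} {k : ℕ} {p : JetCoord n m} (hp : p.point ∈ Ω) :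
    p.trunc k ∈ jetDomain Ω k := by
  simpa [jetDomain, point_extend_trunc] using hp

lemma isOpen_jetDomain {Ω : Set (Euc n × Euc m)} (hΩ : IsOpen Ω) (k : ℕ) :
    IsOpen (jetDomain Ω k) := by
  have : Continuous fun q : FinJetCoord n m k => q.extend.point := by
    simp only [point_extend]
    fun_prop
  exact hΩ.preimage this

variable {Ω : Set (Euc n × Euc m)} {k k' : ℕ} {f g : JetCoord n m → ℝ}

/-- To have order `k` over `Ω` it suffices to be given there by some smooth function `G` of the
`k`-jet. -/
lemma JetSmoothOn.of_trunc {G : FinJetCoord n m k → ℝ} (hG : ContDiffOn ℝ ∞ G (jetDomain Ω k))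
    (h : ∀ p : JetCoord n m, p.point ∈ Ω → f p = G (p.trunc k)) : JetSmoothOn Ω k f := by
  have h' : ∀ q ∈ jetDomain Ω k, finPart k f q = G q := fun q hq => by
    rw [finPart, h _ hq, trunc_extend]
  exact ⟨hG.congr h', fun p hp => by rw [h p hp, h' _ (trunc_mem hp)]⟩

lemma JetSmoothOn.congr (hf : JetSmoothOn Ω k f) (h : ∀ p : JetCoord n m, p.point ∈ Ω → g p = f p) :
    JetSmoothOn Ω k g :=
  .of_trunc hf.1 fun p hp => (h p hp).trans (hf.2 p hp)

lemma JetSmoothOn.subset (hf : JetSmoothOn Ω k f) {Ω' : Set (Euc n × Euc m)} (h : Ω' ⊆ Ω) :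
    JetSmoothOn Ω' k f :=
  ⟨hf.1.mono fun _ hq => h hq, fun p hp => hf.2 p (h hp)⟩

/-- The projection from `k'`-jets to `k`-jets. -/
def jetRestrict (h : k ≤ k') (q : FinJetCoord n m k') : FinJetCoord n m k :=
  (q.1, fun i σ => q.2 i ⟨σ, multiIndices_mono h σ.2⟩)

lemma contDiff_jetRestrict (h : k ≤ k') : ContDiff ℝ ∞ (jetRestrict (n := n) (m := m) h) := by
  unfold jetRestrict
  fun_prop

lemma jetRestrict_mem (h : k ≤ k') {q : FinJetCoord n m k'} (hq : q ∈ jetDomain Ω k') :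
    jetRestrict h q ∈ jetDomain Ω k := by
  simpa [jetDomain, point_extend, jetRestrict] using hq

lemma JetSmoothOn.of_le (hf : JetSmoothOn Ω k f) (h : k ≤ k') : JetSmoothOn Ω k' f :=
  .of_trunc (hf.1.comp (contDiff_jetRestrict h).contDiffOn fun _ hq => jetRestrict_mem h hq)
    fun p hp => hf.2 p hp

lemma JetSmoothOn.eq_of_trunc_eq (hf : JetSmoothOn Ω k f) {p p' : JetCoord n m}
    (hp : p.point ∈ Ω) (h : p.trunc k = p'.trunc k) : f p = f p' := by
  have hp' : p'.point ∈ Ω := by rwa [← point_extend_trunc k, ← h, point_extend_trunc]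
  rw [hf.2 p hp, hf.2 p' hp', h]

lemma JetSmoothOn.const (a : ℝ) : JetSmoothOn Ω k (fun _ => a) :=
  .of_trunc (G := fun _ => a) contDiffOn_const fun _ _ => rfl

lemma JetSmoothOn.mul (hf : JetSmoothOn Ω k f) (hg : JetSmoothOn Ω k g) :
    JetSmoothOn Ω k (fun p => f p * g p) :=
  .of_trunc (hf.1.mul hg.1) fun p hp => by rw [hf.2 p hp, hg.2 p hp]

lemma JetSmoothOn.sum {ι : Type*} {s : Finset ι} {F : ι → JetCoord n m → ℝ}
    (hF : ∀ i ∈ s, JetSmoothOn Ω k (F i)) : JetSmoothOn Ω k (fun p => ∑ i ∈ s, F i p) :=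
  .of_trunc (G := fun q => ∑ i ∈ s, finPart k (F i) q) (ContDiffOn.sum fun i hi => (hF i hi).1)
    fun p hp => Finset.sum_congr rfl fun i hi => (hF i hi).2 p hp

lemma JetSmoothOn.hasFDerivAt (hΩ : IsOpen Ω) (hf : JetSmoothOn Ω k f) {p : JetCoord n m}
    (hp : p.point ∈ Ω) :
    HasFDerivAt (finPart k f) (fderiv ℝ (finPart k f) (p.trunc k)) (p.trunc k) :=
  ((hf.1.contDiffAt ((isOpen_jetDomain hΩ k).mem_nhds (trunc_mem hp))).differentiableAt
    (by simp)).hasFDerivAt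

/-- Chain rule for a function of order `k` along `γ`, which is differentiated through its `k`-jet
coordinates. -/
lemma JetSmoothOn.hasFDerivAt_comp {P : Type*} [NormedAddCommGroup P] [NormedSpace ℝ P]
    (hΩ : IsOpen Ω) (hf : JetSmoothOn Ω k f) {γ : P → JetCoord n m} {a : P}
    (ha : (γ a).point ∈ Ω) {γ' : P →L[ℝ] FinJetCoord n m k}
    (hγ : HasFDerivAt (fun t => (γ t).trunc k) γ' a) :
    HasFDerivAt (fun t => f (γ t)) ((fderiv ℝ (finPart k f) ((γ a).trunc k)).comp γ') a := by
  refine ((hf.hasFDerivAt hΩ ha).comp a hγ).congr_of_eventuallyEq ?_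
  have := hγ.continuousAt.preimage_mem_nhds ((isOpen_jetDomain hΩ k).mem_nhds (trunc_mem ha))
  filter_upwards [this] with t ht
  refine hf.2 _ ?_
  simpa [jetDomain, point_extend_trunc] using ht

lemma JetSmoothOn.lineDeriv_eq (hΩ : IsOpen Ω) (hf : JetSmoothOn Ω k f) {p : JetCoord n m}
    (hp : p.point ∈ Ω) (v : JetCoord n m) :
    lineDeriv ℝ f p v = fderiv ℝ (finPart k f) (p.trunc k) (v.trunc k) := by
  have h1 : HasFDerivAt (fun t : ℝ => (p + t • v).trunc k)
      (ContinuousLinearMap.toSpanSingleton ℝ (v.trunc k)) 0 := by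
    have h2 : (fun t : ℝ => (p + t • v).trunc k) = fun t => p.trunc k +
      ContinuousLinearMap.toSpanSingleton ℝ (v.trunc k) t := rfl
    rw [h2]
    exact (ContinuousLinearMap.hasFDerivAt _).const_add _
  have h3 := (hf.hasFDerivAt_comp hΩ (γ := fun t : ℝ => p + t • v) (a := 0) (by simpa using hp)
    h1).hasDerivAt
  rw [lineDeriv, h3.deriv]
  simp

/-- The coordinate vector `∂_i^σ` of the jet coordinate space. -/
def fiberDir (i : Fin m) (σ : Fin n → ℕ) : JetCoord n m := (0, Pi.single i (Pi.single σ 1))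

lemma JetSmoothOn.dFiber_eq (hΩ : IsOpen Ω) (hf : JetSmoothOn Ω k f) {p : JetCoord n m}
    (hp : p.point ∈ Ω) (i : Fin m) (σ : Fin n → ℕ) :
    dFiber i σ f p = fderiv ℝ (finPart k f) (p.trunc k) ((fiberDir i σ).trunc k) :=
  hf.lineDeriv_eq hΩ hp _

lemma JetSmoothOn.dBase_eq (hΩ : IsOpen Ω) (hf : JetSmoothOn Ω k f) {p : JetCoord n m}
    (hp : p.point ∈ Ω) (l : Fin n) :
    dBase l f p = fderiv ℝ (finPart k f) (p.trunc k) (unitVec l, 0) :=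
  hf.lineDeriv_eq hΩ hp _

lemma trunc_fiberDir_of_notMem (i : Fin m) {σ : Fin n → ℕ} (hσ : σ ∉ multiIndices n k) :
    (fiberDir i σ : JetCoord n m).trunc k = 0 := by
  refine Prod.ext rfl ?_
  funext j τ
  have : (τ : Fin n → ℕ) ≠ σ := fun h => hσ (h ▸ τ.2)
  by_cases hj : j = i
  · subst hj
    simp [fiberDir, JetCoord.trunc, this]
  · simp [fiberDir, JetCoord.trunc, hj]

lemma JetSmoothOn.dFiber_eq_zero (hΩ : IsOpen Ω) (hf : JetSmoothOn Ω k f) {p : JetCoord n m}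
    (hp : p.point ∈ Ω) (i : Fin m) {σ : Fin n → ℕ} (hσ : σ ∉ multiIndices n k) :
    dFiber i σ f p = 0 := by
  rw [hf.dFiber_eq hΩ hp, trunc_fiberDir_of_notMem i hσ, map_zero]

/-- Expansion of the fibre part of a vector in the coordinate vectors `∂_i^σ`. -/
lemma finJet_decomp (a : Euc n) (v : Fin m → ↥(multiIndices n k) → ℝ) :
    ((a, v) : FinJetCoord n m k) =
      (a, 0) + ∑ i, ∑ σ : ↥(multiIndices n k), v i σ • (fiberDir i (σ : Fin n → ℕ)).trunc k := by
  refine Prod.ext ?_ ?_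
  · simp [Prod.fst_sum, fiberDir, JetCoord.trunc]
  · funext j τ
    simp only [Prod.snd_add, Prod.snd_sum, Prod.smul_snd, Pi.add_apply, Pi.zero_apply, zero_add,
      Finset.sum_apply, Pi.smul_apply, smul_eq_mul]
    rw [Finset.sum_eq_single j, Finset.sum_eq_single τ]
    · simp [fiberDir, JetCoord.trunc]
    · intro σ _ hσ
      have : (τ : Fin n → ℕ) ≠ σ := fun h => hσ (Subtype.ext h.symm)
      simp [fiberDir, JetCoord.trunc, this]
    · simp
    · intro i _ hi
      refine Finset.sum_eq_zero fun σ _ => ?_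
      simp [fiberDir, JetCoord.trunc, Ne.symm hi]
    · simp

/-- The derivative along a direction `(a, v)` splits into the base part and `∑ v^i_σ ∂_i^σ f`. -/
lemma JetSmoothOn.fderiv_apply (hΩ : IsOpen Ω) (hf : JetSmoothOn Ω k f) {p : JetCoord n m}
    (hp : p.point ∈ Ω) (a : Euc n) (v : Fin m → (Fin n → ℕ) → ℝ) :
    fderiv ℝ (finPart k f) (p.trunc k) (JetCoord.trunc k (a, v)) =
      fderiv ℝ (finPart k f) (p.trunc k) (a, 0) +
        ∑ i, ∑ σ ∈ multiIndices n k, v i σ * dFiber i σ f p := by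
  have h := finJet_decomp a (fun i (σ : ↥(multiIndices n k)) => v i σ)
  have h' : JetCoord.trunc k ((a, v) : JetCoord n m) =
    ((a, fun i (σ : ↥(multiIndices n k)) => v i σ) : FinJetCoord n m k) := rfl
  rw [h', h, map_add, map_sum]
  congr 1
  refine Finset.sum_congr rfl fun i _ => ?_
  rw [map_sum, ← Finset.sum_coe_sort (multiIndices n k)]
  refine Finset.sum_congr rfl fun σ _ => ?_
  rw [map_smul, hf.dFiber_eq hΩ hp, smul_eq_mul]

/-- The direction `∂_l + y^i_{σ+l} ∂_i^σ` of the total derivative. -/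
noncomputable def totalDir (l : Fin n) (p : JetCoord n m) : JetCoord n m :=
  (unitVec l, fun i σ => p.2 i (σ + Pi.single l 1))

/-- For a function of finite order the total derivative is a directional derivative, and the sum in
its definition has finite support. -/
lemma JetSmoothOn.totalDeriv_eq (hΩ : IsOpen Ω) (hf : JetSmoothOn Ω k f) {p : JetCoord n m}
    (hp : p.point ∈ Ω) (l : Fin n) :
    totalDeriv l f p = fderiv ℝ (finPart k f) (p.trunc k) ((totalDir l p).trunc k) := by
  rw [totalDir, hf.fderiv_apply hΩ hp, totalDeriv, hf.dBase_eq hΩ hp]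
  congr 1
  refine Finset.sum_congr rfl fun i _ => ?_
  refine finsum_eq_sum_of_support_subset _ fun σ hσ => ?_
  by_contra hσ'
  exact hσ (by simp [hf.dFiber_eq_zero hΩ hp i (by simpa using hσ')])

lemma JetSmoothOn.dFiber (hΩ : IsOpen Ω) (hf : JetSmoothOn Ω k f) (i : Fin m) (σ : Fin n → ℕ) :
    JetSmoothOn Ω k (dFiber i σ f) :=
  .of_trunc (contDiffOn_dirDeriv (isOpen_jetDomain hΩ k) hf.1 _)
    fun _ hp => hf.dFiber_eq hΩ hp i σ

lemma JetSmoothOn.totalDeriv (hΩ : IsOpen Ω) (hf : JetSmoothOn Ω k f) (l : Fin n) :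
    JetSmoothOn Ω (k + 1) (totalDeriv l f) := by
  have h1 : ContDiffOn ℝ ∞ (fun q : FinJetCoord n m (k + 1) =>
      fderiv ℝ (finPart k f) (jetRestrict k.le_succ q)) (jetDomain Ω (k + 1)) :=
    (hf.1.fderiv_of_isOpen (isOpen_jetDomain hΩ k) (by simp)).comp
      (contDiff_jetRestrict k.le_succ).contDiffOn fun _ hq => jetRestrict_mem _ hq
  have h2 : ContDiff ℝ ∞ (fun q : FinJetCoord n m (k + 1) =>
      ((unitVec l, fun i σ => q.2 i ⟨(σ : Fin n → ℕ) + Pi.single l 1,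
        add_single_mem_multiIndices σ.2 l⟩) : FinJetCoord n m k)) := by
    fun_prop
  exact .of_trunc (h1.clm_apply h2.contDiffOn) fun p hp => hf.totalDeriv_eq hΩ hp l

lemma JetSmoothOn.totalDerivs (hΩ : IsOpen Ω) (hf : JetSmoothOn Ω k f) (σ : Fin n → ℕ) :
    JetSmoothOn Ω (k + ∑ l, σ l) (totalDerivs σ f) :=
  iterOp_rel (fun k f (_ : JetCoord n m → ℝ) => JetSmoothOn Ω k f)
    (fun _ _ _ l h => h.totalDeriv hΩ l) σ (b := f) hf (D' := fun _ => id)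

lemma JetSmoothOn.eulerExpr (hΩ : IsOpen Ω) (hf : JetSmoothOn Ω k f) (i : Fin m) :
    JetSmoothOn Ω (2 * k) (eulerExpr k f i) :=
  .sum fun σ hσ => (JetSmoothOn.const _).mul <|
    ((hf.dFiber hΩ i σ).totalDerivs hΩ σ).of_le <| by
      have := mem_multiIndices.mp hσ
      omega

lemma JetSmoothOn.dFiber_comm (hΩ : IsOpen Ω) (hf : JetSmoothOn Ω k f) (i j : Fin m)
    (σ τ : Fin n → ℕ) {p : JetCoord n m} (hp : p.point ∈ Ω) :
    SecondVariation.dFiber i σ (SecondVariation.dFiber j τ f) p =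
      SecondVariation.dFiber j τ (SecondVariation.dFiber i σ f) p := by
  have key : ∀ (i j : Fin m) (σ τ : Fin n → ℕ),
      SecondVariation.dFiber i σ (SecondVariation.dFiber j τ f) p =
      dirDeriv ((fiberDir i σ).trunc k) (dirDeriv ((fiberDir j τ).trunc k) (finPart k f))
        (p.trunc k) := by
    intro i j σ τ
    rw [(hf.dFiber hΩ j τ).dFiber_eq hΩ hp]
    refine eqOn_dirDeriv (isOpen_jetDomain hΩ k) (fun q hq => ?_) _ (trunc_mem hp)
    rw [finPart, hf.dFiber_eq hΩ hq, trunc_extend]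
    rfl
  rw [key, key]
  exact dirDeriv_comm (isOpen_jetDomain hΩ k) hf.1 _ _ (trunc_mem hp)

lemma dFiber_congr (hΩ : IsOpen Ω) (h : ∀ p : JetCoord n m, p.point ∈ Ω → f p = g p)
    (i : Fin m) (σ : Fin n → ℕ) {p : JetCoord n m} (hp : p.point ∈ Ω) :
    dFiber i σ f p = dFiber i σ g p := by
  unfold dFiber lineDeriv
  refine Filter.EventuallyEq.deriv_eq ?_
  have hc : Continuous fun t : ℝ => (p + t • (fiberDir i σ : JetCoord n m)).point := by
    unfold JetCoord.point fiberDir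
    fun_prop
  have : (fun t : ℝ => (p + t • (fiberDir i σ : JetCoord n m)).point) ⁻¹' Ω ∈ 𝓝 (0 : ℝ) :=
    (hΩ.preimage hc).mem_nhds (by rwa [mem_preimage, zero_smul, add_zero])
  filter_upwards [this] with t ht using h _ ht

lemma dBase_congr (hΩ : IsOpen Ω) (h : ∀ p : JetCoord n m, p.point ∈ Ω → f p = g p)
    (l : Fin n) {p : JetCoord n m} (hp : p.point ∈ Ω) :
    dBase l f p = dBase l g p := by
  unfold dBase lineDeriv
  refine Filter.EventuallyEq.deriv_eq ?_
  have hc : Continuous fun t : ℝ => (p + t • ((unitVec l, 0) : JetCoord n m)).point := by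
    unfold JetCoord.point
    fun_prop
  have : (fun t : ℝ => (p + t • ((unitVec l, 0) : JetCoord n m)).point) ⁻¹' Ω ∈ 𝓝 (0 : ℝ) :=
    (hΩ.preimage hc).mem_nhds (by rwa [mem_preimage, zero_smul, add_zero])
  filter_upwards [this] with t ht using h _ ht

lemma totalDerivs_congr (hΩ : IsOpen Ω) (h : ∀ p : JetCoord n m, p.point ∈ Ω → f p = g p)
    (σ : Fin n → ℕ) {p : JetCoord n m} (hp : p.point ∈ Ω) :
    totalDerivs σ f p = totalDerivs σ g p := by
  refine iterOp_rel' (fun f g : JetCoord n m → ℝ => ∀ p : JetCoord n m, p.point ∈ Ω → f p = g p)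
    (fun f g l h p hp => ?_) σ h p hp
  simp only [totalDeriv, dBase_congr hΩ h l hp, dFiber_congr hΩ h _ _ hp]

end JetFunctions

/-! ### Jet functions along prolonged maps -/

section Prolongation

variable {n m : ℕ} {Ω : Set (Euc n × Euc m)} {k : ℕ} {f g : JetCoord n m → ℝ}
  {U : Set (Euc n)} {u v : Euc n → Euc m}

lemma contDiffOn_coord {P : Type*} [NormedAddCommGroup P] [NormedSpace ℝ P] {U : Set P}
    {u : P → Euc m} (hu : ContDiffOn ℝ ∞ u U) (i : Fin m) :
    ContDiffOn ℝ ∞ (fun x => u x i) U :=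
  contDiffOn_euclidean.mp hu i

lemma jetProl_congr (hU : IsOpen U) (h : EqOn u v U) {z : Euc n} (hz : z ∈ U) :
    jetProl u z = jetProl v z := by
  refine Prod.ext rfl ?_
  funext i σ
  exact eqOn_partialDeriv hU (fun x hx => by simp only [h hx]) σ hz

/-- The prolongation `j u` has partial derivatives `∂_l (j u)` equal to the directions of the total
derivatives `D_l`. -/
lemma hasFDerivAt_trunc_jetProl (hU : IsOpen U) (hu : ContDiffOn ℝ ∞ u U) (k : ℕ) {z : Euc n}
    (hz : z ∈ U) :
    ∃ γ' : Euc n →L[ℝ] FinJetCoord n m k,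
      HasFDerivAt (fun z => (jetProl u z).trunc k) γ' z ∧
        ∀ l, γ' (unitVec l) = (totalDir l (jetProl u z)).trunc k := by
  have hd : ∀ i (σ : ↥(multiIndices n k)), HasFDerivAt (partialDeriv (σ : Fin n → ℕ) fun x => u x i)
      (fderiv ℝ (partialDeriv (σ : Fin n → ℕ) fun x => u x i) z) z := fun i σ =>
    (((contDiffOn_partialDeriv hU (contDiffOn_coord hu i) σ).contDiffAt
      (hU.mem_nhds hz)).differentiableAt (by simp)).hasFDerivAt
  refine ⟨_, (hasFDerivAt_id z).prodMk
    (hasFDerivAt_pi.mpr fun i => hasFDerivAt_pi.mpr fun σ => hd i σ), fun l => ?_⟩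
  refine Prod.ext rfl ?_
  funext i σ
  exact dirDeriv_partialDeriv hU (contDiffOn_coord hu i) σ l hz

/-- The chain rule `(D_l f)(j u) = ∂_l (f(j u))`. -/
lemma JetSmoothOn.totalDeriv_jetProl (hΩ : IsOpen Ω) (hf : JetSmoothOn Ω k f) (hU : IsOpen U)
    (hu : ContDiffOn ℝ ∞ u U) (l : Fin n) {z : Euc n} (hz : z ∈ U) (hzΩ : (z, u z) ∈ Ω) :
    SecondVariation.totalDeriv l f (jetProl u z) =
      dirDeriv (unitVec l) (fun z => f (jetProl u z)) z := by
  obtain ⟨γ', hγ, hl⟩ := hasFDerivAt_trunc_jetProl hU hu k hz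
  rw [← point_jetProl] at hzΩ
  rw [hf.totalDeriv_eq hΩ hzΩ, dirDeriv, (hf.hasFDerivAt_comp hΩ hzΩ hγ).fderiv, ← hl]
  rfl

lemma JetSmoothOn.contDiffOn_jetProl (hf : JetSmoothOn Ω k f) (hU : IsOpen U)
    (hu : ContDiffOn ℝ ∞ u U) (hΩU : ∀ z ∈ U, (z, u z) ∈ Ω) :
    ContDiffOn ℝ ∞ (fun z => f (jetProl u z)) U := by
  have h1 : ContDiffOn ℝ ∞ (fun z => (jetProl u z).trunc k) U :=
    contDiffOn_id.prodMk (contDiffOn_pi.mpr fun i => contDiffOn_pi.mpr fun σ =>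
      contDiffOn_partialDeriv hU (contDiffOn_coord hu i) σ)
  have hm : ∀ z ∈ U, (jetProl u z).point ∈ Ω := fun z hz => by
    rw [point_jetProl]
    exact hΩU z hz
  exact (hf.1.comp h1 fun z hz => trunc_mem (hm z hz)).congr fun z hz => hf.2 _ (hm z hz)

/-- The chain rule `(D_σ f)(j u) = ∂_σ (f(j u))`. -/
lemma JetSmoothOn.totalDerivs_jetProl (hΩ : IsOpen Ω) (hf : JetSmoothOn Ω k f) (hU : IsOpen U)
    (hu : ContDiffOn ℝ ∞ u U) (hΩU : ∀ z ∈ U, (z, u z) ∈ Ω) (σ : Fin n → ℕ) {z : Euc n}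
    (hz : z ∈ U) :
    SecondVariation.totalDerivs σ f (jetProl u z) =
      partialDeriv σ (fun z => f (jetProl u z)) z := by
  refine (iterOp_rel (D := SecondVariation.totalDeriv) (D' := fun l => dirDeriv (unitVec l))
    (fun k F h => JetSmoothOn Ω k F ∧ EqOn (fun z => F (jetProl u z)) h U)
    (fun k F h l hF => ⟨hF.1.totalDeriv hΩ l, fun z hz => ?_⟩) σ (k := k) (a := f)
    ⟨hf, fun _ _ => rfl⟩).2 hz
  simp only
  rw [hF.1.totalDeriv_jetProl hΩ hU hu l hz (hΩU z hz)]
  exact eqOn_dirDeriv hU hF.2 _ hz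

variable {W : Set (ℝ × Euc n)} {w : ℝ × Euc n → Euc m}

lemma isOpen_slice (hW : IsOpen W) (t : ℝ) : IsOpen {x | (t, x) ∈ W} :=
  hW.preimage (by fun_prop)

lemma contDiffOn_slice {P : Type*} [NormedAddCommGroup P] [NormedSpace ℝ P] {w : ℝ × Euc n → P}
    (hw : ContDiffOn ℝ ∞ w W) (t : ℝ) : ContDiffOn ℝ ∞ (fun x => w (t, x)) {x | (t, x) ∈ W} :=
  hw.comp (contDiff_prodMk_right t).contDiffOn fun _ hx => hx

lemma hasDerivAt_slice {G : ℝ × Euc n → ℝ} (hW : IsOpen W) (hG : ContDiffOn ℝ ∞ G W) {t : ℝ}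
    {x : Euc n} (hx : (t, x) ∈ W) :
    HasDerivAt (fun t => G (t, x)) (dirDeriv ((1 : ℝ), (0 : Euc n)) G (t, x)) t := by
  simpa [partialDeriv_zero] using hasDerivAt_partialDeriv_slice hW hG 0 hx

lemma JetSmoothOn.contDiffOn_family (hf : JetSmoothOn Ω k f) (hW : IsOpen W)
    (hw : ContDiffOn ℝ ∞ w W) (hΩW : ∀ t x, (t, x) ∈ W → (x, w (t, x)) ∈ Ω) :
    ContDiffOn ℝ ∞ (fun p : ℝ × Euc n => f (jetProl (fun x => w (p.1, x)) p.2)) W := by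
  have h1 : ContDiffOn ℝ ∞
      (fun p : ℝ × Euc n => (jetProl (fun x => w (p.1, x)) p.2).trunc k) W := by
    refine contDiffOn_snd.prodMk (contDiffOn_pi.mpr fun i => contDiffOn_pi.mpr fun σ => ?_)
    exact (contDiffOn_iterOp_slice hW (contDiffOn_coord hw i) σ).congr
      fun p hp => partialDeriv_slice hW (contDiffOn_coord hw i) σ hp
  have hm : ∀ p ∈ W, (jetProl (fun x => w (p.1, x)) p.2).point ∈ Ω := fun p hp => by
    rw [point_jetProl]
    exact hΩW p.1 p.2 hp
  exact (hf.1.comp h1 fun z hz => trunc_mem (hm z hz)).congr fun z hz => hf.2 _ (hm z hz)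

/-- The linearization `∑ ∂_σ ξ^i ∂_i^σ f` of `f` along `j u`, in the direction `ξ`. -/
noncomputable def variation (k : ℕ) (f : JetCoord n m → ℝ) (u : Euc n → Euc m)
    (ξ : Fin m → Euc n → ℝ) (x : Euc n) : ℝ :=
  ∑ i, ∑ σ ∈ multiIndices n k, partialDeriv σ (ξ i) x * dFiber i σ f (jetProl u x)

/-- First variation, pointwise: the derivative of `f(j w_t)` in the parameter of a smooth family is
the linearization of `f` in the direction `∂w/∂t`. -/
lemma JetSmoothOn.hasDerivAt_family (hΩ : IsOpen Ω) (hf : JetSmoothOn Ω k f) (hW : IsOpen W)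
    (hw : ContDiffOn ℝ ∞ w W) {t : ℝ} {x : Euc n} (hx : (t, x) ∈ W) (hxΩ : (x, w (t, x)) ∈ Ω) :
    HasDerivAt (fun t => f (jetProl (fun x => w (t, x)) x))
      (variation k f (fun x => w (t, x))
        (fun i x => dirDeriv ((1 : ℝ), (0 : Euc n)) (fun p => w p i) (t, x)) x) t := by
  have h1 : HasDerivAt (fun t => (jetProl (fun x => w (t, x)) x).trunc k)
      (JetCoord.trunc k ((0, fun i σ => partialDeriv σ (fun x => dirDeriv ((1 : ℝ), (0 : Euc n))
        (fun p => w p i) (t, x)) x) : JetCoord n m)) t :=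
    (hasDerivAt_const t x).prodMk (hasDerivAt_pi.mpr fun i => hasDerivAt_pi.mpr fun σ =>
      hasDerivAt_partialDeriv_slice hW (contDiffOn_coord hw i) σ hx)
  have hp : (jetProl (fun x => w (t, x)) x).point ∈ Ω := by rwa [point_jetProl]
  convert (hf.hasFDerivAt_comp hΩ (γ := fun t => jetProl (fun x => w (t, x)) x) hp
    h1.hasFDerivAt).hasDerivAt using 1
  simp only [ContinuousLinearMap.comp_apply, ContinuousLinearMap.toSpanSingleton_apply, one_smul]
  rw [hf.fderiv_apply hΩ hp]
  have h0 : (((0 : Euc n), 0) : FinJetCoord n m k) = 0 := rfl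
  rw [h0, map_zero, zero_add]
  rfl

lemma variation_congr (hU : IsOpen U) (huv : EqOn u v U) {ξ η : Fin m → Euc n → ℝ}
    (hξ : ∀ i, EqOn (ξ i) (η i) U) (k : ℕ) (f : JetCoord n m → ℝ) {x : Euc n} (hx : x ∈ U) :
    variation k f u ξ x = variation k f v η x := by
  simp only [variation, jetProl_congr hU huv hx]
  exact Finset.sum_congr rfl fun i _ => Finset.sum_congr rfl fun σ _ => by
    rw [eqOn_partialDeriv hU (hξ i) σ hx]

lemma JetSmoothOn.contDiffOn_variation (hΩ : IsOpen Ω) (hf : JetSmoothOn Ω k f) (hU : IsOpen U)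
    (hu : ContDiffOn ℝ ∞ u U) (hΩU : ∀ z ∈ U, (z, u z) ∈ Ω) {ξ : Fin m → Euc n → ℝ}
    (hξ : ∀ i, ContDiffOn ℝ ∞ (ξ i) U) : ContDiffOn ℝ ∞ (variation k f u ξ) U :=
  ContDiffOn.sum fun i _ => ContDiffOn.sum fun σ _ => (contDiffOn_partialDeriv hU (hξ i) σ).mul
    ((hf.dFiber hΩ i σ).contDiffOn_jetProl hU hu hΩU)

lemma JetSmoothOn.testOn_variation (hΩ : IsOpen Ω) (hf : JetSmoothOn Ω k f) (hU : IsOpen U)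
    (hu : ContDiffOn ℝ ∞ u U) (hΩU : ∀ z ∈ U, (z, u z) ∈ Ω) {ξ : Fin m → Euc n → ℝ}
    (hξ : ∀ i, TestOn U (ξ i)) : TestOn U (variation k f u ξ) :=
  .sum fun i _ => .sum fun σ _ => ((hξ i).partialDeriv hU σ).mul_right
    ((hf.dFiber hΩ i σ).contDiffOn_jetProl hU hu hΩU)

/-- The affine family `u + t ξ`, as a function of `(t, x)`. -/
noncomputable def affineFamily (u : Euc n → Euc m) (ξ : Fin m → Euc n → ℝ) (p : ℝ × Euc n) :
    Euc m :=
  u p.2 + p.1 • WithLp.toLp 2 fun i => ξ i p.2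

/-- The pairs `(t, x)` at which the affine family stays in `Ω`. -/
def affineDomain (Ω : Set (Euc n × Euc m)) (U : Set (Euc n)) (u : Euc n → Euc m)
    (ξ : Fin m → Euc n → ℝ) : Set (ℝ × Euc n) :=
  {p | p.2 ∈ U ∧ (p.2, affineFamily u ξ p) ∈ Ω}

lemma contDiffOn_affineFamily (hu : ContDiffOn ℝ ∞ u U) {ξ : Fin m → Euc n → ℝ}
    (hξ : ∀ i, ContDiffOn ℝ ∞ (ξ i) U) :
    ContDiffOn ℝ ∞ (affineFamily u ξ) {p | p.2 ∈ U} := by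
  have hs : ContDiffOn ℝ ∞ (Prod.snd : ℝ × Euc n → Euc n) {p | p.2 ∈ U} := contDiffOn_snd
  refine (hu.comp hs fun _ hp => hp).add (contDiffOn_fst.smul ?_)
  rw [contDiffOn_euclidean]
  exact fun i => (hξ i).comp hs fun _ hp => hp

lemma isOpen_affineDomain (hΩ : IsOpen Ω) (hU : IsOpen U) (hu : ContDiffOn ℝ ∞ u U)
    {ξ : Fin m → Euc n → ℝ} (hξ : ∀ i, ContDiffOn ℝ ∞ (ξ i) U) :
    IsOpen (affineDomain Ω U u ξ) :=
  (continuousOn_snd.prodMk (contDiffOn_affineFamily hu hξ).continuousOn).isOpen_inter_preimage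
    (hU.preimage continuous_snd) hΩ

lemma affineFamily_zero (u : Euc n → Euc m) (ξ : Fin m → Euc n → ℝ) :
    (fun x => affineFamily u ξ (0, x)) = u := by
  funext x
  simp [affineFamily]

lemma dirDeriv_affineFamily (hU : IsOpen U) (hu : ContDiffOn ℝ ∞ u U) {ξ : Fin m → Euc n → ℝ}
    (hξ : ∀ i, ContDiffOn ℝ ∞ (ξ i) U) (i : Fin m) (t : ℝ) {x : Euc n} (hx : x ∈ U) :
    dirDeriv ((1 : ℝ), (0 : Euc n)) (fun p => affineFamily u ξ p i) (t, x) = ξ i x := by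
  have h1 := hasDerivAt_slice (hU.preimage continuous_snd)
    (contDiffOn_coord (contDiffOn_affineFamily hu hξ) i) (t := t) (x := x) hx
  have h2 : HasDerivAt (fun t : ℝ => affineFamily u ξ (t, x) i) (ξ i x) t := by
    simpa [affineFamily] using ((hasDerivAt_id t).mul_const (ξ i x)).const_add (u x i)
  exact h1.unique h2

/-- The linearization of `E(f)` is `∑ (-1)^{|σ|} ∂_σ` of the linearizations of `∂_i^σ f`, since
the parameter derivative commutes with `∂_σ`. -/
lemma JetSmoothOn.variation_eulerExpr (hΩ : IsOpen Ω) (hf : JetSmoothOn Ω k f) (hU : IsOpen U)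
    (hu : ContDiffOn ℝ ∞ u U) (hΩU : ∀ z ∈ U, (z, u z) ∈ Ω) {ξ : Fin m → Euc n → ℝ}
    (hξ : ∀ i, ContDiffOn ℝ ∞ (ξ i) U) (i : Fin m) {x : Euc n} (hx : x ∈ U) :
    variation (2 * k) (SecondVariation.eulerExpr k f i) u ξ x =
      ∑ σ ∈ multiIndices n k, (-1) ^ (∑ l, σ l) *
        partialDeriv σ (variation k (SecondVariation.dFiber i σ f) u ξ) x := by
  set w := affineFamily u ξ with hw
  set W := affineDomain Ω U u ξ with hW
  have hWo : IsOpen W := isOpen_affineDomain hΩ hU hu hξ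
  have hws : ContDiffOn ℝ ∞ w W := (contDiffOn_affineFamily hu hξ).mono fun _ hp => hp.1
  have hΩW : ∀ t x, (t, x) ∈ W → (x, w (t, x)) ∈ Ω := fun t x h => h.2
  have h0 : (fun x => w (0, x)) = u := affineFamily_zero u ξ
  have hWx : ∀ y ∈ U, ((0 : ℝ), y) ∈ W := fun y hy => ⟨hy, by
    rw [show affineFamily u ξ (0, y) = u y from congrFun h0 y]
    exact hΩU y hy⟩
  have hdir : ∀ i,
      EqOn (fun x => dirDeriv ((1 : ℝ), (0 : Euc n)) (fun p => w p i) (0, x)) (ξ i) U :=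
    fun i y hy => dirDeriv_affineFamily hU hu hξ i 0 hy
  have hvar : ∀ {k : ℕ} {F : JetCoord n m → ℝ}, JetSmoothOn Ω k F → ∀ y ∈ U,
      HasDerivAt (fun t => F (jetProl (fun x => w (t, x)) y)) (variation k F u ξ y) 0 := by
    intro k F hF y hy
    have h1 := hF.hasDerivAt_family hΩ hWo hws (hWx y hy) (hΩW _ _ (hWx y hy))
    rwa [variation_congr hU (fun y _ => congrFun h0 y) hdir k F hy] at h1
  -- Both sides are the derivative at `t = 0` of `E(f)_i` along `j(u + tξ)`.
  refine (hvar (hf.eulerExpr hΩ i) x hx).unique ?_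
  have key : ∀ σ ∈ multiIndices n k, HasDerivAt
      (fun t => (-1) ^ (∑ l, σ l) * SecondVariation.totalDerivs σ (SecondVariation.dFiber i σ f)
        (jetProl (fun x => w (t, x)) x))
      ((-1) ^ (∑ l, σ l) *
        partialDeriv σ (variation k (SecondVariation.dFiber i σ f) u ξ) x) 0 := by
    intro σ _
    refine HasDerivAt.const_mul _ ?_
    have hF := hf.dFiber hΩ i σ
    have hG := hF.contDiffOn_family hWo hws hΩW
    have h1 := hasDerivAt_partialDeriv_slice hWo hG σ (hWx x hx)
    have h2 : EqOn (fun y => dirDeriv ((1 : ℝ), (0 : Euc n)) (fun p : ℝ × Euc n =>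
        SecondVariation.dFiber i σ f (jetProl (fun x => w (p.1, x)) p.2)) (0, y))
        (variation k (SecondVariation.dFiber i σ f) u ξ) U := fun y hy =>
      (hasDerivAt_slice hWo hG (hWx y hy)).unique (hvar hF y hy)
    rw [eqOn_partialDeriv hU h2 σ hx] at h1
    refine h1.congr_of_eventuallyEq ?_
    have hV : IsOpen {t : ℝ | (t, x) ∈ W} := hWo.preimage (by fun_prop)
    filter_upwards [hV.mem_nhds (hWx x hx)] with t ht
    exact hF.totalDerivs_jetProl hΩ (isOpen_slice hWo t) (contDiffOn_slice hws t)
      (fun y hy => hΩW t y hy) σ ht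
  exact HasDerivAt.fun_sum key

end Prolongation

/-! ### First variation and self-adjointness of the second variation -/

section Variation

open MeasureTheory

variable {n m : ℕ} {Ω : Set (Euc n × Euc m)} {k : ℕ} {f : JetCoord n m → ℝ}
  {U : Set (Euc n)} {u : Euc n → Euc m}

lemma partialDeriv_sum (hU : IsOpen U) {ι : Type*} (s : Finset ι) {F : ι → Euc n → ℝ}
    (hF : ∀ i, ContDiffOn ℝ ∞ (F i) U) (σ : Fin n → ℕ) :
    EqOn (partialDeriv σ fun x => ∑ i ∈ s, F i x) (fun x => ∑ i ∈ s, partialDeriv σ (F i) x) U := by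
  refine ((iterOp_rel' (D := fun l (F : ι → Euc n → ℝ) i => dirDeriv (unitVec l) (F i))
    (D' := fun l => dirDeriv (unitVec l))
    (fun F G => (∀ i, ContDiffOn ℝ ∞ (F i) U) ∧ EqOn G (fun x => ∑ i ∈ s, F i x) U) ?_ σ (a := F)
    ⟨hF, fun _ _ => rfl⟩).2).trans ?_
  · rintro F G l ⟨hF, hG⟩
    refine ⟨fun i => contDiffOn_dirDeriv hU (hF i) _, fun x hx => ?_⟩
    rw [eqOn_dirDeriv hU hG _ hx, dirDeriv, fderiv_fun_sum fun i _ =>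
      ((hF i).contDiffAt (hU.mem_nhds hx)).differentiableAt (by simp)]
    simp [dirDeriv]
  · intro x _
    refine Finset.sum_congr rfl fun i _ => ?_
    exact congrFun (iterOp_rel' (D := fun l (F : ι → Euc n → ℝ) i => dirDeriv (unitVec l) (F i))
      (D' := fun l => dirDeriv (unitVec l)) (fun F G => F i = G)
      (fun F G l h => congrArg (dirDeriv (unitVec l)) h) σ (a := F) (b := F i) rfl) x

/-- Integration by parts for `∂_σ`, where one of the two factors is a test function. -/
lemma integral_partialDeriv_mul (hU : IsOpen U) {φ g : Euc n → ℝ} (hφ : ContDiffOn ℝ ∞ φ U)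
    (hg : ContDiffOn ℝ ∞ g U) (h : TestOn U φ ∨ TestOn U g) (σ : Fin n → ℕ) :
    ∫ x in U, partialDeriv σ φ x * g x =
      ∫ x in U, φ x * ((-1) ^ (∑ l, σ l) * partialDeriv σ g x) := by
  have hs : ((-1 : ℝ) ^ (∑ l, σ l)) * (-1) ^ (∑ l, σ l) = 1 := by
    rw [← mul_pow]; simp
  have hr : ∫ x in U, φ x * ((-1) ^ (∑ l, σ l) * partialDeriv σ g x) =
      (-1) ^ (∑ l, σ l) * ∫ x in U, φ x * partialDeriv σ g x := by
    rw [← integral_const_mul]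
    congr 1
    funext x
    ring
  rw [hr]
  rcases h with h | h
  · rw [h.integral_mul_partialDeriv hU hg σ, ← mul_assoc, hs, one_mul]
  · have := h.integral_mul_partialDeriv hU hφ σ
    simp only [mul_comm (g _), mul_comm (partialDeriv σ g _)] at this
    exact this

/-- Integration by parts in a sum of terms `∂_σ ξ^i A_i^σ`. -/
lemma integral_sum_partialDeriv_mul (hU : IsOpen U) {ξ : Fin m → Euc n → ℝ}
    {A : Fin m → (Fin n → ℕ) → Euc n → ℝ} (hξ : ∀ i, ContDiffOn ℝ ∞ (ξ i) U)
    (hA : ∀ i σ, ContDiffOn ℝ ∞ (A i σ) U)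
    (h : (∀ i, TestOn U (ξ i)) ∨ ∀ i σ, TestOn U (A i σ)) (s : Finset (Fin n → ℕ)) :
    ∫ x in U, ∑ i, ∑ σ ∈ s, partialDeriv σ (ξ i) x * A i σ x =
      ∫ x in U, ∑ i, ξ i x * ∑ σ ∈ s, (-1) ^ (∑ l, σ l) * partialDeriv σ (A i σ) x := by
  have h1 : ∀ i σ, IntegrableOn (fun x => partialDeriv σ (ξ i) x * A i σ x) U := by
    intro i σ
    rcases h with h | h
    · exact (((h i).partialDeriv hU σ).mul_right (hA i σ)).integrableOn hU
    · exact ((h i σ).mul_left (contDiffOn_partialDeriv hU (hξ i) σ)).integrableOn hU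
  have h2 : ∀ i σ, IntegrableOn
      (fun x => ξ i x * ((-1) ^ (∑ l, σ l) * partialDeriv σ (A i σ) x)) U := by
    intro i σ
    rcases h with h | h
    · exact ((h i).mul_right
        (contDiffOn_const.mul (contDiffOn_partialDeriv hU (hA i σ) σ))).integrableOn hU
    · exact ((((h i σ).partialDeriv hU σ).mul_left contDiffOn_const).mul_left
        (hξ i)).integrableOn hU
  simp only [Finset.mul_sum]
  rw [integral_finsetSum _ fun i _ => integrable_finsetSum _ fun σ _ => h1 i σ,
    integral_finsetSum _ fun i _ => integrable_finsetSum _ fun σ _ => h2 i σ]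
  refine Finset.sum_congr rfl fun i _ => ?_
  rw [integral_finsetSum _ fun σ _ => h1 i σ, integral_finsetSum _ fun σ _ => h2 i σ]
  refine Finset.sum_congr rfl fun σ _ => ?_
  exact integral_partialDeriv_mul hU (hξ i) (hA i σ) (h.imp (fun h => h i) fun h => h i σ) σ

/-- The first variation formula: for compactly supported `η`, the integral of the linearization of
`f` is that of `η^i E(f)_i`. -/
lemma JetSmoothOn.integral_variation (hΩ : IsOpen Ω) (hf : JetSmoothOn Ω k f) (hU : IsOpen U)
    (hu : ContDiffOn ℝ ∞ u U) (hΩU : ∀ z ∈ U, (z, u z) ∈ Ω) {η : Fin m → Euc n → ℝ}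
    (hη : ∀ i, TestOn U (η i)) :
    ∫ x in U, variation k f u η x =
      ∫ x in U, ∑ i, η i x * SecondVariation.eulerExpr k f i (jetProl u x) := by
  refine (integral_sum_partialDeriv_mul hU (fun i => (hη i).1)
    (fun i σ => (hf.dFiber hΩ i σ).contDiffOn_jetProl hU hu hΩU) (.inl hη) _).trans ?_
  refine setIntegral_congr_fun hU.measurableSet fun x hx => ?_
  refine Finset.sum_congr rfl fun i _ => ?_
  simp only [SecondVariation.eulerExpr]
  congr 1
  refine Finset.sum_congr rfl fun σ _ => ?_
  rw [(hf.dFiber hΩ i σ).totalDerivs_jetProl hΩ hU hu hΩU σ hx]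

/-- The second variation `∑ ∂_σ η^i ∂_τ ξ^j ∂_i^σ ∂_j^τ f` along `j u`. -/
noncomputable def secondVariation (k : ℕ) (f : JetCoord n m → ℝ) (u : Euc n → Euc m)
    (η ξ : Fin m → Euc n → ℝ) (x : Euc n) : ℝ :=
  ∑ i, ∑ σ ∈ multiIndices n k, partialDeriv σ (η i) x * variation k (dFiber i σ f) u ξ x

lemma JetSmoothOn.secondVariation_comm (hΩ : IsOpen Ω) (hf : JetSmoothOn Ω k f)
    (hΩU : ∀ z ∈ U, (z, u z) ∈ Ω) (η ξ : Fin m → Euc n → ℝ) {x : Euc n} (hx : x ∈ U) :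
    secondVariation k f u η ξ x = secondVariation k f u ξ η x := by
  have hp : (jetProl u x).point ∈ Ω := by
    rw [point_jetProl]
    exact hΩU x hx
  have key : ∀ η ξ : Fin m → Euc n → ℝ, secondVariation k f u η ξ x =
      ∑ a ∈ Finset.univ ×ˢ multiIndices n k, ∑ b ∈ Finset.univ ×ˢ multiIndices n k,
        partialDeriv a.2 (η a.1) x * (partialDeriv b.2 (ξ b.1) x *
          SecondVariation.dFiber b.1 b.2 (SecondVariation.dFiber a.1 a.2 f) (jetProl u x)) := by
    intro η ξ
    simp only [secondVariation, variation, Finset.sum_product, Finset.mul_sum]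
  rw [key, key, Finset.sum_comm]
  refine Finset.sum_congr rfl fun a _ => Finset.sum_congr rfl fun b _ => ?_
  rw [hf.dFiber_comm hΩ a.1 b.1 a.2 b.2 hp]
  ring

/-- The linearized Euler--Lagrange expressions in the direction `ξ`, paired with `η`, integrate to the
second variation. -/
lemma JetSmoothOn.integral_secondVariation (hΩ : IsOpen Ω) (hf : JetSmoothOn Ω k f)
    (hU : IsOpen U) (hu : ContDiffOn ℝ ∞ u U) (hΩU : ∀ z ∈ U, (z, u z) ∈ Ω)
    {η ξ : Fin m → Euc n → ℝ} (hη : ∀ i, ContDiffOn ℝ ∞ (η i) U)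
    (hξ : ∀ i, ContDiffOn ℝ ∞ (ξ i) U) (h : (∀ i, TestOn U (η i)) ∨ ∀ i, TestOn U (ξ i)) :
    ∫ x in U, ∑ i, η i x * variation (2 * k) (SecondVariation.eulerExpr k f i) u ξ x =
      ∫ x in U, secondVariation k f u η ξ x := by
  refine Eq.trans ?_ (integral_sum_partialDeriv_mul hU hη
    (fun i σ => (hf.dFiber hΩ i σ).contDiffOn_variation hΩ hU hu hΩU hξ)
    (h.imp id fun h i σ => (hf.dFiber hΩ i σ).testOn_variation hΩ hU hu hΩU h) _).symm
  refine setIntegral_congr_fun hU.measurableSet fun x hx => ?_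
  exact Finset.sum_congr rfl fun i _ => by
    rw [hf.variation_eulerExpr hΩ hU hu hΩU hξ i hx]

/-- The linearized Euler--Lagrange operator along `j u` is formally self-adjoint: paired with
compactly supported fields, both sides integrate to the symmetric second variation. -/
lemma JetSmoothOn.variation_eulerExpr_selfAdjoint (hΩ : IsOpen Ω) (hf : JetSmoothOn Ω k f)
    (hU : IsOpen U) (hu : ContDiffOn ℝ ∞ u U) (hΩU : ∀ z ∈ U, (z, u z) ∈ Ω)
    {ξ : Fin m → Euc n → ℝ} (hξ : ∀ i, ContDiffOn ℝ ∞ (ξ i) U) (i : Fin m) {x : Euc n}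
    (hx : x ∈ U) :
    variation (2 * k) (SecondVariation.eulerExpr k f i) u ξ x =
      ∑ j, ∑ σ ∈ multiIndices n (2 * k), (-1) ^ (∑ l, σ l) * partialDeriv σ (fun y =>
        SecondVariation.dFiber i σ (SecondVariation.eulerExpr k f j) (jetProl u y) * ξ j y) x := by
  have hB : ∀ i j σ, ContDiffOn ℝ ∞ (fun y => SecondVariation.dFiber i σ
      (SecondVariation.eulerExpr k f j) (jetProl u y) * ξ j y) U := fun i j σ =>
    (((hf.eulerExpr hΩ j).dFiber hΩ i σ).contDiffOn_jetProl hU hu hΩU).mul (hξ j)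
  set N : Fin m → Euc n → ℝ := fun i x => ∑ σ ∈ multiIndices n (2 * k),
    (-1) ^ (∑ l, σ l) * partialDeriv σ (fun y => ∑ j, SecondVariation.dFiber i σ
      (SecondVariation.eulerExpr k f j) (jetProl u y) * ξ j y) x with hN
  have hNs : ∀ i, ContDiffOn ℝ ∞ (N i) U := fun i => ContDiffOn.sum fun σ _ =>
    contDiffOn_const.mul (contDiffOn_partialDeriv hU (ContDiffOn.sum fun j _ => hB i j σ) σ)
  have hV : ∀ i, ContDiffOn ℝ ∞ (variation (2 * k) (SecondVariation.eulerExpr k f i) u ξ) U :=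
    fun i => (hf.eulerExpr hΩ i).contDiffOn_variation hΩ hU hu hΩU hξ
  -- Exchange `η` and `ξ` in the second variation, then move the derivatives off `η`.
  have key : ∀ η : Fin m → Euc n → ℝ, (∀ i, TestOn U (η i)) →
      ∫ x in U, ∑ i, η i x * variation (2 * k) (SecondVariation.eulerExpr k f i) u ξ x =
        ∫ x in U, ∑ i, η i x * N i x := by
    intro η hη
    rw [hf.integral_secondVariation hΩ hU hu hΩU (fun i => (hη i).1) hξ (.inl hη),
      setIntegral_congr_fun hU.measurableSet fun x hx =>
        hf.secondVariation_comm hΩ hΩU η ξ hx,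
      ← hf.integral_secondVariation hΩ hU hu hΩU hξ (fun i => (hη i).1) (.inr hη)]
    refine Eq.trans ?_ (integral_sum_partialDeriv_mul hU (fun i => (hη i).1)
      (fun i σ => ContDiffOn.sum fun j _ => hB i j σ) (.inl hη) (multiIndices n (2 * k)))
    congr 1
    funext x
    simp only [variation, Finset.mul_sum]
    rw [Finset.sum_comm]
    refine Finset.sum_congr rfl fun i _ => ?_
    rw [Finset.sum_comm]
    refine Finset.sum_congr rfl fun σ _ => Finset.sum_congr rfl fun j _ => ?_
    ring
  have hNe : N i x = ∑ j, ∑ σ ∈ multiIndices n (2 * k), (-1) ^ (∑ l, σ l) *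
      partialDeriv σ (fun y => SecondVariation.dFiber i σ (SecondVariation.eulerExpr k f j)
        (jetProl u y) * ξ j y) x := by
    rw [Finset.sum_comm]
    refine Finset.sum_congr rfl fun σ _ => ?_
    rw [partialDeriv_sum hU _ (fun j => hB i j σ) σ hx, Finset.mul_sum]
  rw [← hNe, ← sub_eq_zero]
  refine eqOn_zero_of_integral_testOn hU (g := fun x =>
    variation (2 * k) (SecondVariation.eulerExpr k f i) u ξ x - N i x)
    ((hV i).sub (hNs i)).continuousOn (fun φ hφ => ?_) hx
  have h1 := key (fun i' => if i' = i then φ else fun _ => 0) fun i' => by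
    by_cases h : i' = i
    · simpa [h] using hφ
    · simpa [h] using TestOn.zero
  have h2 : ∀ F : Fin m → Euc n → ℝ,
      (fun x => ∑ i', (if i' = i then φ else fun _ => 0) x * F i' x) = fun x => φ x * F i x := by
    intro F
    funext x
    rw [Finset.sum_eq_single i] <;> simp +contextual
  rw [h2, h2 N] at h1
  simp only [mul_sub]
  rw [integral_sub ((hφ.mul_right (hV i)).integrableOn hU) ((hφ.mul_right (hNs i)).integrableOn hU),
    h1, sub_self]

/-- Self-adjointness of the vertical differential of the Euler--Lagrange expressions, in
coordinates. -/
theorem JetSmoothOn.nabla_eq_nablaAdjoint (hΩ : IsOpen Ω) (hf : JetSmoothOn Ω k f)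
    (hU : IsOpen U) (hu : ContDiffOn ℝ ∞ u U) (hΩU : ∀ z ∈ U, (z, u z) ∈ Ω) {k' : ℕ}
    {Ξ : Fin m → JetCoord n m → ℝ} (hΞ : ∀ i, JetSmoothOn Ω k' (Ξ i)) (i : Fin m) {x : Euc n}
    (hx : x ∈ U) :
    nabla (2 * k) (fun i j σ => SecondVariation.dFiber i σ (SecondVariation.eulerExpr k f j)) Ξ i
        (jetProl u x) =
      nablaAdjoint (2 * k)
        (fun i j σ => SecondVariation.dFiber i σ (SecondVariation.eulerExpr k f j)) Ξ i
        (jetProl u x) := by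
  have h := hf.variation_eulerExpr_selfAdjoint hΩ hU hu hΩU
    (ξ := fun j y => Ξ j (jetProl u y)) (fun j => (hΞ j).contDiffOn_jetProl hU hu hΩU) i hx
  refine Eq.trans ?_ (h.trans ?_)
  · refine Finset.sum_congr rfl fun j _ => Finset.sum_congr rfl fun σ _ => ?_
    rw [(hΞ j).totalDerivs_jetProl hΩ hU hu hΩU σ hx]
  · refine Finset.sum_congr rfl fun j _ => Finset.sum_congr rfl fun σ _ => ?_
    rw [((((hf.eulerExpr hΩ j).dFiber hΩ i σ).of_le (le_max_left _ k')).mul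
      ((hΞ j).of_le (le_max_right (2 * k) k'))).totalDerivs_jetProl hΩ hU hu hΩU σ hx]

/-- For `g = Ξ^j E_j`, the expression `E(g)_i` is `∇^*(Ξ)_i` along `j u` if the `E_j` vanish along
`j u`: the other terms of `E(g)_i` are `(-1)^{|σ|} D_σ (∂_i^σ Ξ^j E_j)`. -/
theorem eulerExpr_contract_eq_nablaAdjoint (hΩ : IsOpen Ω) (hU : IsOpen U)
    (hu : ContDiffOn ℝ ∞ u U) (hΩU : ∀ z ∈ U, (z, u z) ∈ Ω)
    {E Ξ : Fin m → JetCoord n m → ℝ} (hE : ∀ j, JetSmoothOn Ω k (E j))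
    (hΞ : ∀ j, JetSmoothOn Ω k (Ξ j)) {g : JetCoord n m → ℝ}
    (hg : ∀ p : JetCoord n m, p.point ∈ Ω → g p = ∑ j, Ξ j p * E j p)
    (hcrit : ∀ z ∈ U, ∀ j, E j (jetProl u z) = 0) (i : Fin m) {x : Euc n} (hx : x ∈ U) :
    eulerExpr k g i (jetProl u x) =
      nablaAdjoint k (fun i j σ => dFiber i σ (E j)) Ξ i (jetProl u x) := by
  have hp : ∀ z ∈ U, (jetProl u z).point ∈ Ω := fun z hz => by
    rw [point_jetProl]
    exact hΩU z hz
  have hgs : JetSmoothOn Ω k g :=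
    (JetSmoothOn.sum fun j _ => (hΞ j).mul (hE j)).congr hg
  -- The product rule for `∂_i^σ`.
  have hprod : ∀ (σ : Fin n → ℕ) (p : JetCoord n m), p.point ∈ Ω → dFiber i σ g p =
      ∑ j, (Ξ j p * dFiber i σ (E j) p + dFiber i σ (Ξ j) p * E j p) := by
    intro σ p hpΩ
    rw [dFiber_congr hΩ hg i σ hpΩ, (JetSmoothOn.sum fun j _ => (hΞ j).mul (hE j)).dFiber_eq hΩ hpΩ]
    have hd : ∀ j, HasFDerivAt (fun q => finPart k (Ξ j) q * finPart k (E j) q) _ (p.trunc k) :=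
      fun j => ((hΞ j).hasFDerivAt hΩ hpΩ).mul ((hE j).hasFDerivAt hΩ hpΩ)
    have hs := HasFDerivAt.fun_sum (u := Finset.univ) fun j _ => hd j
    have he : finPart k (fun p => ∑ j, Ξ j p * E j p) =
      fun q => ∑ j, finPart k (Ξ j) q * finPart k (E j) q := rfl
    rw [he, hs.fderiv]
    simp only [sum_apply, add_apply, smul_apply, smul_eq_mul]
    refine Finset.sum_congr rfl fun j _ => ?_
    rw [← (hΞ j).dFiber_eq hΩ hpΩ, ← (hE j).dFiber_eq hΩ hpΩ, ← (hΞ j).2 p hpΩ,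
      ← (hE j).2 p hpΩ]
    ring
  have hB : ∀ j σ, JetSmoothOn Ω k (fun q => dFiber i σ (E j) q * Ξ j q) := fun j σ =>
    ((hE j).dFiber hΩ i σ).mul (hΞ j)
  simp only [eulerExpr, nablaAdjoint]
  rw [Finset.sum_comm]
  refine Finset.sum_congr rfl fun σ _ => ?_
  rw [← Finset.mul_sum, (hgs.dFiber hΩ i σ).totalDerivs_jetProl hΩ hU hu hΩU σ hx]
  congr 1
  have h1 : EqOn (fun z => dFiber i σ g (jetProl u z))
      (fun z => ∑ j, (dFiber i σ (E j) (jetProl u z) * Ξ j (jetProl u z))) U := by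
    intro z hz
    simp only
    rw [hprod σ _ (hp z hz)]
    refine Finset.sum_congr rfl fun j _ => ?_
    rw [hcrit z hz j]
    ring
  rw [eqOn_partialDeriv hU h1 σ hx, partialDeriv_sum hU _
    (fun j => (hB j σ).contDiffOn_jetProl hU hu hΩU) σ hx]
  refine Finset.sum_congr rfl fun j _ => ?_
  rw [(hB j σ).totalDerivs_jetProl hΩ hU hu hΩU σ hx]

end Variation

/-! ### Fibered changes of coordinates -/

section CoordChange

open MeasureTheory

variable {n m : ℕ}

/-- A fibered change of coordinates `(x, y) ↦ (ψ x, Φ (x, y))` from `Ω`, over `U`, to `Ω'`, over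
`U'`; the base map `ψ` has inverse `θ`. -/
structure IsCoordChange (U U' : Set (Euc n)) (ψ θ : Euc n → Euc n) (Ω Ω' : Set (Euc n × Euc m))
    (Φ : Euc n × Euc m → Euc m) : Prop where
  isOpen_base : IsOpen U
  isOpen_base' : IsOpen U'
  isOpen_total : IsOpen Ω
  isOpen_total' : IsOpen Ω'
  smooth_base : ContDiffOn ℝ ∞ ψ U
  smooth_inv : ContDiffOn ℝ ∞ θ U'
  mapsTo_base : MapsTo ψ U U'
  mapsTo_inv : MapsTo θ U' U
  left_inv : ∀ x ∈ U, θ (ψ x) = x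
  right_inv : ∀ x ∈ U', ψ (θ x) = x
  smooth_fiber : ContDiffOn ℝ ∞ Φ Ω
  fst_mem : ∀ p ∈ Ω, p.1 ∈ U
  mapsTo_total : ∀ p ∈ Ω, (ψ p.1, Φ p) ∈ Ω'

/-- The expression in the new coordinates of the map `v`. -/
def transport (θ : Euc n → Euc n) (Φ : Euc n × Euc m → Euc m) (v : Euc n → Euc m) (x : Euc n) :
    Euc m :=
  Φ (θ x, v (θ x))

variable {U U' : Set (Euc n)} {ψ θ : Euc n → Euc n} {Ω Ω' : Set (Euc n × Euc m)}
  {Φ : Euc n × Euc m → Euc m} {k : ℕ} {V : Set (Euc n)} {v v₁ v₂ : Euc n → Euc m}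

lemma JetSmoothOn.of_base {a : Euc n → ℝ} (ha : ContDiffOn ℝ ∞ a U) (hU : ∀ p ∈ Ω, p.1 ∈ U) :
    JetSmoothOn Ω k (fun p => a p.1) :=
  .of_trunc (G := fun q => a q.1) (ha.comp contDiffOn_fst fun _ hq => hU _ hq) fun _ _ => rfl

lemma JetSmoothOn.of_point {a : Euc n × Euc m → ℝ} (ha : ContDiffOn ℝ ∞ a Ω) :
    JetSmoothOn Ω k (fun p => a p.point) := by
  have h : ContDiff ℝ ∞ fun q : FinJetCoord n m k => q.extend.point := by
    simp only [point_extend]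
    refine contDiff_fst.prodMk ?_
    rw [contDiff_euclidean]
    intro i
    fun_prop
  exact .of_trunc (G := fun q => a q.extend.point) (ha.comp h.contDiffOn fun q hq => hq)
    fun p _ => by rw [point_extend_trunc]

lemma dirDeriv_eq_sum {g : Euc n → ℝ} (z w : Euc n) :
    fderiv ℝ g z w = ∑ a, w a * dirDeriv (unitVec a) g z := by
  have : w = ∑ a, w a • unitVec a := by
    have := (EuclideanSpace.basisFun (Fin n) ℝ).sum_repr w
    simpa using this.symm
  conv_lhs => rw [this, map_sum]
  simp [dirDeriv]

namespace IsCoordChange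

variable (hc : IsCoordChange U U' ψ θ Ω Ω' Φ)
include hc

lemma isOpen_inv_preimage (hV : IsOpen V) : IsOpen (U' ∩ θ ⁻¹' V) :=
  hc.smooth_inv.continuousOn.isOpen_inter_preimage hc.isOpen_base' hV

lemma contDiffOn_transport (hv : ContDiffOn ℝ ∞ v V) (hΩ : ∀ z ∈ V, (z, v z) ∈ Ω) :
    ContDiffOn ℝ ∞ (transport θ Φ v) (U' ∩ θ ⁻¹' V) := by
  have hθ : ContDiffOn ℝ ∞ θ (U' ∩ θ ⁻¹' V) := hc.smooth_inv.mono inter_subset_left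
  exact hc.smooth_fiber.comp (hθ.prodMk (hv.comp hθ fun _ hx => hx.2)) fun x hx => hΩ _ hx.2

/-- The derivatives of order `|σ|` of a map in the new coordinates are functions of its jet in the
old ones, the same for all maps. -/
lemma exists_partialDeriv_transport (σ : Fin n → ℕ) (i : Fin m) :
    ∃ F : JetCoord n m → ℝ, JetSmoothOn Ω (∑ l, σ l) F ∧ ∀ (V : Set (Euc n)) (v : Euc n → Euc m),
      IsOpen V → V ⊆ U → ContDiffOn ℝ ∞ v V → (∀ z ∈ V, (z, v z) ∈ Ω) → ∀ z ∈ V,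
        partialDeriv σ (fun x => transport θ Φ v x i) (ψ z) = F (jetProl v z) := by
  -- In the old coordinates, `∂/∂x'^l` is `∑ (∂θ^a/∂x'^l) D_a`.
  let D : Fin n → (JetCoord n m → ℝ) → JetCoord n m → ℝ := fun l F p =>
    ∑ a, (fderiv ℝ θ (ψ p.1) (unitVec l)) a * totalDeriv a F p
  have hcoef : ∀ l a, ContDiffOn ℝ ∞ (fun x => (fderiv ℝ θ (ψ x) (unitVec l)) a) U := by
    intro l a
    have h1 : ContDiffOn ℝ ∞ (fun x => fderiv ℝ θ (ψ x) (unitVec l)) U :=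
      ((hc.smooth_inv.fderiv_of_isOpen hc.isOpen_base' (by simp)).comp hc.smooth_base
        hc.mapsTo_base).clm_apply contDiffOn_const
    exact contDiffOn_coord h1 a
  have hD : ∀ k F l, JetSmoothOn Ω k F → JetSmoothOn Ω (k + 1) (D l F) := fun k F l hF =>
    .sum fun a _ => (JetSmoothOn.of_base (hcoef l a) hc.fst_mem).mul
      (hF.totalDeriv hc.isOpen_total a)
  let F₀ : JetCoord n m → ℝ := fun p => Φ p.point i
  have hF₀ : JetSmoothOn Ω 0 F₀ := .of_point (contDiffOn_coord hc.smooth_fiber i)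
  refine ⟨iterOp D σ F₀, ?_, fun V v hV hVU hv hΩ => ?_⟩
  · have := iterOp_rel (fun k F (_ : Unit) => JetSmoothOn Ω k F) (D := D) (D' := fun _ => id)
      (fun k F _ l hF => hD k F l hF) σ (b := ()) hF₀
    rwa [zero_add] at this
  refine (iterOp_rel (D := D) (D' := fun l => dirDeriv (unitVec l))
    (fun k F g => JetSmoothOn Ω k F ∧ ∀ z ∈ V, g (ψ z) = F (jetProl v z))
    (fun k F g l hF => ⟨hD k F l hF.1, fun z hz => ?_⟩) σ (k := 0) (a := F₀) ⟨hF₀, ?_⟩).2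
  · have hz' : ψ z ∈ U' ∩ θ ⁻¹' V :=
      ⟨hc.mapsTo_base (hVU hz), by rw [mem_preimage, hc.left_inv z (hVU hz)]; exact hz⟩
    have he : EqOn g (fun x => F (jetProl v (θ x))) (U' ∩ θ ⁻¹' V) := fun x hx => by
      have := hF.2 (θ x) hx.2
      rwa [hc.right_inv x hx.1] at this
    rw [eqOn_dirDeriv (hc.isOpen_inv_preimage hV) he _ hz', dirDeriv]
    have hθ : HasFDerivAt θ (fderiv ℝ θ (ψ z)) (ψ z) :=
      ((hc.smooth_inv.contDiffAt (hc.isOpen_base'.mem_nhds hz'.1)).differentiableAt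
        (by simp)).hasFDerivAt
    have hG : HasFDerivAt (fun z => F (jetProl v z)) (fderiv ℝ (fun z => F (jetProl v z)) (θ (ψ z)))
        (θ (ψ z)) :=
      (((hF.1.contDiffOn_jetProl hV hv hΩ).contDiffAt (hV.mem_nhds hz'.2)).differentiableAt
        (by simp)).hasFDerivAt
    have hGθ : fderiv ℝ (fun x => F (jetProl v (θ x))) (ψ z) = _ := (hG.comp (ψ z) hθ).fderiv
    rw [hGθ, hc.left_inv z (hVU hz), ContinuousLinearMap.comp_apply, dirDeriv_eq_sum]
    refine Finset.sum_congr rfl fun a _ => ?_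
    rw [hF.1.totalDeriv_jetProl hc.isOpen_total hV hv a hz (hΩ z hz)]
    rfl
  · intro z hz
    simp only [F₀, point_jetProl, transport, hc.left_inv z (hVU hz)]

/-- Contact of order `k` does not depend on the coordinates. -/
lemma trunc_jetProl_transport (hV : IsOpen V) (hVU : V ⊆ U) (hv₁ : ContDiffOn ℝ ∞ v₁ V)
    (hv₂ : ContDiffOn ℝ ∞ v₂ V) (hΩ₁ : ∀ z ∈ V, (z, v₁ z) ∈ Ω) (hΩ₂ : ∀ z ∈ V, (z, v₂ z) ∈ Ω)
    {z : Euc n} (hz : z ∈ V) (h : (jetProl v₁ z).trunc k = (jetProl v₂ z).trunc k) :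
    (jetProl (transport θ Φ v₁) (ψ z)).trunc k = (jetProl (transport θ Φ v₂) (ψ z)).trunc k := by
  refine Prod.ext rfl ?_
  funext i σ
  obtain ⟨F, hF, hFv⟩ := hc.exists_partialDeriv_transport (σ : Fin n → ℕ) i
  refine (hFv V v₁ hV hVU hv₁ hΩ₁ z hz).trans (Eq.trans ?_ (hFv V v₂ hV hVU hv₂ hΩ₂ z hz).symm)
  refine (hF.of_le (mem_multiIndices.mp σ.2)).eq_of_trunc_eq ?_ h
  rw [point_jetProl]
  exact hΩ₁ z hz

end IsCoordChange

end CoordChange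

/-! ### Taylor polynomials -/

section Taylor

variable {n m : ℕ}

/-- The monomial `(u - a)^τ / τ!`. -/
noncomputable def taylorMonomial (a : Euc n) (τ : Fin n → ℕ) (u : Euc n) : ℝ :=
  ∏ l, (u l - a l) ^ τ l / (Nat.factorial (τ l) : ℝ)

lemma contDiff_taylorMonomial (a : Euc n) (τ : Fin n → ℕ) :
    ContDiff ℝ ∞ (taylorMonomial a τ) := by
  refine contDiff_prod fun l _ =>
    ContDiff.div_const (ContDiff.pow (ContDiff.sub ?_ contDiff_const) _) _
  exact (EuclideanSpace.proj l : Euc n →L[ℝ] ℝ).contDiff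

lemma dirDeriv_taylorMonomial (a : Euc n) (τ : Fin n → ℕ) (l : Fin n) (u : Euc n) :
    dirDeriv (unitVec l) (taylorMonomial a τ) u =
      (τ l * (u l - a l) ^ (τ l - 1) / (Nat.factorial (τ l) : ℝ)) *
        ∏ j ∈ Finset.univ.erase l, (u j - a j) ^ τ j / (Nat.factorial (τ j) : ℝ) := by
  have hd := ((contDiff_taylorMonomial a τ).differentiable (by simp)) u
  rw [dirDeriv, ← hd.lineDeriv_eq_fderiv, lineDeriv]
  have h1 : (fun t : ℝ => taylorMonomial a τ (u + t • unitVec l)) = fun t : ℝ =>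
      ((u l + t - a l) ^ τ l / (Nat.factorial (τ l) : ℝ)) *
        ∏ j ∈ Finset.univ.erase l, (u j - a j) ^ τ j / (Nat.factorial (τ j) : ℝ) := by
    funext t
    rw [taylorMonomial, ← Finset.mul_prod_erase _ _ (Finset.mem_univ l)]
    congr 1
    · simp
    · refine Finset.prod_congr rfl fun j hj => ?_
      simp [Finset.ne_of_mem_erase hj]
  rw [h1]
  refine HasDerivAt.deriv ?_
  have h2 : HasDerivAt (fun t : ℝ => u l + t - a l) 1 0 :=
    ((hasDerivAt_id (0 : ℝ)).const_add (u l)).sub_const (a l)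
  have h3 := ((h2.pow (τ l)).div_const (Nat.factorial (τ l) : ℝ)).mul_const
    (∏ j ∈ Finset.univ.erase l, (u j - a j) ^ τ j / (Nat.factorial (τ j) : ℝ))
  simpa using h3

lemma dirDeriv_taylorMonomial_add_single (a : Euc n) (τ : Fin n → ℕ) (l : Fin n) (u : Euc n) :
    dirDeriv (unitVec l) (taylorMonomial a (τ + Pi.single l 1)) u = taylorMonomial a τ u := by
  rw [dirDeriv_taylorMonomial, taylorMonomial, ← Finset.mul_prod_erase _ _ (Finset.mem_univ l)]
  congr 1
  · have h1 : ((τ l : ℝ) + 1) ≠ 0 := by positivity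
    have h2 : (Nat.factorial (τ l) : ℝ) ≠ 0 := by positivity
    simp only [Pi.add_apply, Pi.single_eq_same, Nat.add_sub_cancel, Nat.factorial_succ]
    push_cast
    field_simp
  · refine Finset.prod_congr rfl fun j hj => ?_
    simp [Finset.ne_of_mem_erase hj]

/-- The polynomial with Taylor coefficients `b` up to order `K`. -/
noncomputable def coeffPoly (K : ℕ) (a : Euc n) (b : (Fin n → ℕ) → ℝ) (u : Euc n) : ℝ :=
  ∑ τ ∈ multiIndices n K, b τ * taylorMonomial a τ u

/-- Differentiation of a polynomial shifts its Taylor coefficients. -/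
lemma dirDeriv_coeffPoly (K : ℕ) (a : Euc n) {b : (Fin n → ℕ) → ℝ}
    (hb : ∀ τ ∉ multiIndices n K, b τ = 0) (l : Fin n) :
    dirDeriv (unitVec l) (coeffPoly K a b) = coeffPoly K a fun τ => b (τ + Pi.single l 1) := by
  funext u
  have h1 : dirDeriv (unitVec l) (coeffPoly K a b) u =
      ∑ τ ∈ multiIndices n K, b τ * dirDeriv (unitVec l) (taylorMonomial a τ) u := by
    have hd : ∀ τ ∈ multiIndices n K, DifferentiableAt ℝ (fun u => b τ * taylorMonomial a τ u) u :=
      fun τ _ => (((contDiff_taylorMonomial a τ).differentiable (by simp)) u).const_mul _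
    change fderiv ℝ (fun u => ∑ τ ∈ multiIndices n K, b τ * taylorMonomial a τ u) u _ = _
    rw [fderiv_fun_sum hd, sum_apply]
    refine Finset.sum_congr rfl fun τ _ => ?_
    rw [fderiv_const_mul (((contDiff_taylorMonomial a τ).differentiable (by simp)) u)]
    rfl
  -- Let the sum run up to order `K + 1`, so that the shift `τ ↦ τ + l` maps into its index set; the
  -- multi-indices with `τ l = 0`, which it misses, contribute constants in the direction `l`.
  rw [h1, Finset.sum_subset (fun τ hτ => multiIndices_mono K.le_succ hτ)
    (fun τ _ hτ => by rw [hb τ hτ, zero_mul]), coeffPoly]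
  refine (Finset.sum_of_injOn (fun τ => τ + Pi.single l 1) (fun τ _ τ' _ h => add_right_cancel h)
    (fun τ hτ => add_single_mem_multiIndices hτ l) (fun τ hτ hτ' => ?_) fun τ _ => ?_).symm
  · have h0 : τ l = 0 := by
      by_contra h0
      have hτe : τ - Pi.single l 1 + Pi.single l 1 = τ := by
        funext j
        by_cases hj : j = l
        · subst hj
          simp only [Pi.add_apply, Pi.sub_apply, Pi.single_eq_same]
          omega
        · simp [hj]
      refine hτ' ⟨τ - Pi.single l 1, ?_, hτe⟩
      have hs : ∑ j, (τ - Pi.single l 1 + Pi.single l 1 : Fin n → ℕ) j ≤ K + 1 := by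
        rw [hτe]
        exact mem_multiIndices.mp hτ
      simp only [Pi.add_apply, Finset.sum_add_distrib, Finset.sum_pi_single', Finset.mem_univ,
        if_true] at hs
      exact mem_multiIndices.mpr (by omega)
    rw [dirDeriv_taylorMonomial, h0]
    simp
  · rw [dirDeriv_taylorMonomial_add_single]

lemma coeffPoly_self (K : ℕ) (a : Euc n) (b : (Fin n → ℕ) → ℝ) : coeffPoly K a b a = b 0 := by
  rw [coeffPoly, Finset.sum_eq_single 0]
  · simp [taylorMonomial]
  · intro σ _ hσ
    obtain ⟨l, hl⟩ := Function.ne_iff.mp hσ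
    rw [taylorMonomial, Finset.prod_eq_zero (Finset.mem_univ l) (by simp [zero_pow hl]), mul_zero]
  · intro h
    exact absurd zero_mem_multiIndices h

lemma partialDeriv_coeffPoly_self (K : ℕ) (a : Euc n) {b : (Fin n → ℕ) → ℝ}
    (hb : ∀ τ ∉ multiIndices n K, b τ = 0) (σ : Fin n → ℕ) :
    partialDeriv σ (coeffPoly K a b) a = b σ := by
  -- On coefficients, `∂_l` acts as the shift `S l`.
  let S : Fin n → ((Fin n → ℕ) → ℝ) → (Fin n → ℕ) → ℝ := fun l b τ => b (τ + Pi.single l 1)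
  have hS : ∀ σ : Fin n → ℕ, iterOp S σ b = fun τ => b (τ + σ) := by
    intro σ
    induction σ using multiIndex_induction with
    | h0 => rw [iterOp_zero]; rfl
    | hs σ l ih =>
      rw [← iterOp_add_single (R := Eq) Eq.trans (fun l h => congrArg (S l) h) ?_ σ l rfl, ih]
      · funext τ
        simp only [S]
        congr 1
        abel
      · intro b k l _
        funext τ
        simp only [S]
        congr 1
        abel
  have h := iterOp_rel' (D := S) (D' := fun l => dirDeriv (unitVec l))
    (fun b g => (∀ τ ∉ multiIndices n K, b τ = 0) ∧ g = coeffPoly K a b) (fun b g l h =>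
      ⟨fun τ hτ => h.1 _ fun h' => hτ (by
        rw [mem_multiIndices] at *
        simp only [Pi.add_apply, Finset.sum_add_distrib] at h'
        omega), by rw [h.2, dirDeriv_coeffPoly K a h.1]⟩) σ (a := b) ⟨hb, rfl⟩
  rw [partialDeriv_eq_iterOp, h.2, coeffPoly_self, hS]
  simp only [zero_add]

/-- The derivatives of the Taylor polynomial are its coefficients. -/
lemma jetProl_taylorPoly (K : ℕ) (p : JetCoord n m) :
    jetProl (AdaptedChart.taylorPoly K p) p.1 = (p.trunc K).extend := by
  refine Prod.ext rfl ?_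
  funext i σ
  have h := partialDeriv_coeffPoly_self K p.1
    (b := fun τ => if τ ∈ multiIndices n K then p.2 i τ else 0) (fun τ hτ => if_neg hτ) σ
  have he : (fun u => AdaptedChart.taylorPoly K p u i) =
      coeffPoly K p.1 fun τ => if τ ∈ multiIndices n K then p.2 i τ else 0 := by
    funext u
    refine Finset.sum_congr rfl fun τ hτ => ?_
    simp only [if_pos hτ, taylorMonomial]
  simp only [jetProl, he, h, FinJetCoord.extend, JetCoord.trunc]
  rfl

end Taylor

/-! ### Transformation of the Euler--Lagrange expressions -/

section Transformation

open MeasureTheory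

variable {n m : ℕ} {U U' : Set (Euc n)} {ψ θ : Euc n → Euc n} {Ω Ω' : Set (Euc n × Euc m)}
  {Φ : Euc n × Euc m → Euc m} {k : ℕ} {f f' : JetCoord n m → ℝ} {u : Euc n → Euc m}

namespace IsCoordChange

/-- The change of coordinates over a smaller open set. -/
lemma restrict (hc : IsCoordChange U U' ψ θ Ω Ω' Φ) {V : Set (Euc n)} (hV : IsOpen V)
    (hVU : V ⊆ U) : IsCoordChange V (U' ∩ θ ⁻¹' V) ψ θ (Ω ∩ Prod.fst ⁻¹' V) Ω' Φ where
  isOpen_base := hV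
  isOpen_base' := hc.isOpen_inv_preimage hV
  isOpen_total := hc.isOpen_total.inter (hV.preimage continuous_fst)
  isOpen_total' := hc.isOpen_total'
  smooth_base := hc.smooth_base.mono hVU
  smooth_inv := hc.smooth_inv.mono inter_subset_left
  mapsTo_base := fun x hx => ⟨hc.mapsTo_base (hVU hx), by
    rw [mem_preimage, hc.left_inv x (hVU hx)]
    exact hx⟩
  mapsTo_inv := fun _ hx => hx.2
  left_inv := fun x hx => hc.left_inv x (hVU hx)
  right_inv := fun x hx => hc.right_inv x hx.1
  smooth_fiber := hc.smooth_fiber.mono inter_subset_left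
  fst_mem := fun _ hp => hp.2
  mapsTo_total := fun p hp => hc.mapsTo_total p hp.1

variable (hc : IsCoordChange U U' ψ θ Ω Ω' Φ)
include hc

lemma hasFDerivAt_base {z : Euc n} (hz : z ∈ U) : HasFDerivAt ψ (fderiv ℝ ψ z) z :=
  ((hc.smooth_base.contDiffAt (hc.isOpen_base.mem_nhds hz)).differentiableAt
    (by simp)).hasFDerivAt

lemma contDiffOn_det : ContDiffOn ℝ ∞ (fun z => (fderiv ℝ ψ z).det) U := by
  have h1 : ContDiffOn ℝ ∞ (fderiv ℝ ψ) U :=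
    hc.smooth_base.fderiv_of_isOpen hc.isOpen_base (by simp)
  have h2 : ∀ z, (fderiv ℝ ψ z).det = (Matrix.of fun i j => (fderiv ℝ ψ z (unitVec j)) i).det := by
    intro z
    rw [ContinuousLinearMap.det,
      ← LinearMap.det_toMatrix (EuclideanSpace.basisFun (Fin n) ℝ).toBasis]
    rfl
  simp only [h2, Matrix.det_apply]
  refine ContDiffOn.sum fun σ _ => ContDiffOn.const_smul _ (contDiffOn_prod fun i _ => ?_)
  exact contDiffOn_coord (h1.clm_apply contDiffOn_const) _

lemma det_ne_zero {z : Euc n} (hz : z ∈ U) : (fderiv ℝ ψ z).det ≠ 0 := by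
  have hθ : HasFDerivAt θ (fderiv ℝ θ (ψ z)) (ψ z) :=
    ((hc.smooth_inv.contDiffAt (hc.isOpen_base'.mem_nhds (hc.mapsTo_base hz))).differentiableAt
      (by simp)).hasFDerivAt
  have h1 := hθ.comp z (hc.hasFDerivAt_base hz)
  have h2 : HasFDerivAt (θ ∘ ψ) (ContinuousLinearMap.id ℝ (Euc n)) z :=
    (hasFDerivAt_id z).congr_of_eventuallyEq <| by
      filter_upwards [hc.isOpen_base.mem_nhds hz] with x hx using hc.left_inv x hx
  have h3 := congrArg ContinuousLinearMap.det (h1.unique h2)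
  have h4 : (fderiv ℝ θ (ψ z)).det * (fderiv ℝ ψ z).det = 1 := by
    simpa [ContinuousLinearMap.det, LinearMap.det_comp] using h3
  exact right_ne_zero_of_mul_eq_one h4

lemma fiber_differentiableAt {p : Euc n × Euc m} (hp : p ∈ Ω) :
    HasFDerivAt Φ (fderiv ℝ Φ p) p :=
  ((hc.smooth_fiber.contDiffAt (hc.isOpen_total.mem_nhds hp)).differentiableAt
    (by simp)).hasFDerivAt

/-- The transformation law of the Euler--Lagrange expressions, where the Jacobian determinant has
constant sign `ε`. The linearizations of the two Lagrangians in the direction of a compactly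
supported vertical field correspond to each other, hence so do their integrals; these determine
the Euler--Lagrange expressions. -/
theorem eulerExpr_transport_of_sign (hf : JetSmoothOn Ω k f) (hf' : JetSmoothOn Ω' k f')
    (hinv : ∀ (V : Set (Euc n)) (v : Euc n → Euc m), IsOpen V → V ⊆ U → ContDiffOn ℝ ∞ v V →
      (∀ z ∈ V, (z, v z) ∈ Ω) → ∀ z ∈ V,
        f (jetProl v z) = (fderiv ℝ ψ z).det * f' (jetProl (transport θ Φ v) (ψ z)))
    {ε : ℝ} (hε : ∀ z ∈ U, (fderiv ℝ ψ z).det = ε * |(fderiv ℝ ψ z).det|)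
    (hu : ContDiffOn ℝ ∞ u U) (hΩU : ∀ z ∈ U, (z, u z) ∈ Ω) (j : Fin m) {z : Euc n} (hz : z ∈ U) :
    eulerExpr k f j (jetProl u z) = (fderiv ℝ ψ z).det *
      ∑ i, (fderiv ℝ Φ (z, u z) (0, EuclideanSpace.single j 1)) i *
        eulerExpr k f' i (jetProl (transport θ Φ u) (ψ z)) := by
  have hU := hc.isOpen_base
  have hU' := hc.isOpen_base'
  set u' := transport θ Φ u with hu'
  have hu's : ContDiffOn ℝ ∞ u' U' :=
    (hc.contDiffOn_transport hu hΩU).mono fun x hx => ⟨hx, hc.mapsTo_inv hx⟩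
  have hΩU' : ∀ x ∈ U', (x, u' x) ∈ Ω' := fun x hx => by
    have := hc.mapsTo_total _ (hΩU (θ x) (hc.mapsTo_inv hx))
    rwa [hc.right_inv x hx] at this
  have hJs : ∀ i, ContDiffOn ℝ ∞
      (fun z => (fderiv ℝ Φ (z, u z) (0, EuclideanSpace.single j 1)) i) U := by
    intro i
    refine contDiffOn_coord (ContDiffOn.clm_apply ?_ contDiffOn_const) i
    exact (hc.smooth_fiber.fderiv_of_isOpen hc.isOpen_total (by simp)).comp
      (contDiffOn_id.prodMk hu) fun z hz => hΩU z hz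
  have hE's : ∀ i, ContDiffOn ℝ ∞ (fun z => eulerExpr k f' i (jetProl u' (ψ z))) U := fun i =>
    ((hf'.eulerExpr hc.isOpen_total' i).contDiffOn_jetProl hU' hu's hΩU').comp hc.smooth_base
      hc.mapsTo_base
  have hEs := (hf.eulerExpr hc.isOpen_total j).contDiffOn_jetProl hU hu hΩU
  have hRs : ContDiffOn ℝ ∞ (fun z => (fderiv ℝ ψ z).det *
      ∑ i, (fderiv ℝ Φ (z, u z) (0, EuclideanSpace.single j 1)) i *
        eulerExpr k f' i (jetProl u' (ψ z))) U :=
    hc.contDiffOn_det.mul (ContDiffOn.sum fun i _ => (hJs i).mul (hE's i))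
  rw [← sub_eq_zero]
  refine eqOn_zero_of_integral_testOn hU (g := fun z => eulerExpr k f j (jetProl u z) -
    (fderiv ℝ ψ z).det * ∑ i, (fderiv ℝ Φ (z, u z) (0, EuclideanSpace.single j 1)) i *
      eulerExpr k f' i (jetProl u' (ψ z))) (hEs.sub hRs).continuousOn (fun φ hφ => ?_) hz
  -- Vary `u` by `t φ e_j`, in both systems of coordinates.
  set η : Fin m → Euc n → ℝ := fun i => if i = j then φ else fun _ => 0 with hη
  have hηt : ∀ i, TestOn U (η i) := fun i => by
    by_cases h : i = j
    · simpa [hη, h] using hφ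
    · simpa [hη, h] using TestOn.zero
  have hηs : ∀ i, ContDiffOn ℝ ∞ (η i) U := fun i => (hηt i).1
  have hηv : ∀ x, (WithLp.toLp 2 fun i => η i x : Euc m) = φ x • EuclideanSpace.single j 1 := by
    intro x
    ext i
    by_cases h : i = j <;> simp [hη, h]
  set w := affineFamily u η with hw
  set W := affineDomain Ω U u η with hW
  have hWo : IsOpen W := isOpen_affineDomain hc.isOpen_total hU hu hηs
  have hws : ContDiffOn ℝ ∞ w W := (contDiffOn_affineFamily hu hηs).mono fun _ hp => hp.1
  have hw0 : (fun x => w (0, x)) = u := affineFamily_zero u η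
  have hWx : ∀ y ∈ U, ((0 : ℝ), y) ∈ W := fun y hy => ⟨hy, by
    rw [show affineFamily u η (0, y) = u y from congrFun hw0 y]
    exact hΩU y hy⟩
  set w' : ℝ × Euc n → Euc m := fun p => Φ (θ p.2, w (p.1, θ p.2)) with hw'
  set W' : Set (ℝ × Euc n) := {p | p.2 ∈ U' ∧ (p.1, θ p.2) ∈ W} with hW'
  have hθs : ContDiffOn ℝ ∞ (fun p : ℝ × Euc n => (p.1, θ p.2)) {p | p.2 ∈ U'} :=
    contDiffOn_fst.prodMk (hc.smooth_inv.comp contDiffOn_snd fun _ hp => hp)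
  have hW'o : IsOpen W' :=
    hθs.continuousOn.isOpen_inter_preimage (hU'.preimage continuous_snd) hWo
  have hw's : ContDiffOn ℝ ∞ w' W' := by
    have h1 : ContDiffOn ℝ ∞ (fun p : ℝ × Euc n => (p.1, θ p.2)) W' := hθs.mono fun _ hp => hp.1
    exact hc.smooth_fiber.comp ((contDiffOn_snd.comp h1 fun _ _ => mem_univ _).prodMk
      (hws.comp h1 fun _ hp => hp.2)) fun p hp => hp.2.2
  have hw'0 : (fun x => w' (0, x)) = u' := by
    funext x
    simp only [hw', hu', transport]
    rw [show w (0, θ x) = u (θ x) from congrFun hw0 (θ x)]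
  have hW'x : ∀ x ∈ U', ((0 : ℝ), x) ∈ W' := fun x hx => ⟨hx, hWx _ (hc.mapsTo_inv hx)⟩
  set η' : Fin m → Euc n → ℝ := fun i x =>
    dirDeriv ((1 : ℝ), (0 : Euc n)) (fun p => w' p i) (0, x) with hη'
  have hη'ψ : ∀ i, ∀ x ∈ U, η' i (ψ x) =
      φ x * (fderiv ℝ Φ (x, u x) (0, EuclideanSpace.single j 1)) i := by
    intro i x hx
    have h1 := hasDerivAt_slice hW'o (contDiffOn_coord hw's i) (hW'x _ (hc.mapsTo_base hx))
    refine h1.unique ?_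
    have hl : HasDerivAt (fun t : ℝ => (x, w (t, x)))
        ((0 : Euc n), φ x • (EuclideanSpace.single j 1 : Euc m)) 0 := by
      refine (hasDerivAt_const 0 x).prodMk ?_
      have := ((hasDerivAt_id (0 : ℝ)).smul_const (WithLp.toLp 2 fun i => η i x : Euc m)).const_add
        (u x)
      rw [hηv, one_smul] at this
      simpa [hw, affineFamily, hηv] using this
    have hx0 : (x, w (0, x)) = (x, u x) := by rw [show w (0, x) = u x from congrFun hw0 x]
    have hΦ : HasFDerivAt Φ (fderiv ℝ Φ (x, u x)) ((fun t : ℝ => (x, w (t, x))) 0) := by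
      simp only [hx0]
      exact hc.fiber_differentiableAt (hΩU x hx)
    have h2 := hΦ.comp_hasDerivAt 0 hl
    have h3 := (EuclideanSpace.proj i : Euc m →L[ℝ] ℝ).hasFDerivAt.comp_hasDerivAt 0 h2
    have h4 : ((0 : Euc n), φ x • (EuclideanSpace.single j 1 : Euc m)) =
        φ x • ((0 : Euc n), (EuclideanSpace.single j 1 : Euc m)) := by simp
    rw [h4, map_smul] at h3
    simp only [hw', hc.left_inv x hx]
    exact h3
  -- The variation in the new coordinates is supported in the compact set `ψ '' K`.
  have hη't : ∀ i, TestOn U' (η' i) := by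
    intro i
    obtain ⟨hs, K, hKU, hK, h0⟩ := hφ
    refine ⟨?_, ψ '' K, fun x hx => ?_, hK.image_of_continuousOn
      (hc.smooth_base.continuousOn.mono hKU), fun x hx hxK => ?_⟩
    · exact (contDiffOn_slice (contDiffOn_dirDeriv hW'o (contDiffOn_coord hw's i) _) 0).mono
        fun x hx => hW'x x hx
    · obtain ⟨y, hy, rfl⟩ := hx
      exact hc.mapsTo_base (hKU hy)
    · have h1 := hη'ψ i (θ x) (hc.mapsTo_inv hx)
      rw [hc.right_inv x hx] at h1
      rw [h1, h0 (θ x) (hc.mapsTo_inv hx) fun h => hxK ⟨θ x, h, hc.right_inv x hx⟩, zero_mul]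
  -- Differentiate the invariance of the Lagrangian along the family at `t = 0`.
  have hlin : ∀ x ∈ U, variation k f u η x =
      (fderiv ℝ ψ x).det * variation k f' u' η' (ψ x) := by
    intro x hx
    have h1 := hf.hasDerivAt_family hc.isOpen_total hWo hws (hWx x hx) (hWx x hx).2
    rw [variation_congr hU (fun y _ => congrFun hw0 y)
      (fun i y hy => dirDeriv_affineFamily hU hu hηs i 0 hy) k f hx] at h1
    have hψx := hc.mapsTo_base hx
    have hΩ'x : (ψ x, w' (0, ψ x)) ∈ Ω' := by
      rw [show w' (0, ψ x) = u' (ψ x) from congrFun hw'0 (ψ x)]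
      exact hΩU' _ hψx
    have h2 := hf'.hasDerivAt_family hc.isOpen_total' hW'o hw's (hW'x _ hψx) hΩ'x
    rw [hw'0] at h2
    refine h1.unique ((h2.const_mul (fderiv ℝ ψ x).det).congr_of_eventuallyEq ?_)
    have hV : IsOpen {t : ℝ | (t, x) ∈ W} := hWo.preimage (by fun_prop)
    filter_upwards [hV.mem_nhds (hWx x hx)] with t ht
    exact hinv {x | (t, x) ∈ W} (fun x => w (t, x)) (isOpen_slice hWo t) (fun y hy => hy.1)
      (contDiffOn_slice hws t) (fun y hy => hy.2) x ht
  have himg : ψ '' U = U' := by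
    refine Subset.antisymm (image_subset_iff.mpr hc.mapsTo_base) fun x hx =>
      ⟨θ x, hc.mapsTo_inv hx, hc.right_inv x hx⟩
  have hinj : InjOn ψ U := fun x hx y hy h => by rw [← hc.left_inv x hx, h, hc.left_inv y hy]
  have hcov : ∀ G : Euc n → ℝ, ∫ x in U, (fderiv ℝ ψ x).det * G (ψ x) = ε * ∫ x in U', G x := by
    intro G
    rw [← himg, integral_image_eq_integral_abs_det_fderiv_smul volume hU.measurableSet
      (fun x hx => (hc.hasFDerivAt_base hx).hasFDerivWithinAt) hinj, ← integral_const_mul]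
    refine setIntegral_congr_fun hU.measurableSet fun x hx => ?_
    simp only [smul_eq_mul]
    rw [← mul_assoc, ← hε x hx]
  have hint : ∫ x in U, φ x * eulerExpr k f j (jetProl u x) =
      ∫ x in U, φ x * ((fderiv ℝ ψ x).det *
        ∑ i, (fderiv ℝ Φ (x, u x) (0, EuclideanSpace.single j 1)) i *
          eulerExpr k f' i (jetProl u' (ψ x))) := by
    have e1 : ∫ x in U, φ x * eulerExpr k f j (jetProl u x) = ∫ x in U, variation k f u η x := by
      rw [hf.integral_variation hc.isOpen_total hU hu hΩU hηt]
      congr 1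
      funext x
      rw [Finset.sum_eq_single j] <;> simp +contextual [hη]
    rw [e1, setIntegral_congr_fun hU.measurableSet hlin, hcov (variation k f' u' η'),
      hf'.integral_variation hc.isOpen_total' hU' hu's hΩU' hη't, ← hcov]
    refine setIntegral_congr_fun hU.measurableSet fun x hx => ?_
    simp only [Finset.mul_sum]
    refine Finset.sum_congr rfl fun i _ => ?_
    rw [hη'ψ i x hx]
    ring
  simp only [mul_sub]
  rw [integral_sub ((hφ.mul_right hEs).integrableOn hU) ((hφ.mul_right hRs).integrableOn hU), hint,
    sub_self]

/-- The transformation law of the Euler--Lagrange expressions: if `f` and `f'` represent the same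
Lagrangian, in that their values along each map differ by the Jacobian, then `E(f)_j` and `E(f')_i`
are related by the Jacobian and the derivatives `∂Φ^i/∂y^j`. -/
theorem eulerExpr_transport (hf : JetSmoothOn Ω k f) (hf' : JetSmoothOn Ω' k f')
    (hinv : ∀ (V : Set (Euc n)) (v : Euc n → Euc m), IsOpen V → V ⊆ U → ContDiffOn ℝ ∞ v V →
      (∀ z ∈ V, (z, v z) ∈ Ω) → ∀ z ∈ V,
        f (jetProl v z) = (fderiv ℝ ψ z).det * f' (jetProl (transport θ Φ v) (ψ z)))
    (hu : ContDiffOn ℝ ∞ u U) (hΩU : ∀ z ∈ U, (z, u z) ∈ Ω) (j : Fin m) {z : Euc n} (hz : z ∈ U) :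
    eulerExpr k f j (jetProl u z) = (fderiv ℝ ψ z).det *
      ∑ i, (fderiv ℝ Φ (z, u z) (0, EuclideanSpace.single j 1)) i *
        eulerExpr k f' i (jetProl (transport θ Φ u) (ψ z)) := by
  set d : Euc n → ℝ := fun z => (fderiv ℝ ψ z).det with hd
  -- Restrict to the neighbourhood of `z` where the determinant has the sign it has at `z`.
  set V : Set (Euc n) := {x | x ∈ U ∧ 0 < d x * d z} with hV
  have hVo : IsOpen V :=
    (hc.contDiffOn_det.continuousOn.mul continuousOn_const).isOpen_inter_preimage
      hc.isOpen_base isOpen_Ioi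
  have hVU : V ⊆ U := fun x hx => hx.1
  have hzV : z ∈ V := ⟨hz, mul_self_pos.mpr (hc.det_ne_zero hz)⟩
  refine (hc.restrict hVo hVU).eulerExpr_transport_of_sign (hf.subset inter_subset_left) hf'
    (fun V' v hV' hV'V hv hΩ => hinv V' v hV' (hV'V.trans hVU) hv fun x hx => (hΩ x hx).1)
    (ε := SignType.sign (d z)) (fun x hx => ?_) (hu.mono hVU) (fun x hx => ⟨hΩU x hx.1, hx⟩) j hzV
  have h1 : SignType.sign (d x) = SignType.sign (d z) := by
    rcases pos_and_pos_or_neg_and_neg_of_mul_pos hx.2 with h | h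
    · rw [sign_pos h.1, sign_pos h.2]
    · rw [sign_neg h.1, sign_neg h.2]
  rw [← h1]
  exact (sign_mul_abs (d x)).symm

end IsCoordChange

end Transformation

set_option linter.unusedSectionVars false

/-! ### Coordinate expressions of sections -/

section Charts

variable {n m : ℕ} {X Y : Type*}
  [TopologicalSpace X] [ChartedSpace (Euc n) X] [IsManifold 𝓘(ℝ, Euc n) ∞ X]
  [TopologicalSpace Y] [ChartedSpace (Euc n × Euc m) Y]
  [IsManifold 𝓘(ℝ, Euc n × Euc m) ∞ Y]
  {π : FiberedManifold n m X Y}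

namespace AdaptedChart

variable (c c' : AdaptedChart π) (s t : LocalSection π)

/-- The coordinate expression `y^i ∘ s` of a section; it represents the section on `exprDomain`. -/
noncomputable def expr (z : Euc n) : Euc m := (c.total (s.toFun (c.base.symm z))).2

/-- The open set where the coordinate expression of a section represents it. -/
def exprDomain : Set (Euc n) :=
  c.base.target ∩ c.base.symm ⁻¹' (s.domain ∩ s.toFun ⁻¹' c.total.source)

lemma isOpen_exprDomain : IsOpen (c.exprDomain s) :=
  c.base.symm.isOpen_inter_preimage
    (s.smooth.continuousOn.isOpen_inter_preimage s.isOpen_domain c.total.open_source)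

variable {s t}

lemma mem_base_source {x : X} (hx : x ∈ s.domain) (hc : s.toFun x ∈ c.total.source) :
    x ∈ c.base.source := by
  have := c.proj_mem _ hc
  rwa [s.isSection x hx] at this

lemma base_mem_exprDomain {x : X} (hx : x ∈ s.domain) (hc : s.toFun x ∈ c.total.source) :
    c.base x ∈ c.exprDomain s := by
  have hb := c.mem_base_source hx hc
  refine ⟨c.base.map_source hb, ?_⟩
  rw [mem_preimage, c.base.left_inv hb]
  exact ⟨hx, hc⟩

lemma total_section {x : X} (hx : x ∈ s.domain) (hc : s.toFun x ∈ c.total.source) :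
    c.total (s.toFun x) = (c.base x, c.expr s (c.base x)) := by
  refine Prod.ext ?_ ?_
  · rw [c.fst_total _ hc, s.isSection x hx]
  · rw [expr, c.base.left_inv (c.mem_base_source hx hc)]

lemma total_section' {z : Euc n} (hz : z ∈ c.exprDomain s) :
    c.total (s.toFun (c.base.symm z)) = (z, c.expr s z) := by
  rw [c.total_section hz.2.1 hz.2.2, c.base.right_inv hz.1]

lemma graph_expr_mem {z : Euc n} (hz : z ∈ c.exprDomain s) : (z, c.expr s z) ∈ c.total.target := by
  rw [← c.total_section' hz]
  exact c.total.map_source hz.2.2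

lemma contDiffOn_expr : ContDiffOn ℝ ∞ (c.expr s) (c.exprDomain s) := by
  rw [← contMDiffOn_iff_contDiffOn]
  have h1 : ContMDiffOn 𝓘(ℝ, Euc n) 𝓘(ℝ, Euc n) ∞ c.base.symm (c.exprDomain s) :=
    (contMDiffOn_symm_of_mem_maximalAtlas c.base_mem).mono fun _ hz => hz.1
  have h2 := (contMDiffOn_of_mem_maximalAtlas c.total_mem).comp (s.smooth.comp h1
    fun _ hz => hz.2.1) fun _ hz => hz.2.2
  exact contDiff_snd.contMDiff.comp_contMDiffOn h2

lemma base_mdifferentiable : c.base.MDifferentiable 𝓘(ℝ, Euc n) 𝓘(ℝ, Euc n) :=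
  ⟨(contMDiffOn_of_mem_maximalAtlas c.base_mem).mdifferentiableOn (by simp),
    (contMDiffOn_symm_of_mem_maximalAtlas c.base_mem).mdifferentiableOn (by simp)⟩

lemma total_mdifferentiable :
    c.total.MDifferentiable 𝓘(ℝ, Euc n × Euc m) 𝓘(ℝ, Euc n × Euc m) :=
  ⟨(contMDiffOn_of_mem_maximalAtlas c.total_mem).mdifferentiableOn (by simp),
    (contMDiffOn_symm_of_mem_maximalAtlas c.total_mem).mdifferentiableOn (by simp)⟩

/-! ### Change of adapted chart -/

/-- The change of coordinates on the base. -/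
def baseChange : OpenPartialHomeomorph (Euc n) (Euc n) := c.base.symm.trans c'.base

/-- The change of coordinates on the total space. -/
def totalChange : OpenPartialHomeomorph (Euc n × Euc m) (Euc n × Euc m) :=
  c.total.symm.trans c'.total

/-- The fibre components of the change of coordinates. -/
def fiberChange (p : Euc n × Euc m) : Euc m := (c.totalChange c' p).2

lemma contDiffOn_totalChange :
    ContDiffOn ℝ ∞ (c.totalChange c') (c.totalChange c').source := by
  rw [← contMDiffOn_iff_contDiffOn]
  exact (contMDiffOn_of_mem_maximalAtlas c'.total_mem).comp
    ((contMDiffOn_symm_of_mem_maximalAtlas c.total_mem).mono fun _ hz => by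
      simp only [totalChange, mfld_simps] at hz
      exact hz.1) fun _ hz => by
      simp only [totalChange, mfld_simps] at hz
      exact hz.2

lemma contDiffOn_baseChange : ContDiffOn ℝ ∞ (c.baseChange c') (c.baseChange c').source := by
  rw [← contMDiffOn_iff_contDiffOn]
  exact (contMDiffOn_of_mem_maximalAtlas c'.base_mem).comp
    ((contMDiffOn_symm_of_mem_maximalAtlas c.base_mem).mono fun _ hz => by
      simp only [baseChange, mfld_simps] at hz
      exact hz.1) fun _ hz => by
      simp only [baseChange, mfld_simps] at hz
      exact hz.2

lemma baseChange_symm : (c.baseChange c').symm = c'.baseChange c := by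
  simp [baseChange, OpenPartialHomeomorph.trans_symm_eq_symm_trans_symm]

lemma fst_of_mem_target {p : Euc n × Euc m} (hp : p ∈ c.total.target) :
    c.base (π.proj (c.total.symm p)) = p.1 := by
  rw [← c.fst_total _ (c.total.map_target hp), c.total.right_inv hp]

lemma symm_fst_of_mem_target {p : Euc n × Euc m} (hp : p ∈ c.total.target) :
    c.base.symm p.1 = π.proj (c.total.symm p) := by
  rw [← c.fst_of_mem_target hp, c.base.left_inv (c.proj_mem _ (c.total.map_target hp))]

lemma fst_mem_base_target {p : Euc n × Euc m} (hp : p ∈ c.total.target) : p.1 ∈ c.base.target := by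
  rw [← c.fst_of_mem_target hp]
  exact c.base.map_source (c.proj_mem _ (c.total.map_target hp))

lemma isCoordChange : IsCoordChange (c.baseChange c').source (c.baseChange c').target
    (c.baseChange c') (c.baseChange c').symm (c.totalChange c').source c'.total.target
    (c.fiberChange c') where
  isOpen_base := (c.baseChange c').open_source
  isOpen_base' := (c.baseChange c').open_target
  isOpen_total := (c.totalChange c').open_source
  isOpen_total' := c'.total.open_target
  smooth_base := c.contDiffOn_baseChange c'
  smooth_inv := by
    rw [← OpenPartialHomeomorph.symm_source, baseChange_symm]
    exact c'.contDiffOn_baseChange c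
  mapsTo_base := (c.baseChange c').mapsTo
  mapsTo_inv := (c.baseChange c').mapsTo_symm
  left_inv := fun _ hx => (c.baseChange c').left_inv hx
  right_inv := fun _ hx => (c.baseChange c').right_inv hx
  smooth_fiber := contDiff_snd.comp_contDiffOn (c.contDiffOn_totalChange c')
  fst_mem := by
    intro p hp
    simp only [totalChange, mfld_simps] at hp
    simp only [baseChange, mfld_simps]
    refine ⟨c.fst_mem_base_target hp.1, ?_⟩
    rw [c.symm_fst_of_mem_target hp.1]
    exact c'.proj_mem _ hp.2
  mapsTo_total := by
    intro p hp
    have h1 : (c.baseChange c' p.1, c.fiberChange c' p) = c.totalChange c' p := by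
      simp only [totalChange, mfld_simps] at hp
      refine Prod.ext ?_ rfl
      simp only [baseChange, totalChange, mfld_simps]
      rw [c.symm_fst_of_mem_target hp.1, c'.fst_total _ hp.2]
    rw [h1]
    have := (c.totalChange c').mapsTo hp
    simp only [totalChange, mfld_simps] at this
    exact this.1

/-- The coordinates, in the chart `c`, of the points where both charts represent the section. -/
def commonDomain (s : LocalSection π) : Set (Euc n) :=
  c.exprDomain s ∩ c.base.symm ⁻¹' (s.domain ∩ s.toFun ⁻¹' c'.total.source)

lemma isOpen_commonDomain : IsOpen (c.commonDomain c' s) := by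
  have h1 := c.base.symm.isOpen_inter_preimage
    (s.smooth.continuousOn.isOpen_inter_preimage s.isOpen_domain c'.total.open_source)
  convert (c.isOpen_exprDomain s).inter h1 using 1
  ext z
  exact ⟨fun h => ⟨h.1, h.1.1, h.2⟩, fun h => ⟨h.1, h.2.2⟩⟩

lemma commonDomain_subset : c.commonDomain c' s ⊆ (c.baseChange c').source := by
  intro z hz
  simp only [baseChange, mfld_simps]
  exact ⟨hz.1.1, c'.mem_base_source hz.2.1 hz.2.2⟩

lemma graph_mem_totalChange {z : Euc n} (hz : z ∈ c.commonDomain c' s) :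
    (z, c.expr s z) ∈ (c.totalChange c').source := by
  simp only [totalChange, mfld_simps]
  refine ⟨c.graph_expr_mem hz.1, ?_⟩
  rw [← c.total_section' hz.1, c.total.left_inv hz.1.2.2]
  exact hz.2.2

lemma base_mem_commonDomain {x : X} (hx : x ∈ s.domain) (hc : s.toFun x ∈ c.total.source)
    (hc' : s.toFun x ∈ c'.total.source) : c.base x ∈ c.commonDomain c' s := by
  refine ⟨c.base_mem_exprDomain hx hc, ?_⟩
  rw [mem_preimage, c.base.left_inv (c.mem_base_source hx hc)]
  exact ⟨hx, hc'⟩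

lemma baseChange_base {x : X} (hx : x ∈ c.base.source) :
    c.baseChange c' (c.base x) = c'.base x := by
  simp [baseChange, c.base.left_inv hx]

/-- The coordinate expressions of a section in two charts are related by the change of coordinates. -/
lemma expr_eq_transport : EqOn (c'.expr s)
    (transport (c.baseChange c').symm (c.fiberChange c') (c.expr s))
    ((c.baseChange c').target ∩ (c.baseChange c').symm ⁻¹' c.commonDomain c' s) := by
  rintro x' ⟨hx', hz⟩
  have hz1 := hz.1
  have hb : c.base.symm ((c.baseChange c').symm x') = c'.base.symm x' := by
    simp only [baseChange, mfld_simps] at hx' ⊢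
    exact c.base.left_inv hx'.2
  rw [transport, ← c.total_section' hz1, fiberChange, totalChange,
    OpenPartialHomeomorph.trans_apply, c.total.left_inv hz1.2.2, hb]
  rfl

lemma jetProl_expr_eq {x : X} (hx : x ∈ s.domain) (hc : s.toFun x ∈ c.total.source)
    (hc' : s.toFun x ∈ c'.total.source) :
    jetProl (c'.expr s) (c'.base x) =
      jetProl (transport (c.baseChange c').symm (c.fiberChange c') (c.expr s))
        (c.baseChange c' (c.base x)) := by
  have hb := c.mem_base_source hx hc
  have hcc := c.isCoordChange c'
  have hz := c.base_mem_commonDomain c' hx hc hc'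
  rw [← c.baseChange_base c' hb]
  refine jetProl_congr (hcc.isOpen_inv_preimage (c.isOpen_commonDomain c'))
    (c.expr_eq_transport c') ⟨hcc.mapsTo_base (c.commonDomain_subset c' hz), ?_⟩
  rw [mem_preimage, hcc.left_inv _ (c.commonDomain_subset c' hz)]
  exact hz

/-- Sections with the same jet coordinates in one adapted chart have the same jet. -/
lemma jet_eq_of_trunc_eq {k : ℕ} {x : X} (hs : x ∈ s.domain) (ht : x ∈ t.domain)
    (hcs : s.toFun x ∈ c.total.source) (hct : t.toFun x ∈ c.total.source)
    (h : (jetProl (c.expr s) (c.base x)).trunc k = (jetProl (c.expr t) (c.base x)).trunc k) :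
    s.jet k hs = t.jet k ht := by
  have hst : s.toFun x = t.toFun x := by
    refine c.total.injOn hcs hct ?_
    have := congrArg (fun q => q.extend.point) h
    simp only [point_extend_trunc, point_jetProl] at this
    rw [c.total_section hs hcs, c.total_section ht hct, this]
  refine Quotient.sound ⟨hst, fun c' hc' i σ hσ => ?_⟩
  have hc't : t.toFun x ∈ c'.total.source := hst ▸ hc'
  have h1 := (c.isCoordChange c').trunc_jetProl_transport (k := k)
    ((c.isOpen_commonDomain c' (s := s)).inter (c.isOpen_commonDomain c' (s := t)))
    (fun z hz => c.commonDomain_subset c' hz.1) (c.contDiffOn_expr.mono fun z hz => hz.1.1)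
    (c.contDiffOn_expr.mono fun z hz => hz.2.1) (fun z hz => c.graph_mem_totalChange c' hz.1)
    (fun z hz => c.graph_mem_totalChange c' hz.2)
    ⟨c.base_mem_commonDomain c' hs hcs hc', c.base_mem_commonDomain c' ht hct hc't⟩ h
  rw [← c.jetProl_expr_eq c' hs hcs hc', ← c.jetProl_expr_eq c' ht hct hc't] at h1
  exact congrFun (congrFun (congrArg Prod.snd h1) i) ⟨σ, hσ⟩

/-- The jet coordinates of `j_k s` are the derivatives of `s`, whichever section represents the jet in
the definition of `jetCoord`. -/
lemma jetCoord_jet {k : ℕ} {x : X} (hx : x ∈ s.domain) (hc : s.toFun x ∈ c.total.source) :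
    c.jetCoord (s.jet k hx) = ((jetProl (c.expr s) (c.base x)).trunc k).extend := by
  have h : (jetSetoid π k x).r (s.jet k hx).out ⟨s, hx⟩ := Quotient.mk_out (s := jetSetoid π k x) _
  refine Prod.ext rfl ?_
  funext i σ
  simp only [jetCoord, FinJetCoord.extend, JetCoord.trunc]
  by_cases hσ : σ ∈ multiIndices n k
  · simp only [hσ, if_true, dif_pos]
    exact h.2 c (by rw [h.1]; exact hc) i σ hσ
  · simp [hσ]

lemma trunc_jetCoord {k l : ℕ} (hl : l ≤ k) {x : X} (hx : x ∈ s.domain)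
    (hc : s.toFun x ∈ c.total.source) :
    (c.jetCoord (s.jet k hx)).trunc l = (jetProl (c.expr s) (c.base x)).trunc l := by
  rw [c.jetCoord_jet hx hc]
  refine Prod.ext rfl ?_
  funext i σ
  simp [FinJetCoord.extend, JetCoord.trunc, multiIndices_mono hl σ.2]

/-- The section with coordinate expression `v`. -/
def sectionOf (V : Set (Euc n)) (v : Euc n → Euc m) (hV : IsOpen V) (hv : ContDiffOn ℝ ∞ v V)
    (hΩ : ∀ z ∈ V, (z, v z) ∈ c.total.target) : LocalSection π where
  domain := c.base.source ∩ c.base ⁻¹' V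
  isOpen_domain := c.base.isOpen_inter_preimage hV
  toFun x := c.total.symm (c.base x, v (c.base x))
  smooth := by
    refine (contMDiffOn_symm_of_mem_maximalAtlas c.total_mem).comp ?_ fun _ hx => hΩ _ hx.2
    have hb : ContMDiffOn 𝓘(ℝ, Euc n) 𝓘(ℝ, Euc n) ∞ c.base (c.base.source ∩ c.base ⁻¹' V) :=
      (contMDiffOn_of_mem_maximalAtlas c.base_mem).mono fun _ hx => hx.1
    exact hb.prodMk_space (hv.contMDiffOn.comp hb fun _ hx => hx.2)
  isSection := by
    rintro x ⟨hx, hxV⟩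
    have hs := c.total.map_target (hΩ _ hxV)
    apply c.base.injOn (c.proj_mem _ hs) hx
    rw [← c.fst_total _ hs, c.total.right_inv (hΩ _ hxV)]

section

variable {V : Set (Euc n)} {v : Euc n → Euc m} (hV : IsOpen V) (hv : ContDiffOn ℝ ∞ v V)
  (hΩ : ∀ z ∈ V, (z, v z) ∈ c.total.target)

lemma symm_mem_sectionOf {z : Euc n} (hz : z ∈ V) :
    c.base.symm z ∈ (c.sectionOf V v hV hv hΩ).domain := by
  have hb := c.fst_mem_base_target (hΩ z hz)
  refine ⟨c.base.map_target hb, ?_⟩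
  rw [mem_preimage, c.base.right_inv hb]
  exact hz

lemma sectionOf_symm {z : Euc n} (hz : z ∈ V) :
    (c.sectionOf V v hV hv hΩ).toFun (c.base.symm z) = c.total.symm (z, v z) := by
  simp only [sectionOf, c.base.right_inv (c.fst_mem_base_target (hΩ z hz))]

lemma expr_sectionOf : EqOn (c.expr (c.sectionOf V v hV hv hΩ)) v V := by
  intro z hz
  rw [expr, c.sectionOf_symm hV hv hΩ hz, c.total.right_inv (hΩ z hz)]

lemma jetProl_sectionOf {z : Euc n} (hz : z ∈ V) :
    jetProl (c.expr (c.sectionOf V v hV hv hΩ)) z = jetProl v z :=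
  jetProl_congr hV (c.expr_sectionOf hV hv hΩ) hz

end

/-- The `k`-jet with coordinates `p` is the jet of a section whose jet coordinates of order at
most `k` are those of `p`. -/
lemma exists_section (k : ℕ) {p : JetCoord n m} (hp : p.point ∈ c.total.target) :
    ∃ (s : LocalSection π) (hx : c.base.symm p.1 ∈ s.domain),
      s.toFun (c.base.symm p.1) = c.total.symm p.point ∧
      (jetProl (c.expr s) p.1).trunc k = p.trunc k ∧ c.jetOf k hp = s.jet k hx := by
  refine ⟨c.taylorSection k p, c.mem_taylorSection_domain k hp, ?_, ?_, rfl⟩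
  · have hb := c.fst_mem_base_target hp
    simp only [taylorSection, JetCoord.point] at hb ⊢
    rw [c.base.right_inv hb, taylorPoly_self]
  · have h1 : EqOn (c.expr (c.taylorSection k p)) (taylorPoly k p)
        (c.exprDomain (c.taylorSection k p)) := by
      intro z hz
      have h2 := hz.2.1.2
      simp only [taylorSection, expr]
      rw [c.total.right_inv h2, c.base.right_inv hz.1]
    have h3 := c.base_mem_exprDomain (c.mem_taylorSection_domain k hp)
      (c.total.map_target (c.mem_taylorSection_domain k hp).2)
    rw [c.base.right_inv (show p.1 ∈ c.base.target from c.fst_mem_base_target hp)] at h3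
    rw [jetProl_congr (c.isOpen_exprDomain _) h1 h3, jetProl_taylorPoly, trunc_extend]

end AdaptedChart

end Charts

section Frames

variable {n m : ℕ} {X Y : Type*}
  [TopologicalSpace X] [ChartedSpace (Euc n) X] [IsManifold 𝓘(ℝ, Euc n) ∞ X]
  [TopologicalSpace Y] [ChartedSpace (Euc n × Euc m) Y]
  [IsManifold 𝓘(ℝ, Euc n × Euc m) ∞ Y]
  {π : FiberedManifold n m X Y}

namespace AdaptedChart

variable (c c' : AdaptedChart π) {s : LocalSection π} {x : X} {y : Y}

/-! ### Frames, volume forms and vertical coordinates -/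

lemma mfderiv_base_baseFrame (hx : x ∈ c.base.source) (l : Fin n) :
    mfderiv 𝓘(ℝ, Euc n) 𝓘(ℝ, Euc n) c.base x (c.baseFrame x l) = (unitVec l : Euc n) := by
  have h : (mfderiv 𝓘(ℝ, Euc n) 𝓘(ℝ, Euc n) c.base x).IsInvertible :=
    ⟨c.base_mdifferentiable.mfderiv hx, rfl⟩
  exact h.self_apply_inverse _

lemma volumeForm_baseFrame (hx : x ∈ c.base.source) : c.volumeForm x (c.baseFrame x) = 1 := by
  have h : c.volumeForm x (c.baseFrame x) = (EuclideanSpace.basisFun (Fin n) ℝ).toBasis.det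
      (fun l => mfderiv 𝓘(ℝ, Euc n) 𝓘(ℝ, Euc n) c.base x (c.baseFrame x l)) := rfl
  rw [h]
  have h2 : (fun l => (mfderiv 𝓘(ℝ, Euc n) 𝓘(ℝ, Euc n) c.base x (c.baseFrame x l) : Euc n)) =
      (EuclideanSpace.basisFun (Fin n) ℝ).toBasis := by
    funext l
    rw [c.mfderiv_base_baseFrame hx]
    simp
    rfl
  exact (congrArg _ h2).trans (Module.Basis.det_self _)

/-- The space of `n`-forms at a point is spanned by the volume form of the chart. -/
lemma eq_smul_volumeForm (hx : x ∈ c.base.source) (α : TopForm n X x) :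
    α = α (c.baseFrame x) • c.volumeForm x := by
  let e : TangentSpace 𝓘(ℝ, Euc n) x ≃L[ℝ] Euc n := c.base_mdifferentiable.mfderiv hx
  let b : Module.Basis (Fin n) ℝ (TangentSpace 𝓘(ℝ, Euc n) x) :=
    (EuclideanSpace.basisFun (Fin n) ℝ).toBasis.map e.symm.toLinearEquiv
  have hb : (b : Fin n → TangentSpace 𝓘(ℝ, Euc n) x) = c.baseFrame x := by
    funext l
    apply e.injective
    refine Eq.trans ?_ (c.mfderiv_base_baseFrame hx l).symm
    simp [b]
  have hvol : c.volumeForm x = b.det := by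
    have h := (c.volumeForm x).eq_smul_basis_det b
    rwa [hb, c.volumeForm_baseFrame hx, one_smul] at h
  have h := α.eq_smul_basis_det b
  rwa [hb, ← hvol] at h

lemma base_mem_baseChange (hx : x ∈ c.base.source) (hx' : x ∈ c'.base.source) :
    c.base x ∈ (c.baseChange c').source := by
  simp only [baseChange, mfld_simps]
  exact ⟨c.base.map_source hx, by rwa [c.base.left_inv hx]⟩

lemma mfderiv_base_change (hx : x ∈ c.base.source) (hx' : x ∈ c'.base.source)
    (v : TangentSpace 𝓘(ℝ, Euc n) x) :
    mfderiv 𝓘(ℝ, Euc n) 𝓘(ℝ, Euc n) c'.base x v =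
      fderiv ℝ (c.baseChange c') (c.base x) (mfderiv 𝓘(ℝ, Euc n) 𝓘(ℝ, Euc n) c.base x v) := by
  have hd : MDifferentiableAt 𝓘(ℝ, Euc n) 𝓘(ℝ, Euc n) (c.baseChange c') (c.base x) :=
    ((c.isCoordChange c').hasFDerivAt_base
      (c.base_mem_baseChange c' hx hx')).differentiableAt.mdifferentiableAt
  have h1 : mfderiv 𝓘(ℝ, Euc n) 𝓘(ℝ, Euc n) c'.base x =
      mfderiv 𝓘(ℝ, Euc n) 𝓘(ℝ, Euc n) (c.baseChange c' ∘ c.base) x := by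
    apply Filter.EventuallyEq.mfderiv_eq
    filter_upwards [c.base.open_source.mem_nhds hx] with z hz
    exact (c.baseChange_base c' hz).symm
  rw [mfderiv_comp x hd (c.base_mdifferentiable.mdifferentiableAt hx), mfderiv_eq_fderiv] at h1
  exact DFunLike.congr_fun h1 v

lemma volumeForm_change (hx : x ∈ c.base.source) (hx' : x ∈ c'.base.source) :
    c'.volumeForm x = (fderiv ℝ (c.baseChange c') (c.base x)).det • c.volumeForm x := by
  rw [c.eq_smul_volumeForm hx (c'.volumeForm x)]
  congr 1
  have h : c'.volumeForm x (c.baseFrame x) = (EuclideanSpace.basisFun (Fin n) ℝ).toBasis.det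
      (fun l => mfderiv 𝓘(ℝ, Euc n) 𝓘(ℝ, Euc n) c'.base x (c.baseFrame x l)) := rfl
  have h2 : (fun l => (mfderiv 𝓘(ℝ, Euc n) 𝓘(ℝ, Euc n) c'.base x (c.baseFrame x l) : Euc n)) =
      (fderiv ℝ (c.baseChange c') (c.base x)).toLinearMap ∘
        (EuclideanSpace.basisFun (Fin n) ℝ).toBasis := by
    funext l
    rw [c.mfderiv_base_change c' hx hx']
    simp only [Function.comp_apply, OrthonormalBasis.coe_toBasis, EuclideanSpace.basisFun_apply]
    exact congrArg _ (c.mfderiv_base_baseFrame hx l)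
  rw [h]
  refine (congrArg _ h2).trans ?_
  rw [Module.Basis.det_comp, Module.Basis.det_self, mul_one]

/-- Vertical vectors have no base components. -/
lemma fst_mfderiv_total (hy : y ∈ c.total.source) (v : Vert π y) :
    (mfderiv 𝓘(ℝ, Euc n × Euc m) 𝓘(ℝ, Euc n × Euc m) c.total y
      (v : TangentSpace 𝓘(ℝ, Euc n × Euc m) y) : Euc n × Euc m).1 = 0 := by
  have hb := c.proj_mem y hy
  have dp : MDifferentiableAt 𝓘(ℝ, Euc n × Euc m) 𝓘(ℝ, Euc n) π.proj y := by
    obtain ⟨F, _, _, hF⟩ := π.submersion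
    exact (hF y).contMDiffAt.mdifferentiableAt (by simp)
  have hfst : MDifferentiableAt 𝓘(ℝ, Euc n × Euc m) 𝓘(ℝ, Euc n)
      (Prod.fst : Euc n × Euc m → Euc n) (c.total y) :=
    differentiableAt_fst.mdifferentiableAt
  have key : mfderiv 𝓘(ℝ, Euc n × Euc m) 𝓘(ℝ, Euc n) (c.base ∘ π.proj) y =
      mfderiv 𝓘(ℝ, Euc n × Euc m) 𝓘(ℝ, Euc n) (Prod.fst ∘ c.total) y := by
    apply Filter.EventuallyEq.mfderiv_eq
    filter_upwards [c.total.open_source.mem_nhds hy] with z hz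
    exact (c.fst_total z hz).symm
  rw [mfderiv_comp y (c.base_mdifferentiable.mdifferentiableAt hb) dp,
    mfderiv_comp y hfst (c.total_mdifferentiable.mdifferentiableAt hy)] at key
  have hd : mfderiv 𝓘(ℝ, Euc n × Euc m) 𝓘(ℝ, Euc n) (Prod.fst : Euc n × Euc m → Euc n)
      (c.total y) = ContinuousLinearMap.fst ℝ (Euc n) (Euc m) := by
    rw [mfderiv_eq_fderiv]
    exact fderiv_fst
  have hv : mfderiv 𝓘(ℝ, Euc n × Euc m) 𝓘(ℝ, Euc n) π.proj y
      (v : TangentSpace 𝓘(ℝ, Euc n × Euc m) y) = 0 := v.2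
  have h1 := DFunLike.congr_fun key (v : TangentSpace 𝓘(ℝ, Euc n × Euc m) y)
  have h2 := DFunLike.congr_fun hd (mfderiv 𝓘(ℝ, Euc n × Euc m) 𝓘(ℝ, Euc n × Euc m) c.total y
      (v : TangentSpace 𝓘(ℝ, Euc n × Euc m) y) : Euc n × Euc m)
  refine (h1.trans h2).symm.trans ?_
  refine (congrArg (mfderiv 𝓘(ℝ, Euc n) 𝓘(ℝ, Euc n) c.base (π.proj y)) hv).trans ?_
  exact map_zero (mfderiv 𝓘(ℝ, Euc n) 𝓘(ℝ, Euc n) c.base (π.proj y))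

lemma mfderiv_total_vert (hy : y ∈ c.total.source) (v : Vert π y) :
    (mfderiv 𝓘(ℝ, Euc n × Euc m) 𝓘(ℝ, Euc n × Euc m) c.total y
      (v : TangentSpace 𝓘(ℝ, Euc n × Euc m) y) : Euc n × Euc m) =
      ∑ j, c.vertCoord y j v • ((0 : Euc n), (EuclideanSpace.single j 1 : Euc m)) := by
  refine Prod.ext ?_ ?_
  · rw [c.fst_mfderiv_total hy v, Prod.fst_sum]
    simp
  · rw [Prod.snd_sum]
    ext i
    simp only [Prod.smul_snd, WithLp.ofLp_sum, Finset.sum_apply, WithLp.ofLp_smul, Pi.smul_apply,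
      smul_eq_mul]
    rw [Finset.sum_eq_single i]
    · simp [vertCoord]
      rfl
    · intro j _ hj
      simp [Ne.symm hj]
    · simp

lemma totalChange_total (hy : y ∈ c.total.source) : c.totalChange c' (c.total y) = c'.total y := by
  simp [totalChange, c.total.left_inv hy]

lemma total_mem_totalChange (hy : y ∈ c.total.source) (hy' : y ∈ c'.total.source) :
    c.total y ∈ (c.totalChange c').source := by
  simp only [totalChange, mfld_simps]
  exact ⟨c.total.map_source hy, by rwa [c.total.left_inv hy]⟩

/-- Vertical components transform with the derivatives `∂y'^i/∂y^j`. -/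
lemma vertCoord_change (hy : y ∈ c.total.source) (hy' : y ∈ c'.total.source) (v : Vert π y)
    (i : Fin m) :
    c'.vertCoord y i v = ∑ j, c.vertCoord y j v *
      (fderiv ℝ (c.fiberChange c') (c.total y) (0, EuclideanSpace.single j 1)) i := by
  have hdf : HasFDerivAt (c.totalChange c') (fderiv ℝ (c.totalChange c') (c.total y)) (c.total y) :=
    (((c.contDiffOn_totalChange c').contDiffAt ((c.totalChange c').open_source.mem_nhds
      (c.total_mem_totalChange c' hy hy'))).differentiableAt (by simp)).hasFDerivAt
  have hd : MDifferentiableAt 𝓘(ℝ, Euc n × Euc m) 𝓘(ℝ, Euc n × Euc m) (c.totalChange c')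
      (c.total y) := hdf.differentiableAt.mdifferentiableAt
  have h1 : mfderiv 𝓘(ℝ, Euc n × Euc m) 𝓘(ℝ, Euc n × Euc m) c'.total y =
      mfderiv 𝓘(ℝ, Euc n × Euc m) 𝓘(ℝ, Euc n × Euc m) (c.totalChange c' ∘ c.total) y := by
    apply Filter.EventuallyEq.mfderiv_eq
    filter_upwards [c.total.open_source.mem_nhds hy] with z hz
    exact (c.totalChange_total c' hz).symm
  rw [mfderiv_comp y hd (c.total_mdifferentiable.mdifferentiableAt hy), mfderiv_eq_fderiv] at h1
  have h2 : mfderiv 𝓘(ℝ, Euc n × Euc m) 𝓘(ℝ, Euc n × Euc m) c'.total y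
      (v : TangentSpace 𝓘(ℝ, Euc n × Euc m) y) = fderiv ℝ (c.totalChange c') (c.total y)
        (mfderiv 𝓘(ℝ, Euc n × Euc m) 𝓘(ℝ, Euc n × Euc m) c.total y
          (v : TangentSpace 𝓘(ℝ, Euc n × Euc m) y)) := DFunLike.congr_fun h1 _
  have h3 : fderiv ℝ (c.fiberChange c') (c.total y) =
      (ContinuousLinearMap.snd ℝ (Euc n) (Euc m)).comp
        (fderiv ℝ (c.totalChange c') (c.total y)) :=
    ((ContinuousLinearMap.snd ℝ (Euc n) (Euc m)).hasFDerivAt.comp (c.total y) hdf).fderiv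
  have h4 : c'.vertCoord y i v = (fderiv ℝ (c.totalChange c') (c.total y)
      (∑ j, c.vertCoord y j v • ((0 : Euc n), (EuclideanSpace.single j 1 : Euc m)))).2 i := by
    rw [← c.mfderiv_total_vert hy v]
    exact congrArg (fun q : Euc n × Euc m => q.2 i) h2
  rw [h4, h3, map_sum, Prod.snd_sum, WithLp.ofLp_sum, Finset.sum_apply]
  refine Finset.sum_congr rfl fun j _ => ?_
  rw [map_smul]
  rfl

lemma vertCoord_fiberVec (hy : y ∈ c.total.source) (i j : Fin m) :
    c.vertCoord y j ⟨c.fiberVec y i, c.fiberVec_mem hy i⟩ = if j = i then 1 else 0 := by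
  have h : (mfderiv 𝓘(ℝ, Euc n × Euc m) 𝓘(ℝ, Euc n × Euc m) c.total y).IsInvertible :=
    ⟨c.total_mdifferentiable.mfderiv hy, rfl⟩
  have h2 := h.self_apply_inverse ((0, EuclideanSpace.single i 1) : Euc n × Euc m)
  have h3 : c.vertCoord y j ⟨c.fiberVec y i, c.fiberVec_mem hy i⟩ =
      ((0, EuclideanSpace.single i 1) : Euc n × Euc m).2 j :=
    congrArg (fun q : Euc n × Euc m => q.2 j) h2
  rw [h3]
  simp

/-- The components of a smooth vertical field are smooth functions of order zero. -/
lemma jetSmoothOn_fieldComp (Ξ : VerticalField π) (i : Fin m) (k : ℕ) :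
    JetSmoothOn c.total.target k (c.fieldComp Ξ i) := by
  refine JetSmoothOn.of_point (a := fun q => c.vertCoord (c.total.symm q) i
    (Ξ.toFun (c.total.symm q))) ?_
  have hs : ContMDiffOn 𝓘(ℝ, Euc n × Euc m) 𝓘(ℝ, Euc n × Euc m) ∞ c.total.symm c.total.target :=
    contMDiffOn_symm_of_mem_maximalAtlas c.total_mem
  have ht := (contMDiffOn_of_mem_maximalAtlas c.total_mem).contMDiffOn_tangentMapWithin
    (m := ∞) (by simp) c.total.open_source.uniqueMDiffOn
  have h1 := ht.comp (Ξ.smooth.comp_contMDiffOn hs) fun q hq => c.total.map_target hq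
  have h2 := (contMDiff_snd_tangentBundle_modelSpace (Euc n × Euc m)
    𝓘(ℝ, Euc n × Euc m)).comp_contMDiffOn h1
  let G : Euc n × Euc m → Euc n × Euc m := fun q =>
    mfderivWithin 𝓘(ℝ, Euc n × Euc m) 𝓘(ℝ, Euc n × Euc m) c.total c.total.source
      (c.total.symm q) (Ξ.toFun (c.total.symm q) :
        TangentSpace 𝓘(ℝ, Euc n × Euc m) (c.total.symm q))
  have hG : ContDiffOn ℝ ∞ G c.total.target := contMDiffOn_iff_contDiffOn.mp h2
  have h3 := contDiffOn_coord (contDiff_snd.comp_contDiffOn hG) i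
  refine h3.congr fun q hq => ?_
  have hy := c.total.map_target hq
  have hGq : G q = mfderiv 𝓘(ℝ, Euc n × Euc m) 𝓘(ℝ, Euc n × Euc m) c.total (c.total.symm q)
      (Ξ.toFun (c.total.symm q) : TangentSpace 𝓘(ℝ, Euc n × Euc m) (c.total.symm q)) :=
    DFunLike.congr_fun (mfderivWithin_of_mem_nhds (c.total.open_source.mem_nhds hy)) _
  exact congrArg (fun q : Euc n × Euc m => q.2 i) hGq.symm

end AdaptedChart

end Frames

section EulerLagrange

variable {n m : ℕ} {X Y : Type*}
  [TopologicalSpace X] [ChartedSpace (Euc n) X] [IsManifold 𝓘(ℝ, Euc n) ∞ X]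
  [TopologicalSpace Y] [ChartedSpace (Euc n × Euc m) Y]
  [IsManifold 𝓘(ℝ, Euc n × Euc m) ∞ Y]
  {π : FiberedManifold n m X Y}

namespace AdaptedChart

variable (c c' : AdaptedChart π) {k : ℕ} {s : LocalSection π} {x : X}

/-! ### Lagrangians in charts -/

lemma point_eq_of_trunc_eq {p : JetCoord n m} (hx : x ∈ s.domain) (hc : s.toFun x ∈ c.total.source)
    (h : p.trunc k = (jetProl (c.expr s) (c.base x)).trunc k) :
    p.point = c.total (s.toFun x) := by
  have h1 := congrArg (fun q => q.extend.point) h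
  simp only [point_extend_trunc, point_jetProl] at h1
  rw [h1, c.total_section hx hc]

/-- The component of a density at `p` is its value, on the coordinate frame, at the jet of any
section with jet coordinates `p`. -/
lemma densityComp_eq (L : Density π k) (hx : x ∈ s.domain) (hc : s.toFun x ∈ c.total.source)
    {p : JetCoord n m} (h : p.trunc k = (jetProl (c.expr s) (c.base x)).trunc k) :
    c.densityComp L p = L x (s.jet k hx) (c.baseFrame x) := by
  have hb := c.mem_base_source hx hc
  have hpp := c.point_eq_of_trunc_eq hx hc h
  have hp : p.point ∈ c.total.target := by
    rw [hpp]
    exact c.total.map_source hc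
  have hp1 : p.1 = c.base x := congrArg Prod.fst h
  have hxp : c.base.symm p.1 = x := by rw [hp1, c.base.left_inv hb]
  obtain ⟨t, ht, hts, htp, htj⟩ := c.exists_section k hp
  rw [densityComp, dif_pos hp, htj]
  -- Identify the base point of `c.jetOf` with `x`, on which the type of the jet depends.
  clear htj
  have hct : t.toFun (c.base.symm p.1) ∈ c.total.source := by
    rw [hts]
    exact c.total.map_target hp
  rw [h, hp1] at htp
  clear hts
  revert ht hct
  rw [hxp]
  intro ht hct
  rw [c.jet_eq_of_trunc_eq ht hx hct hc htp]

lemma densityComp_jetProl (L : Density π k) (hx : x ∈ s.domain) (hc : s.toFun x ∈ c.total.source) :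
    c.densityComp L (jetProl (c.expr s) (c.base x)) = L x (s.jet k hx) (c.baseFrame x) :=
  c.densityComp_eq L hx hc rfl

lemma jetSmoothOn_densityComp {L : Density π k} (hL : L.IsSmooth) :
    JetSmoothOn c.total.target k (c.densityComp L) := by
  refine ⟨hL c, fun p hp => ?_⟩
  obtain ⟨t, ht, hts, htp, -⟩ := c.exists_section k hp
  have hct : t.toFun (c.base.symm p.1) ∈ c.total.source := by
    rw [hts]
    exact c.total.map_target hp
  have hp1 : c.base (c.base.symm p.1) = p.1 := c.base.right_inv (c.fst_mem_base_target hp)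
  rw [← hp1] at htp
  rw [finPart, c.densityComp_eq L ht hct htp.symm, c.densityComp_eq L ht hct]
  rw [trunc_extend, hp1, ← htp, hp1]

/-- In two charts, the components of a density along a section differ by the Jacobian. -/
lemma densityComp_change (L : Density π k) (hx : x ∈ s.domain) (hc : s.toFun x ∈ c.total.source)
    (hc' : s.toFun x ∈ c'.total.source) :
    c.densityComp L (jetProl (c.expr s) (c.base x)) =
      (fderiv ℝ (c.baseChange c') (c.base x)).det *
        c'.densityComp L (jetProl (c'.expr s) (c'.base x)) := by
  have hb := c.mem_base_source hx hc
  have hb' := c'.mem_base_source hx hc'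
  rw [c.densityComp_jetProl L hx hc, c'.densityComp_jetProl L hx hc']
  conv_lhs => rw [c'.eq_smul_volumeForm hb' (L x (s.jet k hx)), c.volumeForm_change c' hb hb']
  simp only [AlternatingMap.smul_apply, smul_eq_mul, c.volumeForm_baseFrame hb]
  ring

/-- The transformation law of the Euler--Lagrange expressions of a Lagrangian. -/
lemma eulerExpr_change {L : Density π k} (hL : L.IsSmooth) (hx : x ∈ s.domain)
    (hc : s.toFun x ∈ c.total.source) (hc' : s.toFun x ∈ c'.total.source) (j : Fin m) :
    eulerExpr k (c.densityComp L) j (jetProl (c.expr s) (c.base x)) =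
      (fderiv ℝ (c.baseChange c') (c.base x)).det *
        ∑ i, (fderiv ℝ (c.fiberChange c') (c.total (s.toFun x)) (0, EuclideanSpace.single j 1)) i *
          eulerExpr k (c'.densityComp L) i (jetProl (c'.expr s) (c'.base x)) := by
  have hsub := c.commonDomain_subset c' (s := s)
  have hcc := (c.isCoordChange c').restrict (c.isOpen_commonDomain c' (s := s)) hsub
  rw [c.jetProl_expr_eq c' hx hc hc', c.total_section hx hc]
  refine hcc.eulerExpr_transport ((c.jetSmoothOn_densityComp hL).subset ?_)
    (c'.jetSmoothOn_densityComp hL) ?_ (c.contDiffOn_expr.mono fun z hz => hz.1)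
    (fun z hz => ⟨c.graph_mem_totalChange c' hz, hz⟩) j (c.base_mem_commonDomain c' hx hc hc')
  · intro p hp
    have := hp.1
    simp only [totalChange, mfld_simps] at this
    exact this.1
  · -- Realize the map `v` by a section and compare the components of `L` along it.
    intro V v hV hVU hv hΩ z hz
    have hΩc : ∀ z ∈ V, (z, v z) ∈ (c.totalChange c').source := fun z hz => (hΩ z hz).1
    have hΩt : ∀ z ∈ V, (z, v z) ∈ c.total.target := fun z hz => by
      have := hΩc z hz
      simp only [totalChange, mfld_simps] at this
      exact this.1
    set t := c.sectionOf V v hV hv hΩt with ht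
    have hzt : z ∈ c.base.target := c.fst_mem_base_target (hΩt z hz)
    have hxt : c.base.symm z ∈ t.domain := c.symm_mem_sectionOf hV hv hΩt hz
    have htz : ∀ z ∈ V, t.toFun (c.base.symm z) = c.total.symm (z, v z) := fun z hz =>
      c.sectionOf_symm hV hv hΩt hz
    have hct : ∀ z ∈ V, t.toFun (c.base.symm z) ∈ c.total.source := fun z hz => by
      rw [htz z hz]
      exact c.total.map_target (hΩt z hz)
    have hct' : ∀ z ∈ V, t.toFun (c.base.symm z) ∈ c'.total.source := fun z hz => by
      have := hΩc z hz
      simp only [totalChange, mfld_simps] at this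
      rw [htz z hz]
      exact this.2
    have h1 := c.densityComp_change c' L hxt (hct z hz) (hct' z hz)
    rw [c.jetProl_expr_eq c' hxt (hct z hz) (hct' z hz), c.base.right_inv hzt,
      c.jetProl_sectionOf hV hv hΩt hz] at h1
    rw [h1]
    congr 2
    have hcc' := c.isCoordChange c'
    refine jetProl_congr (hcc'.isOpen_inv_preimage hV) (fun y hy => ?_)
      ⟨hcc'.mapsTo_base (hsub (hVU hz)), ?_⟩
    · simp only [transport]
      rw [c.expr_sectionOf hV hv hΩt hy.2]
    · rw [mem_preimage, hcc'.left_inv _ (hsub (hVU hz))]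
      exact hz

/-! ### The Euler--Lagrange morphism in charts -/

/-- The Euler--Lagrange morphism is given by the Euler--Lagrange expressions in every adapted
chart. -/
theorem eulerLagrange_jet {L : Density π k} (hL : L.IsSmooth) (hx : x ∈ s.domain)
    (hc : s.toFun x ∈ c.total.source) (v : Vert π (s.toFun x)) :
    eulerLagrange L x (s.jet (2 * k) hx) v =
      (∑ i, c.vertCoord (s.toFun x) i v *
        eulerExpr k (c.densityComp L) i (jetProl (c.expr s) (c.base x))) • c.volumeForm x := by
  -- The chart used in the definition of `eulerLagrange` at this jet.
  set c₀ := adaptedChartAt π (s.toFun x) with hc₀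
  have hc₀s : s.toFun x ∈ c₀.total.source := (exists_adaptedChart π (s.toFun x)).choose_spec
  have hb := c.mem_base_source hx hc
  have hb₀ := c₀.mem_base_source hx hc₀s
  have h1 : eulerLagrange L x (s.jet (2 * k) hx) v =
      ∑ i, c₀.vertCoord (s.toFun x) i v •
        c₀.formAt (eulerExpr k (c₀.densityComp L) i) (s.jet (2 * k) hx) := by
    have h2 : eulerLagrange L x (s.jet (2 * k) hx) v =
        (∑ i, (c₀.vertCoord (s.toFun x) i).smulRight
          (c₀.formAt (eulerExpr k (c₀.densityComp L) i) (s.jet (2 * k) hx))) v := rfl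
    rw [h2, LinearMap.sum_apply]
    rfl
  have h3 : ∀ i, c₀.formAt (eulerExpr k (c₀.densityComp L) i) (s.jet (2 * k) hx) =
      eulerExpr k (c₀.densityComp L) i (jetProl (c₀.expr s) (c₀.base x)) • c₀.volumeForm x := by
    intro i
    rw [formAt]
    congr 1
    refine (((c₀.jetSmoothOn_densityComp hL).eulerExpr c₀.total.open_target i).eq_of_trunc_eq ?_
      (c₀.trunc_jetCoord le_rfl hx hc₀s).symm).symm
    rw [point_jetProl, ← c₀.total_section hx hc₀s]
    exact c₀.total.map_source hc₀s
  rw [h1]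
  -- The Jacobian of the volume forms cancels that of the expressions, and the derivatives
  -- `∂y'^i/∂y^j` pass from the components of `v` to the expressions.
  simp only [h3, c.volumeForm_change c₀ hb hb₀, smul_smul]
  rw [← Finset.sum_smul]
  congr 1
  simp only [c.eulerExpr_change c₀ hL hx hc hc₀s, c.vertCoord_change c₀ hc hc₀s v,
    Finset.sum_mul, Finset.mul_sum]
  rw [Finset.sum_comm]
  refine Finset.sum_congr rfl fun j _ => Finset.sum_congr rfl fun i _ => ?_
  ring

/-- The components of the Euler--Lagrange morphism are the Euler--Lagrange expressions. -/
lemma sourceComp_eulerLagrange {L : Density π k} (hL : L.IsSmooth) (i : Fin m) {p : JetCoord n m}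
    (hp : p.point ∈ c.total.target) :
    c.sourceComp (eulerLagrange L) i p = eulerExpr k (c.densityComp L) i p := by
  have hct := c.target_jetOf_mem (2 * k) hp
  have hb : c.base.symm p.1 ∈ c.base.source := c.base.map_target (c.fst_mem_base_target hp)
  have hp1 : c.base (c.base.symm p.1) = p.1 := c.base.right_inv (c.fst_mem_base_target hp)
  rw [sourceComp, dif_pos hp]
  have h1 := c.eulerLagrange_jet hL (c.mem_taylorSection_domain (2 * k) hp) hct
    ⟨c.fiberVec (c.jetOf (2 * k) hp).target i, c.fiberVec_mem hct i⟩
  refine (DFunLike.congr_fun h1 (c.baseFrame (c.base.symm p.1))).trans ?_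
  rw [AlternatingMap.smul_apply, c.volumeForm_baseFrame hb, smul_eq_mul, mul_one]
  have h2 : ∀ j, c.vertCoord ((c.taylorSection (2 * k) p).toFun (c.base.symm p.1)) j
      ⟨c.fiberVec (c.jetOf (2 * k) hp).target i, c.fiberVec_mem hct i⟩ =
        if j = i then 1 else 0 := fun j => c.vertCoord_fiberVec hct i j
  simp only [h2, ite_mul, one_mul, zero_mul, Finset.sum_ite_eq', Finset.mem_univ, if_true]
  obtain ⟨t, ht, hts, htp, htj⟩ := c.exists_section (2 * k) hp
  refine (((c.jetSmoothOn_densityComp hL).eulerExpr c.total.open_target i).eq_of_trunc_eq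
    hp ?_).symm
  rw [← c.trunc_jetCoord le_rfl (c.mem_taylorSection_domain (2 * k) hp) hct]
  have h3 : (c.taylorSection (2 * k) p).jet (2 * k) (c.mem_taylorSection_domain (2 * k) hp) =
      t.jet (2 * k) ht := htj
  have hct' : t.toFun (c.base.symm p.1) ∈ c.total.source := by
    rw [hts]
    exact c.total.map_target hp
  rw [h3, c.trunc_jetCoord le_rfl ht hct', hp1, htp]

lemma fieldComp_eq (Ξ : VerticalField π) (i : Fin m) {p : JetCoord n m} {y : Y}
    (h : c.total.symm p.point = y) : c.fieldComp Ξ i p = c.vertCoord y i (Ξ.toFun y) := by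
  subst h
  rfl

/-- The component of the density `Ξ ⌋ E(L)` is `Ξ^j E(L)_j`. -/
lemma densityComp_contract {L : Density π k} (hL : L.IsSmooth) (Ξ : VerticalField π)
    {p : JetCoord n m} (hp : p.point ∈ c.total.target) :
    c.densityComp ((eulerLagrange L).contract Ξ) p =
      ∑ j, c.fieldComp Ξ j p * eulerExpr k (c.densityComp L) j p := by
  obtain ⟨t, ht, hts, htp, -⟩ := c.exists_section (2 * k) hp
  have hct : t.toFun (c.base.symm p.1) ∈ c.total.source := by
    rw [hts]
    exact c.total.map_target hp
  have hb : c.base.symm p.1 ∈ c.base.source := c.base.map_target (c.fst_mem_base_target hp)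
  have hp1 : c.base (c.base.symm p.1) = p.1 := c.base.right_inv (c.fst_mem_base_target hp)
  rw [← hp1] at htp
  rw [c.densityComp_eq _ ht hct htp.symm]
  refine (DFunLike.congr_fun (c.eulerLagrange_jet hL ht hct (Ξ.toFun _)) _).trans ?_
  rw [AlternatingMap.smul_apply, c.volumeForm_baseFrame hb, smul_eq_mul, mul_one]
  refine Finset.sum_congr rfl fun j _ => ?_
  rw [c.fieldComp_eq Ξ j hts.symm]
  congr 1
  refine ((c.jetSmoothOn_densityComp hL).eulerExpr c.total.open_target j).eq_of_trunc_eq ?_ htp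
  rw [point_jetProl, ← c.total_section ht hct]
  exact c.total.map_source hct

lemma jetSmoothOn_contract {L : Density π k} (hL : L.IsSmooth) (Ξ : VerticalField π) :
    JetSmoothOn c.total.target (2 * k) (c.densityComp ((eulerLagrange L).contract Ξ)) :=
  (JetSmoothOn.sum fun j _ => (c.jetSmoothOn_fieldComp Ξ j _).mul
    ((c.jetSmoothOn_densityComp hL).eulerExpr c.total.open_target j)).congr
    fun _ hp => c.densityComp_contract hL Ξ hp

lemma verticalDifferential_eulerLagrange {L : Density π k} (hL : L.IsSmooth) (i j : Fin m)
    (σ : Fin n → ℕ) {p : JetCoord n m} (hp : p.point ∈ c.total.target) :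
    c.verticalDifferential (eulerLagrange L) i j σ p =
      dFiber i σ (eulerExpr k (c.densityComp L) j) p :=
  dFiber_congr c.total.open_target (fun _ hq => c.sourceComp_eulerLagrange hL j hq) i σ hp

/-- Along a critical section the Euler--Lagrange expressions vanish. -/
lemma eulerExpr_critical {L : Density π k} (hL : L.IsSmooth) (hs : s.IsCritical L) (i : Fin m)
    {z : Euc n} (hz : z ∈ c.exprDomain s) :
    eulerExpr k (c.densityComp L) i (jetProl (c.expr s) z) = 0 := by
  obtain ⟨hzt, hx, hc⟩ := hz
  have h1 := c.eulerLagrange_jet hL hx hc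
    ⟨c.fiberVec (s.toFun (c.base.symm z)) i, c.fiberVec_mem hc i⟩
  rw [hs _ hx] at h1
  have h2 := DFunLike.congr_fun h1 (c.baseFrame (c.base.symm z))
  rw [AlternatingMap.smul_apply, c.volumeForm_baseFrame (c.base.map_target hzt), smul_eq_mul,
    mul_one] at h2
  simp only [c.vertCoord_fiberVec hc, ite_mul, one_mul, zero_mul, Finset.sum_ite_eq',
    Finset.mem_univ, if_true, c.base.right_inv hzt] at h2
  exact h2.symm

end AdaptedChart

lemma nabla_congr {k : ℕ} {α β : FormComp n m} (ξ : Fin m → JetCoord n m → ℝ)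
    (j : Fin m) {p : JetCoord n m} (h : ∀ i σ, α i j σ p = β i j σ p) :
    nabla k α ξ j p = nabla k β ξ j p := by
  simp only [nabla, h]

lemma nablaAdjoint_congr {Ω : Set (Euc n × Euc m)} (hΩ : IsOpen Ω) {k : ℕ} {α β : FormComp n m}
    (ξ : Fin m → JetCoord n m → ℝ)
    (h : ∀ i j σ, ∀ p : JetCoord n m, p.point ∈ Ω → α i j σ p = β i j σ p) (i : Fin m)
    {p : JetCoord n m} (hp : p.point ∈ Ω) :
    nablaAdjoint k α ξ i p = nablaAdjoint k β ξ i p := by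
  refine Finset.sum_congr rfl fun j _ => Finset.sum_congr rfl fun σ _ => ?_
  rw [totalDerivs_congr hΩ (fun q hq => by rw [h i j σ q hq]) σ hp]

lemma JetSmoothOn.nabla {Ω : Set (Euc n × Euc m)} (hΩ : IsOpen Ω) {k : ℕ} {α : FormComp n m}
    {ξ : Fin m → JetCoord n m → ℝ} (hα : ∀ i j σ, JetSmoothOn Ω k (α i j σ))
    (hξ : ∀ i, JetSmoothOn Ω k (ξ i)) (j : Fin m) :
    JetSmoothOn Ω (2 * k) (nabla k α ξ j) :=
  .sum fun i _ => .sum fun σ hσ => (((hξ i).totalDerivs hΩ σ).of_le (by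
    have := mem_multiIndices.mp hσ
    omega)).mul ((hα i j σ).of_le (by omega))

lemma JetSmoothOn.nablaAdjoint {Ω : Set (Euc n × Euc m)} (hΩ : IsOpen Ω) {k : ℕ}
    {α : FormComp n m} {ξ : Fin m → JetCoord n m → ℝ} (hα : ∀ i j σ, JetSmoothOn Ω k (α i j σ))
    (hξ : ∀ i, JetSmoothOn Ω k (ξ i)) (i : Fin m) :
    JetSmoothOn Ω (2 * k) (nablaAdjoint k α ξ i) :=
  .sum fun j _ => .sum fun σ hσ => (JetSmoothOn.const _).mul <|
    ((((hα i j σ).mul (hξ j)).totalDerivs hΩ σ).of_le (by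
      have := mem_multiIndices.mp hσ
      omega))

end EulerLagrange

end SecondVariation

open SecondVariation in
theorem mainTheorem1 {n m r : ℕ} {X Y : Type*}
    [TopologicalSpace X] [ChartedSpace (Euc n) X] [IsManifold 𝓘(ℝ, Euc n) ∞ X]
    [TopologicalSpace Y] [ChartedSpace (Euc n × Euc m) Y]
    [IsManifold 𝓘(ℝ, Euc n × Euc m) ∞ Y]
    (π : FiberedManifold n m X Y)
    (L : Density π r) (hL : L.IsSmooth)
    (s : LocalSection π) (hs : s.IsCritical L)
    (Ξ₁ Ξ₂ : VerticalField π)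
    (x : X) (hx : x ∈ s.domain)
    (c : AdaptedChart π) (hc : s.toFun x ∈ c.total.source) :
    hessian L Ξ₁ Ξ₂ x (s.jet (2 * (2 * r)) hx) =
        c.formAt (jacobi c L Ξ₁ Ξ₂) (s.jet (2 * (2 * r)) hx) ∧
    hessian L Ξ₁ Ξ₂ x (s.jet (2 * (2 * r)) hx) =
        c.formAt (jacobiAdjoint c L Ξ₁ Ξ₂) (s.jet (2 * (2 * r)) hx) ∧
    ∀ i, nabla (2 * r) (c.verticalDifferential (eulerLagrange L)) (c.fieldComp Ξ₂) i
          (c.jetCoord (s.jet (2 * (2 * r)) hx)) =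
        nablaAdjoint (2 * r) (c.verticalDifferential (eulerLagrange L)) (c.fieldComp Ξ₂) i
          (c.jetCoord (s.jet (2 * (2 * r)) hx)) := by

  have hΩ := c.total.open_target
  have hU := c.isOpen_exprDomain s
  have hu : ContDiffOn ℝ ∞ (c.expr s) (c.exprDomain s) := c.contDiffOn_expr
  have hΩU : ∀ z ∈ c.exprDomain s, (z, c.expr s z) ∈ c.total.target := fun z hz =>
    c.graph_expr_mem hz
  have hxU := c.base_mem_exprDomain hx hc
  have hf := c.jetSmoothOn_densityComp hL
  have hE : ∀ j, JetSmoothOn c.total.target (2 * r) (eulerExpr r (c.densityComp L) j) := fun j =>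
    hf.eulerExpr hΩ j
  have hΞ : ∀ j, JetSmoothOn c.total.target (2 * r) (c.fieldComp Ξ₂ j) := fun j =>
    c.jetSmoothOn_fieldComp Ξ₂ j _
  set J := jetProl (c.expr s) (c.base x) with hJ
  set p := c.jetCoord (s.jet (2 * (2 * r)) hx) with hp
  have hJΩ : J.point ∈ c.total.target := by
    rw [hJ, point_jetProl]
    exact hΩU _ hxU
  have htr : p.trunc (2 * (2 * r)) = J.trunc (2 * (2 * r)) := c.trunc_jetCoord le_rfl hx hc
  have hpp : p.point = c.total (s.toFun x) := c.point_eq_of_trunc_eq hx hc htr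
  have hpΩ : p.point ∈ c.total.target := by
    rw [hpp]
    exact c.total.map_source hc
  have hpy : c.total.symm p.point = s.toFun x := by rw [hpp, c.total.left_inv hc]
  set β : FormComp n m := fun i j σ => dFiber i σ (eulerExpr r (c.densityComp L) j) with hβ
  have hβs : ∀ i j σ, JetSmoothOn c.total.target (2 * r) (β i j σ) := fun i j σ =>
    (hE j).dFiber hΩ i σ
  -- Both operators may be computed along the full jet prolongation of the section.
  have hn : ∀ i, nabla (2 * r) (c.verticalDifferential (eulerLagrange L)) (c.fieldComp Ξ₂) i p =
      nabla (2 * r) β (c.fieldComp Ξ₂) i J := fun i =>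
    (nabla_congr _ i fun a σ => c.verticalDifferential_eulerLagrange hL a i σ hpΩ).trans
      ((JetSmoothOn.nabla hΩ hβs hΞ i).eq_of_trunc_eq hpΩ htr)
  have ha : ∀ i, nablaAdjoint (2 * r) (c.verticalDifferential (eulerLagrange L))
      (c.fieldComp Ξ₂) i p = nablaAdjoint (2 * r) β (c.fieldComp Ξ₂) i J := fun i =>
    (nablaAdjoint_congr hΩ _ (fun a j σ q hq => c.verticalDifferential_eulerLagrange hL a j σ hq)
      i hpΩ).trans ((JetSmoothOn.nablaAdjoint hΩ hβs hΞ i).eq_of_trunc_eq hpΩ htr)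
  have hself : ∀ i, nabla (2 * r) β (c.fieldComp Ξ₂) i J =
      nablaAdjoint (2 * r) β (c.fieldComp Ξ₂) i J := fun i =>
    hf.nabla_eq_nablaAdjoint hΩ hU hu hΩU hΞ i hxU
  have hK : ((eulerLagrange L).contract Ξ₂).IsSmooth := fun c => (c.jetSmoothOn_contract hL Ξ₂).1
  have hess : hessian L Ξ₁ Ξ₂ x (s.jet (2 * (2 * r)) hx) =
      c.formAt (jacobiAdjoint c L Ξ₁ Ξ₂) (s.jet (2 * (2 * r)) hx) := by
    refine (c.eulerLagrange_jet hK hx hc (Ξ₁.toFun (s.toFun x))).trans ?_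
    rw [AdaptedChart.formAt]
    congr 1
    refine Finset.sum_congr rfl fun i _ => ?_
    rw [← hp, ha i, c.fieldComp_eq Ξ₁ i hpy]
    congr 1
    exact eulerExpr_contract_eq_nablaAdjoint hΩ hU hu hΩU hE hΞ
      (fun q hq => c.densityComp_contract hL Ξ₂ hq)
      (fun z hz j => c.eulerExpr_critical hL hs j hz) i hxU
  refine ⟨hess.trans ?_, hess, fun i => by rw [hn, ha, hself]⟩
  rw [AdaptedChart.formAt, AdaptedChart.formAt]
  congr 1
  refine Finset.sum_congr rfl fun i _ => ?_
  rw [← hp, ha i, hn i, hself i]
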